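/- Let $\mathcal P_k=\mathbb F_2[x_1,\dots,x_k]$ with $\deg x_i=1$, with its standard action of the mod $2$ Steenrod algebra $\mathcal A$: $Sq^0=\mathrm{id}$, $Sq^1x_i=x_i^2$, $Sq^jx_i=0$ for $j>1$, and the Cartan formula. Let $\overline{\mathcal A}\subset\mathcal A$ be the augmentation ideal, so that $\overline{\mathcal A}\mathcal P_k=\sum_{j\ge1}Sq^j(\mathcal P_k)$, and let $$(Q\mathcal P_k)_n=(\mathcal P_k)_n/(\overline{\mathcal A}\mathcal P_k\cap(\mathcal P_k)_n),$$ where $(\mathcal P_k)_n$ is the space of homogeneous polynomials of degree $n$; $[f]$ is the class of $f$. The group $GL_k(\mathbb F_2)$ acts on $\mathcal P_k$ by linear substitutions of the variables, hence on $(Q\mathcal P_k)_n$; the symmetric group $\Sigma_k\subset GL_k(\mathbb F_2)$ acts by permuting the variables. A superscript denotes invariants. When $n-k$ is even and non-negative, the Kameko homomorphism $(\widetilde{Sq}{}^0_*)_{(k,n)}:(Q\mathcal P_k)_n\to(Q\mathcal P_k)_{(n-k)/2}$ is the linear map that sends $[x_1^{a_1}\cdots x_k^{a_k}]$ to $[x_1^{(a_1-1)/2}\cdots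 x_k^{(a_k-1)/2}]$ if all $a_j$ are odd and to $0$ otherwise. Let $S_1,\dots,S_{16},G\in(\mathcal P_5)_{17}$ be the polynomials listed below. Then: 1. $\dim(Q\mathcal P_5)_{17}=566$. 2. $\dim(Q\mathcal P_5)_{17}^{\Sigma_5}=16$, and the classes $[S_1],\dots,[S_{16}]$ form a basis of $(Q\mathcal P_5)_{17}^{\Sigma_5}$. 3. $\dim(Q\mathcal P_5)_{17}^{GL_5(\mathbb F_2)}=1$, and this space is spanned by $[G]$. 4. $(Q\mathcal P_5)_6^{GL_5(\mathbb F_2)}=0$. 5. $\dim\big(\ker(\widetilde{Sq}{}^0_*)_{(5,17)}\big)^{GL_5(\mathbb F_2)}=1$. The polynomials (where a sum runs over increasing indices, $q_m$ is a polynomial in the variables $y_1,y_2,\dots$, as many as it has arguments) are: $$S_{1}=\sum_{1\le i<j<k<l\le 5} q_{1}(x_i,x_j,x_k,x_l),$$ $$q_{1}=y_1y_2y_3^2y_4^{13} + y_1y_2^{14}y_3y_4 + y_1y_2^2y_3y_4^{13} + y_1y_2^2y_3^{13}y_4 + y_1y_2^2y_3^7y_4^7 + y_1y_2^3y_3y_4^{12}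 + y_1y_2^3y_3^{12}y_4 + y_1y_2^6y_3^3y_4^7 + y_1y_2^6y_3^7y_4^3 + y_1y_2^7y_3^2y_4^7 + y_1y_2^7y_3^6y_4^3 + y_1y_2^7y_3^7y_4^2 + y_1^3y_2y_3y_4^{12} + y_1^3y_2y_3^{12}y_4 + y_1^3y_2y_3^4y_4^9 + y_1^3y_2y_3^5y_4^8 + y_1^3y_2y_3^6y_4^7 + y_1^3y_2y_3^7y_4^6 + y_1^3y_2^3y_3^4y_4^7 + y_1^3y_2^3y_3^5y_4^6 + y_1^3y_2^3y_3^7y_4^4 + y_1^3y_2^5y_3y_4^8 + y_1^3y_2^5y_3^2y_4^7 + y_1^3y_2^5y_3^3y_4^6 + y_1^3y_2^5y_3^6y_4^3 + y_1^3y_2^5y_3^7y_4^2 + y_1^3y_2^7y_3y_4^6 + y_1^3y_2^7y_3^3y_4^4 + y_1^3y_2^7y_3^5y_4^2 + y_1^7y_2y_3^2y_4^7 + y_1^7y_2y_3^6y_4^3 + y_1^7y_2y_3^7y_4^2 + y_1^7y_2^3y_3y_4^6 + y_1^7y_2^3y_3^3y_4^4 + y_1^7y_2^3y_3^5y_4^2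 + y_1^7y_2^7y_3y_4^2.$$ $$S_{2}=x_1x_2x_3^2x_4^{12}x_5 + x_1x_2x_3^2x_4^6x_5^7 + x_1x_2x_3^2x_4^7x_5^6 + x_1x_2x_3^6x_4^2x_5^7 + x_1x_2x_3^6x_4^7x_5^2 + x_1x_2x_3^7x_4^2x_5^6 + x_1x_2x_3^7x_4^6x_5^2 + x_1x_2^2x_3x_4x_5^{12} + x_1x_2^2x_3x_4^{12}x_5 + x_1x_2^2x_3^{12}x_4x_5 + x_1x_2^2x_3^3x_4^4x_5^7 + x_1x_2^2x_3^3x_4^7x_5^4 + x_1x_2^2x_3^4x_4^3x_5^7 + x_1x_2^2x_3^4x_4^5x_5^5 + x_1x_2^2x_3^4x_4^7x_5^3 + x_1x_2^2x_3^5x_4^4x_5^5 + x_1x_2^2x_3^5x_4^5x_5^4 + x_1x_2^2x_3^7x_4^3x_5^4 + x_1x_2^2x_3^7x_4^4x_5^3 + x_1x_2^3x_3x_4^4x_5^8 + x_1x_2^3x_3^2x_4^4x_5^7 + x_1x_2^3x_3^2x_4^7x_5^4 + x_1x_2^3x_3^4x_4x_5^8 + x_1x_2^3x_3^4x_4^4x_5^5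 + x_1x_2^3x_3^4x_4^5x_5^4 + x_1x_2^3x_3^5x_4^4x_5^4 + x_1x_2^3x_3^7x_4^2x_5^4 + x_1x_2^6x_3x_4^2x_5^7 + x_1x_2^6x_3x_4^7x_5^2 + x_1x_2^6x_3^7x_4x_5^2 + x_1x_2^7x_3x_4^2x_5^6 + x_1x_2^7x_3x_4^6x_5^2 + x_1x_2^7x_3^2x_4^3x_5^4 + x_1x_2^7x_3^2x_4^4x_5^3 + x_1x_2^7x_3^3x_4^2x_5^4 + x_1x_2^7x_3^6x_4x_5^2 + x_1^3x_2x_3x_4^4x_5^8 + x_1^3x_2x_3^2x_4^4x_5^7 + x_1^3x_2x_3^2x_4^7x_5^4 + x_1^3x_2x_3^4x_4^2x_5^7 + x_1^3x_2x_3^4x_4^4x_5^5 + x_1^3x_2x_3^4x_4^5x_5^4 + x_1^3x_2x_3^4x_4^7x_5^2 + x_1^3x_2x_3^5x_4^4x_5^4 + x_1^3x_2x_3^7x_4^2x_5^4 + x_1^3x_2x_3^7x_4^4x_5^2 + x_1^3x_2^4x_3x_4^2x_5^7 + x_1^3x_2^4x_3x_4^7x_5^2 + x_1^3x_2^4x_3^7x_4x_5^2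 + x_1^3x_2^5x_3x_4^4x_5^4 + x_1^3x_2^7x_3x_4^2x_5^4 + x_1^3x_2^7x_3x_4^4x_5^2 + x_1^3x_2^7x_3^4x_4x_5^2 + x_1^7x_2x_3x_4^2x_5^6 + x_1^7x_2x_3x_4^6x_5^2 + x_1^7x_2x_3^2x_4^3x_5^4 + x_1^7x_2x_3^2x_4^4x_5^3 + x_1^7x_2x_3^3x_4^2x_5^4 + x_1^7x_2x_3^6x_4x_5^2 + x_1^7x_2^3x_3x_4^2x_5^4 + x_1^7x_2^3x_3x_4^4x_5^2 + x_1^7x_2^3x_3^4x_4x_5^2.$$ $$S_{3}=x_1x_2x_3^3x_4^4x_5^8 + x_1x_2x_3^6x_4^3x_5^6 + x_1x_2x_3^6x_4^6x_5^3 + x_1x_2^2x_3x_4x_5^{12} + x_1x_2^2x_3x_4^{12}x_5 + x_1x_2^2x_3x_4^4x_5^9 + x_1x_2^2x_3x_4^5x_5^8 + x_1x_2^2x_3^{12}x_4x_5 + x_1x_2^2x_3^3x_4^5x_5^6 + x_1x_2^2x_3^3x_4^6x_5^5 + x_1x_2^2x_3^4x_4x_5^9 + x_1x_2^2x_3^4x_4^5x_5^5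 + x_1x_2^2x_3^4x_4^9x_5 + x_1x_2^2x_3^5x_4x_5^8 + x_1x_2^2x_3^5x_4^8x_5 + x_1x_2^3x_3x_4^4x_5^8 + x_1x_2^3x_3^4x_4x_5^8 + x_1x_2^3x_3^4x_4^8x_5 + x_1^3x_2x_3x_4^4x_5^8 + x_1^3x_2x_3^4x_4x_5^8 + x_1^3x_2x_3^4x_4^8x_5 + x_1^3x_2^3x_3^3x_4^4x_5^4 + x_1^3x_2^3x_3^4x_4^3x_5^4 + x_1^3x_2^3x_3^4x_4^4x_5^3.$$ $$S_{4}=x_1x_2x_3x_4^2x_5^{12} + x_1x_2^2x_3x_4x_5^{12} + x_1x_2^2x_3x_4^{12}x_5 + x_1x_2^2x_3x_4^4x_5^9 + x_1x_2^2x_3x_4^5x_5^8 + x_1x_2^2x_3^{12}x_4x_5 + x_1x_2^2x_3^4x_4x_5^9 + x_1x_2^2x_3^4x_4^5x_5^5 + x_1x_2^2x_3^4x_4^9x_5 + x_1x_2^2x_3^5x_4x_5^8 + x_1x_2^2x_3^5x_4^4x_5^5 + x_1x_2^2x_3^5x_4^5x_5^4 + x_1x_2^2x_3^5x_4^8x_5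 + x_1x_2^3x_3^4x_4x_5^8 + x_1x_2^3x_3^4x_4^4x_5^5 + x_1x_2^3x_3^4x_4^5x_5^4 + x_1x_2^3x_3^4x_4^8x_5 + x_1x_2^3x_3^5x_4^4x_5^4 + x_1^3x_2x_3^4x_4x_5^8 + x_1^3x_2x_3^4x_4^4x_5^5 + x_1^3x_2x_3^4x_4^5x_5^4 + x_1^3x_2x_3^4x_4^8x_5 + x_1^3x_2x_3^5x_4^4x_5^4 + x_1^3x_2^5x_3x_4^4x_5^4.$$ $$S_{5}=x_1x_2x_3^2x_4x_5^{12} + x_1x_2x_3^2x_4^6x_5^7 + x_1x_2x_3^2x_4^7x_5^6 + x_1x_2x_3^6x_4^2x_5^7 + x_1x_2x_3^6x_4^7x_5^2 + x_1x_2x_3^7x_4^2x_5^6 + x_1x_2x_3^7x_4^6x_5^2 + x_1x_2^2x_3x_4x_5^{12} + x_1x_2^2x_3x_4^{12}x_5 + x_1x_2^2x_3x_4^4x_5^9 + x_1x_2^2x_3x_4^5x_5^8 + x_1x_2^2x_3^{12}x_4x_5 + x_1x_2^2x_3^3x_4^4x_5^7 + x_1x_2^2x_3^3x_4^7x_5^4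 + x_1x_2^2x_3^4x_4x_5^9 + x_1x_2^2x_3^4x_4^3x_5^7 + x_1x_2^2x_3^4x_4^7x_5^3 + x_1x_2^2x_3^4x_4^9x_5 + x_1x_2^2x_3^5x_4x_5^8 + x_1x_2^2x_3^5x_4^8x_5 + x_1x_2^2x_3^7x_4^3x_5^4 + x_1x_2^2x_3^7x_4^4x_5^3 + x_1x_2^3x_3x_4^4x_5^8 + x_1x_2^3x_3^2x_4^4x_5^7 + x_1x_2^3x_3^2x_4^7x_5^4 + x_1x_2^3x_3^4x_4^8x_5 + x_1x_2^3x_3^7x_4^2x_5^4 + x_1x_2^6x_3x_4^2x_5^7 + x_1x_2^6x_3x_4^7x_5^2 + x_1x_2^6x_3^7x_4x_5^2 + x_1x_2^7x_3x_4^2x_5^6 + x_1x_2^7x_3x_4^6x_5^2 + x_1x_2^7x_3^2x_4^3x_5^4 + x_1x_2^7x_3^2x_4^4x_5^3 + x_1x_2^7x_3^3x_4^2x_5^4 + x_1x_2^7x_3^6x_4x_5^2 + x_1^3x_2x_3x_4^4x_5^8 + x_1^3x_2x_3^2x_4^4x_5^7 + x_1^3x_2x_3^2x_4^7x_5^4 +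 x_1^3x_2x_3^4x_4x_5^8 + x_1^3x_2x_3^4x_4^2x_5^7 + x_1^3x_2x_3^4x_4^7x_5^2 + x_1^3x_2x_3^4x_4^8x_5 + x_1^3x_2x_3^7x_4^2x_5^4 + x_1^3x_2x_3^7x_4^4x_5^2 + x_1^3x_2^4x_3x_4^2x_5^7 + x_1^3x_2^4x_3x_4^7x_5^2 + x_1^3x_2^4x_3^7x_4x_5^2 + x_1^3x_2^7x_3x_4^2x_5^4 + x_1^3x_2^7x_3x_4^4x_5^2 + x_1^3x_2^7x_3^4x_4x_5^2 + x_1^7x_2x_3x_4^2x_5^6 + x_1^7x_2x_3x_4^6x_5^2 + x_1^7x_2x_3^2x_4^3x_5^4 + x_1^7x_2x_3^2x_4^4x_5^3 + x_1^7x_2x_3^3x_4^2x_5^4 + x_1^7x_2x_3^6x_4x_5^2 + x_1^7x_2^3x_3x_4^2x_5^4 + x_1^7x_2^3x_3x_4^4x_5^2 + x_1^7x_2^3x_3^4x_4x_5^2.$$ $$S_{6}=x_1x_2x_3^3x_4^6x_5^6 + x_1x_2x_3^6x_4^3x_5^6 + x_1x_2x_3^6x_4^6x_5^3 + x_1x_2^2x_3x_4x_5^{12}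 + x_1x_2^2x_3x_4^{12}x_5 + x_1x_2^2x_3x_4^4x_5^9 + x_1x_2^2x_3x_4^5x_5^8 + x_1x_2^2x_3^{12}x_4x_5 + x_1x_2^2x_3^4x_4x_5^9 + x_1x_2^2x_3^4x_4^9x_5 + x_1x_2^2x_3^5x_4x_5^8 + x_1x_2^2x_3^5x_4^8x_5 + x_1x_2^3x_3x_4^6x_5^6 + x_1x_2^3x_3^2x_4^5x_5^6 + x_1x_2^3x_3^2x_4^6x_5^5 + x_1x_2^3x_3^5x_4^2x_5^6 + x_1x_2^3x_3^5x_4^6x_5^2 + x_1x_2^3x_3^6x_4x_5^6 + x_1x_2^3x_3^6x_4^2x_5^5 + x_1x_2^3x_3^6x_4^5x_5^2 + x_1x_2^3x_3^6x_4^6x_5 + x_1^3x_2x_3x_4^6x_5^6 + x_1^3x_2x_3^2x_4^5x_5^6 + x_1^3x_2x_3^2x_4^6x_5^5 + x_1^3x_2x_3^5x_4^2x_5^6 + x_1^3x_2x_3^5x_4^6x_5^2 + x_1^3x_2x_3^6x_4x_5^6 + x_1^3x_2x_3^6x_4^2x_5^5 + x_1^3x_2x_3^6x_4^5x_5^2 +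 x_1^3x_2x_3^6x_4^6x_5 + x_1^3x_2^3x_3^4x_4^3x_5^4 + x_1^3x_2^3x_3^4x_4^4x_5^3 + x_1^3x_2^3x_3^5x_4^2x_5^4 + x_1^3x_2^3x_3^5x_4^4x_5^2 + x_1^3x_2^5x_3x_4^2x_5^6 + x_1^3x_2^5x_3x_4^6x_5^2 + x_1^3x_2^5x_3^2x_4x_5^6 + x_1^3x_2^5x_3^2x_4^2x_5^5 + x_1^3x_2^5x_3^2x_4^5x_5^2 + x_1^3x_2^5x_3^2x_4^6x_5 + x_1^3x_2^5x_3^3x_4^2x_5^4 + x_1^3x_2^5x_3^3x_4^4x_5^2 + x_1^3x_2^5x_3^6x_4x_5^2 + x_1^3x_2^5x_3^6x_4^2x_5.$$ $$S_{7}=\sum_{1\le i<j<k\le 5} q_{7}(x_i,x_j,x_k),$$ $$q_{7}=y_1y_2y_3^{15} + y_1y_2^{15}y_3 + y_1^{15}y_2y_3.$$ $$S_{8}=\sum_{1\le i<j<k\le 5} q_{8}(x_i,x_j,x_k),$$ $$q_{8}=y_1y_2^3y_3^{13} + y_1^3y_2y_3^{13} + y_1^3y_2^{13}y_3.$$ $$S_{9}=x_1x_2x_3^2x_4^4x_5^9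 + x_1x_2x_3^2x_4^5x_5^8 + x_1x_2x_3^6x_4^3x_5^6 + x_1x_2x_3^6x_4^6x_5^3 + x_1x_2^2x_3^3x_4^5x_5^6 + x_1x_2^2x_3^3x_4^6x_5^5 + x_1x_2^2x_3^4x_4^5x_5^5 + x_1^3x_2^3x_3^3x_4^4x_5^4 + x_1^3x_2^3x_3^4x_4^3x_5^4 + x_1^3x_2^3x_3^4x_4^4x_5^3.$$ $$S_{10}=\sum_{1\le i<j<k<l\le 5} q_{10}(x_i,x_j,x_k,x_l),$$ $$q_{10}=y_1y_2y_3y_4^{14} + y_1y_2y_3^{14}y_4 + y_1y_2^3y_3y_4^{12} + y_1y_2^3y_3^{12}y_4 + y_1^3y_2y_3y_4^{12} + y_1^3y_2y_3^{12}y_4 + y_1^3y_2^5y_3y_4^8 + y_1^3y_2^5y_3^8y_4.$$ $$S_{11}=\sum_{1\le i<j<k\le 5} q_{11}(x_i,x_j,x_k),$$ $$q_{11}=y_1^3y_2^5y_3^9.$$ $$S_{12}=x_1x_2^3x_3^3x_4^3x_5^7 + x_1x_2^3x_3^3x_4^7x_5^3 + x_1x_2^3x_3^7x_4^3x_5^3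 + x_1x_2^7x_3^3x_4^3x_5^3 + x_1^3x_2x_3^3x_4^3x_5^7 + x_1^3x_2x_3^3x_4^7x_5^3 + x_1^3x_2x_3^7x_4^3x_5^3 + x_1^3x_2^3x_3x_4^3x_5^7 + x_1^3x_2^3x_3x_4^7x_5^3 + x_1^3x_2^3x_3^3x_4x_5^7 + x_1^3x_2^3x_3^3x_4^7x_5 + x_1^3x_2^3x_3^7x_4x_5^3 + x_1^3x_2^3x_3^7x_4^3x_5 + x_1^3x_2^7x_3x_4^3x_5^3 + x_1^3x_2^7x_3^3x_4x_5^3 + x_1^3x_2^7x_3^3x_4^3x_5 + x_1^7x_2x_3^3x_4^3x_5^3 + x_1^7x_2^3x_3x_4^3x_5^3 + x_1^7x_2^3x_3^3x_4x_5^3 + x_1^7x_2^3x_3^3x_4^3x_5.$$ $$S_{13}=\sum_{1\le i<j<k<l\le 5} q_{13}(x_i,x_j,x_k,x_l),$$ $$q_{13}=y_1y_2^3y_3^4y_4^9 + y_1y_2^6y_3^3y_4^7 + y_1y_2^6y_3^7y_4^3 + y_1y_2^7y_3^6y_4^3 + y_1^3y_2y_3^5y_4^8 + y_1^3y_2y_3^6y_4^7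 + y_1^3y_2y_3^7y_4^6 + y_1^3y_2^3y_3^4y_4^7 + y_1^3y_2^3y_3^7y_4^4 + y_1^3y_2^5y_3^2y_4^7 + y_1^3y_2^5y_3^7y_4^2 + y_1^3y_2^7y_3y_4^6 + y_1^3y_2^7y_3^3y_4^4 + y_1^3y_2^7y_3^5y_4^2 + y_1^7y_2y_3^6y_4^3 + y_1^7y_2^3y_3y_4^6 + y_1^7y_2^3y_3^3y_4^4 + y_1^7y_2^3y_3^5y_4^2.$$ $$S_{14}=x_1x_2x_3x_4^7x_5^7 + x_1x_2x_3^7x_4x_5^7 + x_1x_2x_3^7x_4^7x_5 + x_1x_2^7x_3x_4x_5^7 + x_1x_2^7x_3x_4^7x_5 + x_1x_2^7x_3^7x_4x_5 + x_1^7x_2x_3x_4x_5^7 + x_1^7x_2x_3x_4^7x_5 + x_1^7x_2x_3^7x_4x_5 + x_1^7x_2^7x_3x_4x_5.$$ $$S_{15}=\sum_{1\le i<j<k<l\le 5} q_{15}(x_i,x_j,x_k,x_l),$$ $$q_{15}=y_1y_2^2y_3^5y_4^9 + y_1y_2^2y_3^7y_4^7 + y_1y_2^3y_3^5y_4^8 +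 y_1y_2^6y_3^3y_4^7 + y_1y_2^6y_3^7y_4^3 + y_1y_2^7y_3^2y_4^7 + y_1y_2^7y_3^6y_4^3 + y_1y_2^7y_3^7y_4^2 + y_1^3y_2y_3^4y_4^9 + y_1^3y_2y_3^6y_4^7 + y_1^3y_2y_3^7y_4^6 + y_1^3y_2^3y_3^4y_4^7 + y_1^3y_2^3y_3^7y_4^4 + y_1^3y_2^5y_3y_4^8 + y_1^3y_2^5y_3^2y_4^7 + y_1^3y_2^5y_3^7y_4^2 + y_1^3y_2^7y_3y_4^6 + y_1^3y_2^7y_3^3y_4^4 + y_1^3y_2^7y_3^5y_4^2 + y_1^7y_2y_3^2y_4^7 + y_1^7y_2y_3^6y_4^3 + y_1^7y_2y_3^7y_4^2 + y_1^7y_2^3y_3y_4^6 + y_1^7y_2^3y_3^3y_4^4 + y_1^7y_2^3y_3^5y_4^2 + y_1^7y_2^7y_3y_4^2.$$ $$S_{16}=\sum_{1\le i<j<k\le 5} q_{16}(x_i,x_j,x_k),$$ $$q_{16}=y_1^3y_2^7y_3^7 + y_1^7y_2^3y_3^7 + y_1^7y_2^7y_3^3.$$ $$G=x_1x_2x_3x_4^{14}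 + x_1x_2x_3x_4^2x_5^{12} + x_1x_2x_3x_5^{14} + x_1x_2x_3^{14}x_4 + x_1x_2x_3^{14}x_5 + x_1x_2x_3^3x_4^4x_5^8 + x_1x_2x_3^6x_4^3x_5^6 + x_1x_2x_3^6x_4^6x_5^3 + x_1x_2x_4x_5^{14} + x_1x_2x_4^{14}x_5 + x_1x_2^2x_3^3x_4^5x_5^6 + x_1x_2^2x_3^3x_4^6x_5^5 + x_1x_2^2x_3^5x_4^4x_5^5 + x_1x_2^2x_3^5x_4^5x_5^4 + x_1x_2^3x_3x_4^{12} + x_1x_2^3x_3x_4^4x_5^8 + x_1x_2^3x_3x_5^{12} + x_1x_2^3x_3^{12}x_4 + x_1x_2^3x_3^{12}x_5 + x_1x_2^3x_3^4x_4^4x_5^5 + x_1x_2^3x_3^4x_4^5x_5^4 + x_1x_2^3x_3^5x_4^4x_5^4 + x_1x_2^3x_4x_5^{12} + x_1x_2^3x_4^{12}x_5 + x_1x_3x_4x_5^{14} + x_1x_3x_4^{14}x_5 + x_1x_3^3x_4x_5^{12} + x_1x_3^3x_4^{12}x_5 + x_1^3x_2x_3x_4^{12} + x_1^3x_2x_3x_4^4x_5^8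 + x_1^3x_2x_3x_5^{12} + x_1^3x_2x_3^{12}x_4 + x_1^3x_2x_3^{12}x_5 + x_1^3x_2x_3^4x_4^4x_5^5 + x_1^3x_2x_3^4x_4^5x_5^4 + x_1^3x_2x_3^5x_4^4x_5^4 + x_1^3x_2x_4x_5^{12} + x_1^3x_2x_4^{12}x_5 + x_1^3x_2^3x_3^3x_4^4x_5^4 + x_1^3x_2^3x_3^4x_4^3x_5^4 + x_1^3x_2^3x_3^4x_4^4x_5^3 + x_1^3x_2^5x_3x_4^4x_5^4 + x_1^3x_2^5x_3x_4^8 + x_1^3x_2^5x_3x_5^8 + x_1^3x_2^5x_3^8x_4 + x_1^3x_2^5x_3^8x_5 + x_1^3x_2^5x_4x_5^8 + x_1^3x_2^5x_4^8x_5 + x_1^3x_3x_4x_5^{12} + x_1^3x_3x_4^{12}x_5 + x_1^3x_3^5x_4x_5^8 + x_1^3x_3^5x_4^8x_5 + x_2x_3x_4x_5^{14} + x_2x_3x_4^{14}x_5 + x_2x_3^3x_4x_5^{12} + x_2x_3^3x_4^{12}x_5 + x_2^3x_3x_4x_5^{12} + x_2^3x_3x_4^{12}x_5 + x_2^3x_3^5x_4x_5^8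 + x_2^3x_3^5x_4^8x_5.$$ -/

import Mathlib

namespace HitProblem

/-- The polynomial algebra `P_k = F_2[x_1, ..., x_k]`. -/
abbrev P (k : ℕ) : Type := MvPolynomial (Fin k) (ZMod 2)

/-- The total Steenrod square `f ↦ ∑ j, Sq^j(f) T^j`: the algebra map with
`x_i ↦ x_i + x_i ^ 2 T` (multiplicativity is the Cartan formula). -/
noncomputable def totalSq (k : ℕ) : P k →ₐ[ZMod 2] Polynomial (P k) :=
  MvPolynomial.aeval fun i =>
    Polynomial.C (MvPolynomial.X i) + Polynomial.C (MvPolynomial.X i ^ 2) * Polynomial.X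

theorem totalSq_X {k : ℕ} (i : Fin k) : totalSq k (MvPolynomial.X i) =
    Polynomial.C (MvPolynomial.X i) + Polynomial.C (MvPolynomial.X i ^ 2) * Polynomial.X := by
  simp [totalSq]

/-- The Steenrod square `Sq^j` on `P_k`. -/
noncomputable def Sq (k j : ℕ) : P k →ₗ[ZMod 2] P k :=
  ((Polynomial.lcoeff (P k) j).restrictScalars (ZMod 2)) ∘ₗ (totalSq k).toLinearMap

/-- The subspace of hit elements: the image of the action on `P_k` of the augmentation ideal of
the mod 2 Steenrod algebra. As that algebra is generated by the `Sq^j`, this is the sum of the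
images of the `Sq^j` with `0 < j`. -/
noncomputable def hit (k : ℕ) : Submodule (ZMod 2) (P k) :=
  ⨆ (j : ℕ) (_ : 0 < j), LinearMap.range (Sq k j)

/-- The degree `n` part of `P_k`. -/
noncomputable abbrev PDeg (k n : ℕ) : Submodule (ZMod 2) (P k) :=
  MvPolynomial.homogeneousSubmodule (Fin k) (ZMod 2) n

/-- The hit elements of degree `n`, as a subspace of the degree `n` part of `P_k`. -/
noncomputable def hitDeg (k n : ℕ) : Submodule (ZMod 2) (PDeg k n) :=
  (hit k).comap (PDeg k n).subtype

/-- The space of cohits `(QP_k)_n = (P_k)_n / (hit elements of degree n)`. -/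
abbrev QP (k n : ℕ) : Type := PDeg k n ⧸ hitDeg k n

/-- The group `GL_k(F_2)`. -/
abbrev GLk (k : ℕ) : Type := Matrix.GeneralLinearGroup (Fin k) (ZMod 2)

/-- `g ∈ GL_k(F_2)` acts on `P_k` by the algebra map `x_j ↦ ∑ i, g_ij x_i`. -/
noncomputable def subst {k : ℕ} (g : Matrix (Fin k) (Fin k) (ZMod 2)) : P k →ₐ[ZMod 2] P k :=
  MvPolynomial.aeval fun j => ∑ i, g i j • MvPolynomial.X i

theorem subst_X {k : ℕ} (g : Matrix (Fin k) (Fin k) (ZMod 2)) (j : Fin k) :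
    subst g (MvPolynomial.X j) = ∑ i, g i j • MvPolynomial.X i := by
  simp [subst]

theorem subst_one {k : ℕ} : subst (1 : Matrix (Fin k) (Fin k) (ZMod 2)) = AlgHom.id _ _ := by
  apply MvPolynomial.algHom_ext
  intro j
  simp [subst_X, Matrix.one_apply]

theorem subst_mul {k : ℕ} (g h : Matrix (Fin k) (Fin k) (ZMod 2)) :
    subst (g * h) = (subst g).comp (subst h) := by
  apply MvPolynomial.algHom_ext
  intro j
  simp only [AlgHom.comp_apply, subst_X, map_sum, map_smul, Matrix.mul_apply, Finset.sum_smul,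
    Finset.smul_sum, smul_smul]
  rw [Finset.sum_comm]
  refine Finset.sum_congr rfl fun i _ => Finset.sum_congr rfl fun l _ => ?_
  rw [mul_comm]

theorem subst_mem {k n : ℕ} (g : Matrix (Fin k) (Fin k) (ZMod 2)) {f : P k} (hf : f ∈ PDeg k n) :
    subst g f ∈ PDeg k n := by
  have h : ∀ j, (∑ i, g i j • (MvPolynomial.X i : P k)).IsHomogeneous 1 := fun j =>
    MvPolynomial.IsHomogeneous.sum _ _ _ fun i _ => by
      rw [MvPolynomial.smul_eq_C_mul]
      exact (MvPolynomial.isHomogeneous_X _ i).C_mul _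
  have := MvPolynomial.IsHomogeneous.aeval (φ := f) (m := n) hf _ h
  rw [one_mul] at this
  exact this

theorem totalSq_subst {k : ℕ} (g : Matrix (Fin k) (Fin k) (ZMod 2)) (f : P k) :
    totalSq k (subst g f) = Polynomial.mapAlgHom (subst g) (totalSq k f) := by
  suffices h : (totalSq k).comp (subst g) =
      (Polynomial.mapAlgHom (subst g)).comp (totalSq k) from DFunLike.congr_fun h f
  apply MvPolynomial.algHom_ext
  intro j
  have hfrob : (∑ i, g i j • (MvPolynomial.X i : P k)) ^ 2 =
      ∑ i, g i j • (MvPolynomial.X i : P k) ^ 2 := by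
    rw [sum_pow_char 2]
    refine Finset.sum_congr rfl fun i _ => ?_
    rw [smul_pow, ZMod.pow_card (p := 2)]
  have h1 : totalSq k (subst g (MvPolynomial.X j)) =
      Polynomial.C (∑ i, g i j • MvPolynomial.X i) +
        Polynomial.C (∑ i, g i j • MvPolynomial.X i ^ 2) * Polynomial.X := by
    simp only [subst_X, map_sum, map_smul, totalSq_X, smul_add, Finset.sum_add_distrib,
      Finset.sum_mul, ← Polynomial.smul_C, smul_mul_assoc]
  have h2 : Polynomial.mapAlgHom (subst g) (totalSq k (MvPolynomial.X j)) =
      Polynomial.C (subst g (MvPolynomial.X j)) +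
        Polynomial.C (subst g (MvPolynomial.X j) ^ 2) * Polynomial.X := by
    rw [totalSq_X]
    simp
  rw [AlgHom.comp_apply, AlgHom.comp_apply, h1, h2, subst_X, hfrob]

theorem Sq_subst {k : ℕ} (j : ℕ) (g : Matrix (Fin k) (Fin k) (ZMod 2)) (f : P k) :
    Sq k j (subst g f) = subst g (Sq k j f) := by
  simp [Sq, totalSq_subst, Polynomial.coeff_map]

theorem hit_le_comap_subst {k : ℕ} (g : Matrix (Fin k) (Fin k) (ZMod 2)) :
    hit k ≤ (hit k).comap (subst g).toLinearMap := by
  refine iSup₂_le fun j hj => ?_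
  rintro _ ⟨f, rfl⟩
  refine Submodule.mem_iSup_of_mem j (Submodule.mem_iSup_of_mem hj ⟨subst g f, ?_⟩)
  exact Sq_subst j g f

/-- The action of `GL_k(F_2)` on the degree `n` part of `P_k`. -/
noncomputable def repPDeg (k n : ℕ) : Representation (ZMod 2) (GLk k) (PDeg k n) where
  toFun g := (subst g.val).toLinearMap.restrict fun _ hf => subst_mem g.val hf
  map_one' := by
    ext1 f
    apply Subtype.ext
    simp [subst_one, LinearMap.restrict_apply]
  map_mul' g h := by
    ext1 f
    apply Subtype.ext
    exact DFunLike.congr_fun (subst_mul g.val h.val) f.val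

/-- The induced action of `GL_k(F_2)` on `(QP_k)_n`. -/
noncomputable def repQP (k n : ℕ) : Representation (ZMod 2) (GLk k) (QP k n) :=
  (repPDeg k n).quotient (hitDeg k n) fun g _ hf => hit_le_comap_subst g.val hf

/-- The embedding of `Σ_k` in `GL_k(F_2)` by permutation matrices: `σ` acts by
`x_j ↦ x_(σ j)`. -/
noncomputable def permGL (k : ℕ) : Equiv.Perm (Fin k) →* GLk k :=
  MonoidHom.toHomUnits
    { toFun := fun σ => (σ⁻¹).permMatrix (ZMod 2)
      map_one' := by simp
      map_mul' := fun σ τ => by rw [mul_inv_rev, Matrix.permMatrix_mul] }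

/-- The invariants `(QP_k)_n^{GL_k(F_2)}`. -/
noncomputable def glInvariants (k n : ℕ) : Submodule (ZMod 2) (QP k n) :=
  (repQP k n).invariants

/-- The invariants `(QP_k)_n^{Σ_k}`. -/
noncomputable def sigmaInvariants (k n : ℕ) : Submodule (ZMod 2) (QP k n) :=
  Representation.invariants (MonoidHom.comp (repQP k n) (permGL k))

/-- The linear map on `P_k` that sends a monomial with all exponents `a_i` odd to the monomial
with exponents `(a_i - 1) / 2`, and every other monomial to `0`. -/
noncomputable def halve (k : ℕ) : P k →ₗ[ZMod 2] P k :=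
  (MvPolynomial.basisMonomials (Fin k) (ZMod 2)).constr (ZMod 2) fun a =>
    if ∀ i, Odd (a i) then
      MvPolynomial.monomial (Finsupp.equivFunOnFinite.symm fun i => (a i - 1) / 2) 1
    else 0

theorem halve_monomial {k : ℕ} (a : Fin k →₀ ℕ) :
    halve k (MvPolynomial.monomial a 1) = if ∀ i, Odd (a i) then
      MvPolynomial.monomial (Finsupp.equivFunOnFinite.symm fun i => (a i - 1) / 2) 1 else 0 := by
  have h : (MvPolynomial.monomial a 1 : P k) = MvPolynomial.basisMonomials (Fin k) (ZMod 2) a := by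
    simp
  rw [halve, h, Module.Basis.constr_basis]

theorem induction_monomial {k : ℕ} {p : P k → Prop} (f : P k)
    (h0 : p 0) (hadd : ∀ f g, p f → p g → p (f + g))
    (hmon : ∀ a, p (MvPolynomial.monomial a 1)) : p f := by
  induction f using MvPolynomial.induction_on' with
  | monomial a c =>
    have hc : c = 0 ∨ c = 1 := by revert c; decide
    rcases hc with rfl | rfl
    · simpa using h0
    · exact hmon a
  | add f g hf hg => exact hadd f g hf hg

theorem halve_sq_mul {k : ℕ} (u v : P k) : halve k (u ^ 2 * v) = u * halve k v := by
  induction u using induction_monomial with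
  | h0 => simp
  | hadd f g hf hg => rw [add_pow_char (p := 2), add_mul, map_add, hf, hg, add_mul]
  | hmon a =>
    induction v using induction_monomial with
    | h0 => simp
    | hadd f g hf hg => rw [mul_add, map_add, hf, hg, map_add, mul_add]
    | hmon b =>
      rw [MvPolynomial.monomial_pow, MvPolynomial.monomial_mul, one_pow, one_mul,
        halve_monomial, halve_monomial]
      have hodd : (∀ i, Odd ((2 • a + b) i)) ↔ ∀ i, Odd (b i) := by
        refine forall_congr' fun i => ?_
        simp only [Finsupp.add_apply, Finsupp.smul_apply, smul_eq_mul]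
        grind
      by_cases hb : ∀ i, Odd (b i)
      · rw [if_pos hb, if_pos (hodd.2 hb), MvPolynomial.monomial_mul, one_mul]
        refine congrArg (fun c => MvPolynomial.monomial c (1 : ZMod 2)) (Finsupp.ext fun i => ?_)
        simp only [Finsupp.equivFunOnFinite_symm_apply_apply, Finsupp.add_apply,
          Finsupp.smul_apply, smul_eq_mul]
        obtain ⟨c, hc⟩ := hb i
        omega
      · rw [if_neg hb, if_neg (fun h => hb (hodd.1 h)), mul_zero]

theorem halve_prod_X {k : ℕ} (s : Finset (Fin k)) :
    halve k (∏ i ∈ s, MvPolynomial.X i) = if s = Finset.univ then 1 else 0 := by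
  have h : (∏ i ∈ s, MvPolynomial.X i : P k) =
      MvPolynomial.monomial (Finsupp.equivFunOnFinite.symm fun i => if i ∈ s then 1 else 0) 1 := by
    rw [MvPolynomial.monomial_eq, Finsupp.prod_fintype _ _ (by simp)]
    simp [Finset.prod_ite_mem, apply_ite]
  rw [h, halve_monomial]
  by_cases hs : s = Finset.univ
  · subst hs
    rw [if_pos rfl, if_pos (by simp)]
    change _ = MvPolynomial.monomial 0 (1 : ZMod 2)
    refine congrArg (fun c => MvPolynomial.monomial c (1 : ZMod 2)) (Finsupp.ext fun i => ?_)
    simp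
  · rw [if_neg hs, if_neg]
    intro h
    refine hs (Finset.eq_univ_iff_forall.2 fun i => ?_)
    by_contra hi
    simpa [hi] using h i

/-- `halve` applied to the coefficients of a polynomial in `T` over `P_k`. -/
noncomputable def halveCoeff (k : ℕ) : Polynomial (P k) →ₗ[ZMod 2] Polynomial (P k) :=
  Polynomial.lsum fun n => ((Polynomial.monomial n).restrictScalars (ZMod 2)) ∘ₗ halve k

theorem halveCoeff_monomial {k : ℕ} (n : ℕ) (f : P k) :
    halveCoeff k (Polynomial.monomial n f) = Polynomial.monomial n (halve k f) := by
  simp [halveCoeff, Polynomial.lsum_apply, Polynomial.sum_monomial_index]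

theorem coeff_halveCoeff {k : ℕ} (n : ℕ) (f : Polynomial (P k)) :
    (halveCoeff k f).coeff n = halve k (f.coeff n) := by
  induction f using Polynomial.induction_on' with
  | add f g hf hg => simp [hf, hg]
  | monomial m a =>
    rw [halveCoeff_monomial, Polynomial.coeff_monomial, Polynomial.coeff_monomial]
    split_ifs <;> simp

theorem halveCoeff_sq_mul {k : ℕ} (U V : Polynomial (P k)) :
    halveCoeff k (U ^ 2 * V) = Polynomial.expand (P k) 2 U * halveCoeff k V := by
  induction U using Polynomial.induction_on' with
  | add f g hf hg =>
    rw [add_pow_char (p := 2), add_mul, map_add, hf, hg, map_add, add_mul]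
  | monomial m u =>
    induction V using Polynomial.induction_on' with
    | add f g hf hg => rw [mul_add, map_add, hf, hg, map_add, mul_add]
    | monomial n v =>
      rw [Polynomial.monomial_pow, Polynomial.monomial_mul_monomial, halveCoeff_monomial,
        halveCoeff_monomial, halve_sq_mul, Polynomial.expand_monomial,
        Polynomial.monomial_mul_monomial]

theorem halveCoeff_totalSq_prod {k : ℕ} (s : Finset (Fin k)) :
    halveCoeff k (totalSq k (∏ i ∈ s, MvPolynomial.X i)) = if s = Finset.univ then 1 else 0 := by
  have hterm : ∀ t : Finset (Fin k), halveCoeff k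
      ((∏ i ∈ t, Polynomial.C (MvPolynomial.X i)) *
        ∏ i ∈ s \ t, (Polynomial.C (MvPolynomial.X i ^ 2) * Polynomial.X)) =
      if t = Finset.univ then (Polynomial.monomial (s \ t).card)
        (∏ i ∈ s \ t, MvPolynomial.X i) else 0 := by
    intro t
    have : ((∏ i ∈ t, Polynomial.C (MvPolynomial.X i)) *
        ∏ i ∈ s \ t, (Polynomial.C (MvPolynomial.X i ^ 2) * Polynomial.X) :
          Polynomial (P k)) = Polynomial.monomial (s \ t).card
            ((∏ i ∈ s \ t, MvPolynomial.X i) ^ 2 * ∏ i ∈ t, MvPolynomial.X i) := by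
      rw [← Polynomial.C_mul_X_pow_eq_monomial, Finset.prod_mul_distrib, Finset.prod_const,
        ← map_prod, ← map_prod, Finset.prod_pow, map_mul]
      ring
    rw [this, halveCoeff_monomial, halve_sq_mul, halve_prod_X]
    split_ifs <;> simp
  simp only [map_prod, totalSq_X]
  rw [Finset.prod_add, map_sum, Finset.sum_congr rfl fun t _ => hterm t]
  by_cases hs : s = Finset.univ
  · subst hs
    rw [Finset.sum_eq_single Finset.univ]
    · simp
    · intro t _ ht
      rw [if_neg ht]
    · intro h
      simp at h
  · rw [if_neg hs]
    refine Finset.sum_eq_zero fun t ht => if_neg ?_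
    rintro rfl
    exact hs (Finset.univ_subset_iff.1 (Finset.mem_powerset.1 ht))

theorem halveCoeff_totalSq {k : ℕ} (f : P k) :
    halveCoeff k (totalSq k f) = Polynomial.expand (P k) 2 (totalSq k (halve k f)) := by
  induction f using induction_monomial with
  | h0 => simp
  | hadd f g hf hg => simp only [map_add, hf, hg]
  | hmon a =>
    have ha : (MvPolynomial.monomial a 1 : P k) =
        (MvPolynomial.monomial (Finsupp.equivFunOnFinite.symm fun i => a i / 2) 1) ^ 2 *
          ∏ i ∈ Finset.univ.filter (fun i => Odd (a i)), MvPolynomial.X i := by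
      rw [MvPolynomial.monomial_eq, MvPolynomial.monomial_eq,
        Finsupp.prod_fintype _ _ (by simp), Finsupp.prod_fintype _ _ (by simp), Finset.prod_filter]
      simp only [map_one, one_mul, Finsupp.equivFunOnFinite_symm_apply_apply]
      rw [← Finset.prod_pow, ← Finset.prod_mul_distrib]
      refine Finset.prod_congr rfl fun i _ => ?_
      rw [← pow_mul]
      split_ifs with h
      · rw [← pow_succ]
        congr 1
        grind
      · rw [mul_one]
        congr 1
        grind
    rw [ha, map_mul, map_pow, halveCoeff_sq_mul, halve_sq_mul, halveCoeff_totalSq_prod,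
      halve_prod_X, map_mul, map_mul]
    split_ifs <;> simp

theorem halve_Sq {k : ℕ} (j : ℕ) (f : P k) :
    halve k (Sq k j f) = if 2 ∣ j then Sq k (j / 2) (halve k f) else 0 := by
  have h := congrArg (fun q => Polynomial.coeff q j) (halveCoeff_totalSq f)
  simp only [coeff_halveCoeff, Polynomial.coeff_expand two_pos] at h
  exact h

theorem hit_le_comap_halve (k : ℕ) : hit k ≤ (hit k).comap (halve k) := by
  refine iSup₂_le fun j hj => ?_
  rintro _ ⟨f, rfl⟩
  rw [Submodule.mem_comap, halve_Sq]
  split_ifs with h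
  · exact Submodule.mem_iSup_of_mem (j / 2)
      (Submodule.mem_iSup_of_mem (by omega) ⟨halve k f, rfl⟩)
  · exact Submodule.zero_mem _

theorem halve_mem {k n m : ℕ} (h : n = 2 * m + k) {f : P k} (hf : f ∈ PDeg k n) :
    halve k f ∈ PDeg k m := by
  have hf' : f.IsHomogeneous n := hf
  rw [MvPolynomial.as_sum f, map_sum]
  refine Submodule.sum_mem _ fun a ha => ?_
  have hdeg : ∑ i, a i = n := by
    have := hf' (MvPolynomial.mem_support_iff.1 ha)
    have h1 : a.degree = Finsupp.weight 1 a := by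
      rw [Finsupp.degree_eq_weight_one]
      rfl
    rw [← Finsupp.degree_eq_sum, h1, this]
  have hc : (MvPolynomial.monomial a (f.coeff a) : P k) =
      f.coeff a • MvPolynomial.monomial a 1 := by
    rw [MvPolynomial.smul_monomial, smul_eq_mul, mul_one]
  rw [hc, map_smul, halve_monomial]
  refine Submodule.smul_mem _ _ ?_
  split_ifs with ho
  · refine MvPolynomial.isHomogeneous_monomial _ ?_
    rw [Finsupp.degree_eq_sum]
    have h2 : ∑ i, (2 * ((a i - 1) / 2) + 1) = n := by
      rw [← hdeg]
      refine Finset.sum_congr rfl fun i _ => ?_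
      have := ho i
      grind
    rw [Finset.sum_add_distrib, ← Finset.mul_sum] at h2
    simp only [Finset.sum_const, Finset.card_univ, Fintype.card_fin, smul_eq_mul, mul_one] at h2
    simp only [Finsupp.equivFunOnFinite_symm_apply_apply]
    omega
  · exact Submodule.zero_mem _

/-- The Kameko homomorphism `(QP_k)_n → (QP_k)_m`, where `n = 2 * m + k`. -/
noncomputable def kameko {k n m : ℕ} (h : n = 2 * m + k) : QP k n →ₗ[ZMod 2] QP k m :=
  Submodule.mapQ (hitDeg k n) (hitDeg k m)
    ((halve k).restrict fun _ hf => halve_mem h hf) fun _ hf => hit_le_comap_halve k hf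

/-- The sum of the monomials `x_1^a x_2^b x_3^c x_4^d x_5^e` over the entries `(a,b,c,d,e)` of a
list. -/
noncomputable def ofExponents (L : List (ℕ × ℕ × ℕ × ℕ × ℕ)) : P 5 :=
  (L.map fun (a, b, c, d, e) => MvPolynomial.X 0 ^ a * MvPolynomial.X 1 ^ b *
    MvPolynomial.X 2 ^ c * MvPolynomial.X 3 ^ d * MvPolynomial.X 4 ^ e).sum

theorem ofExponents_mem {n : ℕ} (L : List (ℕ × ℕ × ℕ × ℕ × ℕ))
    (h : ∀ t ∈ L, t.1 + t.2.1 + t.2.2.1 + t.2.2.2.1 + t.2.2.2.2 = n) :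
    ofExponents L ∈ PDeg 5 n := by
  refine list_sum_mem ?_
  intro f hf
  obtain ⟨t, ht, rfl⟩ := List.mem_map.1 hf
  have hX : ∀ (i : Fin 5) (a : ℕ), (MvPolynomial.X i ^ a : P 5).IsHomogeneous a := fun i a =>
    MvPolynomial.isHomogeneous_X_pow i a
  rw [← h t ht]
  exact ((((hX 0 _).mul (hX 1 _)).mul (hX 2 _)).mul (hX 3 _)).mul (hX 4 _)

/-- The exponent vectors of the monomials of `Sigma_5[1], ..., Sigma_5[16]`;
the index `i` stands for `Sigma_5[i + 1]`. -/
def sigmaExponents : Fin 16 → List (ℕ × ℕ × ℕ × ℕ × ℕ) := ![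
  -- Sigma_5[1]
   [(1,1,2,13,0), (1,1,2,0,13), (1,1,0,2,13), (1,14,1,1,0), (1,14,1,0,1), (1,14,0,1,1),
    (1,2,1,13,0), (1,2,1,0,13), (1,2,13,1,0), (1,2,13,0,1), (1,2,7,7,0), (1,2,7,0,7), (1,2,0,1,13),
    (1,2,0,13,1), (1,2,0,7,7), (1,3,1,12,0), (1,3,1,0,12), (1,3,12,1,0), (1,3,12,0,1), (1,3,0,1,12),
    (1,3,0,12,1), (1,6,3,7,0), (1,6,3,0,7), (1,6,7,3,0), (1,6,7,0,3), (1,6,0,3,7), (1,6,0,7,3),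
    (1,7,2,7,0), (1,7,2,0,7), (1,7,6,3,0), (1,7,6,0,3), (1,7,7,2,0), (1,7,7,0,2), (1,7,0,2,7),
    (1,7,0,6,3), (1,7,0,7,2), (1,0,1,2,13), (1,0,14,1,1), (1,0,2,1,13), (1,0,2,13,1), (1,0,2,7,7),
    (1,0,3,1,12), (1,0,3,12,1), (1,0,6,3,7), (1,0,6,7,3), (1,0,7,2,7), (1,0,7,6,3), (1,0,7,7,2),
    (3,1,1,12,0), (3,1,1,0,12), (3,1,12,1,0), (3,1,12,0,1), (3,1,4,9,0), (3,1,4,0,9), (3,1,5,8,0),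
    (3,1,5,0,8), (3,1,6,7,0), (3,1,6,0,7), (3,1,7,6,0), (3,1,7,0,6), (3,1,0,1,12), (3,1,0,12,1),
    (3,1,0,4,9), (3,1,0,5,8), (3,1,0,6,7), (3,1,0,7,6), (3,3,4,7,0), (3,3,4,0,7), (3,3,5,6,0),
    (3,3,5,0,6), (3,3,7,4,0), (3,3,7,0,4), (3,3,0,4,7), (3,3,0,5,6), (3,3,0,7,4), (3,5,1,8,0),
    (3,5,1,0,8), (3,5,2,7,0), (3,5,2,0,7), (3,5,3,6,0), (3,5,3,0,6), (3,5,6,3,0), (3,5,6,0,3),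
    (3,5,7,2,0), (3,5,7,0,2), (3,5,0,1,8), (3,5,0,2,7), (3,5,0,3,6), (3,5,0,6,3), (3,5,0,7,2),
    (3,7,1,6,0), (3,7,1,0,6), (3,7,3,4,0), (3,7,3,0,4), (3,7,5,2,0), (3,7,5,0,2), (3,7,0,1,6),
    (3,7,0,3,4), (3,7,0,5,2), (3,0,1,1,12), (3,0,1,12,1), (3,0,1,4,9), (3,0,1,5,8), (3,0,1,6,7),
    (3,0,1,7,6), (3,0,3,4,7), (3,0,3,5,6), (3,0,3,7,4), (3,0,5,1,8), (3,0,5,2,7), (3,0,5,3,6),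
    (3,0,5,6,3), (3,0,5,7,2), (3,0,7,1,6), (3,0,7,3,4), (3,0,7,5,2), (7,1,2,7,0), (7,1,2,0,7),
    (7,1,6,3,0), (7,1,6,0,3), (7,1,7,2,0), (7,1,7,0,2), (7,1,0,2,7), (7,1,0,6,3), (7,1,0,7,2),
    (7,3,1,6,0), (7,3,1,0,6), (7,3,3,4,0), (7,3,3,0,4), (7,3,5,2,0), (7,3,5,0,2), (7,3,0,1,6),
    (7,3,0,3,4), (7,3,0,5,2), (7,7,1,2,0), (7,7,1,0,2), (7,7,0,1,2), (7,0,1,2,7), (7,0,1,6,3),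
    (7,0,1,7,2), (7,0,3,1,6), (7,0,3,3,4), (7,0,3,5,2), (7,0,7,1,2), (0,1,1,2,13), (0,1,14,1,1),
    (0,1,2,1,13), (0,1,2,13,1), (0,1,2,7,7), (0,1,3,1,12), (0,1,3,12,1), (0,1,6,3,7), (0,1,6,7,3),
    (0,1,7,2,7), (0,1,7,6,3), (0,1,7,7,2), (0,3,1,1,12), (0,3,1,12,1), (0,3,1,4,9), (0,3,1,5,8),
    (0,3,1,6,7), (0,3,1,7,6), (0,3,3,4,7), (0,3,3,5,6), (0,3,3,7,4), (0,3,5,1,8), (0,3,5,2,7),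
    (0,3,5,3,6), (0,3,5,6,3), (0,3,5,7,2), (0,3,7,1,6), (0,3,7,3,4), (0,3,7,5,2), (0,7,1,2,7),
    (0,7,1,6,3), (0,7,1,7,2), (0,7,3,1,6), (0,7,3,3,4), (0,7,3,5,2), (0,7,7,1,2)],
  -- Sigma_5[2]
   [(1,1,2,12,1), (1,1,2,6,7), (1,1,2,7,6), (1,1,6,2,7), (1,1,6,7,2), (1,1,7,2,6), (1,1,7,6,2),
    (1,2,1,1,12), (1,2,1,12,1), (1,2,12,1,1), (1,2,3,4,7), (1,2,3,7,4), (1,2,4,3,7), (1,2,4,5,5),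
    (1,2,4,7,3), (1,2,5,4,5), (1,2,5,5,4), (1,2,7,3,4), (1,2,7,4,3), (1,3,1,4,8), (1,3,2,4,7),
    (1,3,2,7,4), (1,3,4,1,8), (1,3,4,4,5), (1,3,4,5,4), (1,3,5,4,4), (1,3,7,2,4), (1,6,1,2,7),
    (1,6,1,7,2), (1,6,7,1,2), (1,7,1,2,6), (1,7,1,6,2), (1,7,2,3,4), (1,7,2,4,3), (1,7,3,2,4),
    (1,7,6,1,2), (3,1,1,4,8), (3,1,2,4,7), (3,1,2,7,4), (3,1,4,2,7), (3,1,4,4,5), (3,1,4,5,4),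
    (3,1,4,7,2), (3,1,5,4,4), (3,1,7,2,4), (3,1,7,4,2), (3,4,1,2,7), (3,4,1,7,2), (3,4,7,1,2),
    (3,5,1,4,4), (3,7,1,2,4), (3,7,1,4,2), (3,7,4,1,2), (7,1,1,2,6), (7,1,1,6,2), (7,1,2,3,4),
    (7,1,2,4,3), (7,1,3,2,4), (7,1,6,1,2), (7,3,1,2,4), (7,3,1,4,2), (7,3,4,1,2)],
  -- Sigma_5[3]
   [(1,1,3,4,8), (1,1,6,3,6), (1,1,6,6,3), (1,2,1,1,12), (1,2,1,12,1), (1,2,1,4,9), (1,2,1,5,8),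
    (1,2,12,1,1), (1,2,3,5,6), (1,2,3,6,5), (1,2,4,1,9), (1,2,4,5,5), (1,2,4,9,1), (1,2,5,1,8),
    (1,2,5,8,1), (1,3,1,4,8), (1,3,4,1,8), (1,3,4,8,1), (3,1,1,4,8), (3,1,4,1,8), (3,1,4,8,1),
    (3,3,3,4,4), (3,3,4,3,4), (3,3,4,4,3)],
  -- Sigma_5[4]
   [(1,1,1,2,12), (1,2,1,1,12), (1,2,1,12,1), (1,2,1,4,9), (1,2,1,5,8), (1,2,12,1,1), (1,2,4,1,9),
    (1,2,4,5,5), (1,2,4,9,1), (1,2,5,1,8), (1,2,5,4,5), (1,2,5,5,4), (1,2,5,8,1), (1,3,4,1,8),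
    (1,3,4,4,5), (1,3,4,5,4), (1,3,4,8,1), (1,3,5,4,4), (3,1,4,1,8), (3,1,4,4,5), (3,1,4,5,4),
    (3,1,4,8,1), (3,1,5,4,4), (3,5,1,4,4)],
  -- Sigma_5[5]
   [(1,1,2,1,12), (1,1,2,6,7), (1,1,2,7,6), (1,1,6,2,7), (1,1,6,7,2), (1,1,7,2,6), (1,1,7,6,2),
    (1,2,1,1,12), (1,2,1,12,1), (1,2,1,4,9), (1,2,1,5,8), (1,2,12,1,1), (1,2,3,4,7), (1,2,3,7,4),
    (1,2,4,1,9), (1,2,4,3,7), (1,2,4,7,3), (1,2,4,9,1), (1,2,5,1,8), (1,2,5,8,1), (1,2,7,3,4),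
    (1,2,7,4,3), (1,3,1,4,8), (1,3,2,4,7), (1,3,2,7,4), (1,3,4,8,1), (1,3,7,2,4), (1,6,1,2,7),
    (1,6,1,7,2), (1,6,7,1,2), (1,7,1,2,6), (1,7,1,6,2), (1,7,2,3,4), (1,7,2,4,3), (1,7,3,2,4),
    (1,7,6,1,2), (3,1,1,4,8), (3,1,2,4,7), (3,1,2,7,4), (3,1,4,1,8), (3,1,4,2,7), (3,1,4,7,2),
    (3,1,4,8,1), (3,1,7,2,4), (3,1,7,4,2), (3,4,1,2,7), (3,4,1,7,2), (3,4,7,1,2), (3,7,1,2,4),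
    (3,7,1,4,2), (3,7,4,1,2), (7,1,1,2,6), (7,1,1,6,2), (7,1,2,3,4), (7,1,2,4,3), (7,1,3,2,4),
    (7,1,6,1,2), (7,3,1,2,4), (7,3,1,4,2), (7,3,4,1,2)],
  -- Sigma_5[6]
   [(1,1,3,6,6), (1,1,6,3,6), (1,1,6,6,3), (1,2,1,1,12), (1,2,1,12,1), (1,2,1,4,9), (1,2,1,5,8),
    (1,2,12,1,1), (1,2,4,1,9), (1,2,4,9,1), (1,2,5,1,8), (1,2,5,8,1), (1,3,1,6,6), (1,3,2,5,6),
    (1,3,2,6,5), (1,3,5,2,6), (1,3,5,6,2), (1,3,6,1,6), (1,3,6,2,5), (1,3,6,5,2), (1,3,6,6,1),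
    (3,1,1,6,6), (3,1,2,5,6), (3,1,2,6,5), (3,1,5,2,6), (3,1,5,6,2), (3,1,6,1,6), (3,1,6,2,5),
    (3,1,6,5,2), (3,1,6,6,1), (3,3,4,3,4), (3,3,4,4,3), (3,3,5,2,4), (3,3,5,4,2), (3,5,1,2,6),
    (3,5,1,6,2), (3,5,2,1,6), (3,5,2,2,5), (3,5,2,5,2), (3,5,2,6,1), (3,5,3,2,4), (3,5,3,4,2),
    (3,5,6,1,2), (3,5,6,2,1)],
  -- Sigma_5[7]
   [(1,1,15,0,0), (1,1,0,15,0), (1,1,0,0,15), (1,15,1,0,0), (1,15,0,1,0), (1,15,0,0,1),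
    (1,0,1,15,0), (1,0,1,0,15), (1,0,15,1,0), (1,0,15,0,1), (1,0,0,1,15), (1,0,0,15,1),
    (15,1,1,0,0), (15,1,0,1,0), (15,1,0,0,1), (15,0,1,1,0), (15,0,1,0,1), (15,0,0,1,1),
    (0,1,1,15,0), (0,1,1,0,15), (0,1,15,1,0), (0,1,15,0,1), (0,1,0,1,15), (0,1,0,15,1),
    (0,15,1,1,0), (0,15,1,0,1), (0,15,0,1,1), (0,0,1,1,15), (0,0,1,15,1), (0,0,15,1,1)],
  -- Sigma_5[8]
   [(1,3,13,0,0), (1,3,0,13,0), (1,3,0,0,13), (1,0,3,13,0), (1,0,3,0,13), (1,0,0,3,13),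
    (3,1,13,0,0), (3,1,0,13,0), (3,1,0,0,13), (3,13,1,0,0), (3,13,0,1,0), (3,13,0,0,1),
    (3,0,1,13,0), (3,0,1,0,13), (3,0,13,1,0), (3,0,13,0,1), (3,0,0,1,13), (3,0,0,13,1),
    (0,1,3,13,0), (0,1,3,0,13), (0,1,0,3,13), (0,3,1,13,0), (0,3,1,0,13), (0,3,13,1,0),
    (0,3,13,0,1), (0,3,0,1,13), (0,3,0,13,1), (0,0,1,3,13), (0,0,3,1,13), (0,0,3,13,1)],
  -- Sigma_5[9]
   [(1,1,2,4,9), (1,1,2,5,8), (1,1,6,3,6), (1,1,6,6,3), (1,2,3,5,6), (1,2,3,6,5), (1,2,4,5,5),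
    (3,3,3,4,4), (3,3,4,3,4), (3,3,4,4,3)],
  -- Sigma_5[10]
   [(1,1,1,14,0), (1,1,1,0,14), (1,1,14,1,0), (1,1,14,0,1), (1,1,0,1,14), (1,1,0,14,1),
    (1,3,1,12,0), (1,3,1,0,12), (1,3,12,1,0), (1,3,12,0,1), (1,3,0,1,12), (1,3,0,12,1),
    (1,0,1,1,14), (1,0,1,14,1), (1,0,3,1,12), (1,0,3,12,1), (3,1,1,12,0), (3,1,1,0,12),
    (3,1,12,1,0), (3,1,12,0,1), (3,1,0,1,12), (3,1,0,12,1), (3,5,1,8,0), (3,5,1,0,8), (3,5,8,1,0),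
    (3,5,8,0,1), (3,5,0,1,8), (3,5,0,8,1), (3,0,1,1,12), (3,0,1,12,1), (3,0,5,1,8), (3,0,5,8,1),
    (0,1,1,1,14), (0,1,1,14,1), (0,1,3,1,12), (0,1,3,12,1), (0,3,1,1,12), (0,3,1,12,1), (0,3,5,1,8),
    (0,3,5,8,1)],
  -- Sigma_5[11]
   [(3,5,9,0,0), (3,5,0,9,0), (3,5,0,0,9), (3,0,5,9,0), (3,0,5,0,9), (3,0,0,5,9), (0,3,5,9,0),
    (0,3,5,0,9), (0,3,0,5,9), (0,0,3,5,9)],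
  -- Sigma_5[12]
   [(1,3,3,3,7), (1,3,3,7,3), (1,3,7,3,3), (1,7,3,3,3), (3,1,3,3,7), (3,1,3,7,3), (3,1,7,3,3),
    (3,3,1,3,7), (3,3,1,7,3), (3,3,3,1,7), (3,3,3,7,1), (3,3,7,1,3), (3,3,7,3,1), (3,7,1,3,3),
    (3,7,3,1,3), (3,7,3,3,1), (7,1,3,3,3), (7,3,1,3,3), (7,3,3,1,3), (7,3,3,3,1)],
  -- Sigma_5[13]
   [(1,3,4,9,0), (1,3,4,0,9), (1,3,0,4,9), (1,6,3,7,0), (1,6,3,0,7), (1,6,7,3,0), (1,6,7,0,3),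
    (1,6,0,3,7), (1,6,0,7,3), (1,7,6,3,0), (1,7,6,0,3), (1,7,0,6,3), (1,0,3,4,9), (1,0,6,3,7),
    (1,0,6,7,3), (1,0,7,6,3), (3,1,5,8,0), (3,1,5,0,8), (3,1,6,7,0), (3,1,6,0,7), (3,1,7,6,0),
    (3,1,7,0,6), (3,1,0,5,8), (3,1,0,6,7), (3,1,0,7,6), (3,3,4,7,0), (3,3,4,0,7), (3,3,7,4,0),
    (3,3,7,0,4), (3,3,0,4,7), (3,3,0,7,4), (3,5,2,7,0), (3,5,2,0,7), (3,5,7,2,0), (3,5,7,0,2),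
    (3,5,0,2,7), (3,5,0,7,2), (3,7,1,6,0), (3,7,1,0,6), (3,7,3,4,0), (3,7,3,0,4), (3,7,5,2,0),
    (3,7,5,0,2), (3,7,0,1,6), (3,7,0,3,4), (3,7,0,5,2), (3,0,1,5,8), (3,0,1,6,7), (3,0,1,7,6),
    (3,0,3,4,7), (3,0,3,7,4), (3,0,5,2,7), (3,0,5,7,2), (3,0,7,1,6), (3,0,7,3,4), (3,0,7,5,2),
    (7,1,6,3,0), (7,1,6,0,3), (7,1,0,6,3), (7,3,1,6,0), (7,3,1,0,6), (7,3,3,4,0), (7,3,3,0,4),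
    (7,3,5,2,0), (7,3,5,0,2), (7,3,0,1,6), (7,3,0,3,4), (7,3,0,5,2), (7,0,1,6,3), (7,0,3,1,6),
    (7,0,3,3,4), (7,0,3,5,2), (0,1,3,4,9), (0,1,6,3,7), (0,1,6,7,3), (0,1,7,6,3), (0,3,1,5,8),
    (0,3,1,6,7), (0,3,1,7,6), (0,3,3,4,7), (0,3,3,7,4), (0,3,5,2,7), (0,3,5,7,2), (0,3,7,1,6),
    (0,3,7,3,4), (0,3,7,5,2), (0,7,1,6,3), (0,7,3,1,6), (0,7,3,3,4), (0,7,3,5,2)],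
  -- Sigma_5[14]
   [(1,1,1,7,7), (1,1,7,1,7), (1,1,7,7,1), (1,7,1,1,7), (1,7,1,7,1), (1,7,7,1,1), (7,1,1,1,7),
    (7,1,1,7,1), (7,1,7,1,1), (7,7,1,1,1)],
  -- Sigma_5[15]
   [(1,2,5,9,0), (1,2,5,0,9), (1,2,7,7,0), (1,2,7,0,7), (1,2,0,5,9), (1,2,0,7,7), (1,3,5,8,0),
    (1,3,5,0,8), (1,3,0,5,8), (1,6,3,7,0), (1,6,3,0,7), (1,6,7,3,0), (1,6,7,0,3), (1,6,0,3,7),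
    (1,6,0,7,3), (1,7,2,7,0), (1,7,2,0,7), (1,7,6,3,0), (1,7,6,0,3), (1,7,7,2,0), (1,7,7,0,2),
    (1,7,0,2,7), (1,7,0,6,3), (1,7,0,7,2), (1,0,2,5,9), (1,0,2,7,7), (1,0,3,5,8), (1,0,6,3,7),
    (1,0,6,7,3), (1,0,7,2,7), (1,0,7,6,3), (1,0,7,7,2), (3,1,4,9,0), (3,1,4,0,9), (3,1,6,7,0),
    (3,1,6,0,7), (3,1,7,6,0), (3,1,7,0,6), (3,1,0,4,9), (3,1,0,6,7), (3,1,0,7,6), (3,3,4,7,0),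
    (3,3,4,0,7), (3,3,7,4,0), (3,3,7,0,4), (3,3,0,4,7), (3,3,0,7,4), (3,5,1,8,0), (3,5,1,0,8),
    (3,5,2,7,0), (3,5,2,0,7), (3,5,7,2,0), (3,5,7,0,2), (3,5,0,1,8), (3,5,0,2,7), (3,5,0,7,2),
    (3,7,1,6,0), (3,7,1,0,6), (3,7,3,4,0), (3,7,3,0,4), (3,7,5,2,0), (3,7,5,0,2), (3,7,0,1,6),
    (3,7,0,3,4), (3,7,0,5,2), (3,0,1,4,9), (3,0,1,6,7), (3,0,1,7,6), (3,0,3,4,7), (3,0,3,7,4),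
    (3,0,5,1,8), (3,0,5,2,7), (3,0,5,7,2), (3,0,7,1,6), (3,0,7,3,4), (3,0,7,5,2), (7,1,2,7,0),
    (7,1,2,0,7), (7,1,6,3,0), (7,1,6,0,3), (7,1,7,2,0), (7,1,7,0,2), (7,1,0,2,7), (7,1,0,6,3),
    (7,1,0,7,2), (7,3,1,6,0), (7,3,1,0,6), (7,3,3,4,0), (7,3,3,0,4), (7,3,5,2,0), (7,3,5,0,2),
    (7,3,0,1,6), (7,3,0,3,4), (7,3,0,5,2), (7,7,1,2,0), (7,7,1,0,2), (7,7,0,1,2), (7,0,1,2,7),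
    (7,0,1,6,3), (7,0,1,7,2), (7,0,3,1,6), (7,0,3,3,4), (7,0,3,5,2), (7,0,7,1,2), (0,1,2,5,9),
    (0,1,2,7,7), (0,1,3,5,8), (0,1,6,3,7), (0,1,6,7,3), (0,1,7,2,7), (0,1,7,6,3), (0,1,7,7,2),
    (0,3,1,4,9), (0,3,1,6,7), (0,3,1,7,6), (0,3,3,4,7), (0,3,3,7,4), (0,3,5,1,8), (0,3,5,2,7),
    (0,3,5,7,2), (0,3,7,1,6), (0,3,7,3,4), (0,3,7,5,2), (0,7,1,2,7), (0,7,1,6,3), (0,7,1,7,2),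
    (0,7,3,1,6), (0,7,3,3,4), (0,7,3,5,2), (0,7,7,1,2)],
  -- Sigma_5[16]
   [(3,7,7,0,0), (3,7,0,7,0), (3,7,0,0,7), (3,0,7,7,0), (3,0,7,0,7), (3,0,0,7,7), (7,3,7,0,0),
    (7,3,0,7,0), (7,3,0,0,7), (7,7,3,0,0), (7,7,0,3,0), (7,7,0,0,3), (7,0,3,7,0), (7,0,3,0,7),
    (7,0,7,3,0), (7,0,7,0,3), (7,0,0,3,7), (7,0,0,7,3), (0,3,7,7,0), (0,3,7,0,7), (0,3,0,7,7),
    (0,7,3,7,0), (0,7,3,0,7), (0,7,7,3,0), (0,7,7,0,3), (0,7,0,3,7), (0,7,0,7,3), (0,0,3,7,7),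
    (0,0,7,3,7), (0,0,7,7,3)]]

/-- The exponent vectors of the monomials of `GL_5[1]`. -/
def glExponents : List (ℕ × ℕ × ℕ × ℕ × ℕ) :=
   [(1,1,1,14,0), (1,1,1,2,12), (1,1,1,0,14), (1,1,14,1,0), (1,1,14,0,1), (1,1,3,4,8), (1,1,6,3,6),
    (1,1,6,6,3), (1,1,0,1,14), (1,1,0,14,1), (1,2,3,5,6), (1,2,3,6,5), (1,2,5,4,5), (1,2,5,5,4),
    (1,3,1,12,0), (1,3,1,4,8), (1,3,1,0,12), (1,3,12,1,0), (1,3,12,0,1), (1,3,4,4,5), (1,3,4,5,4),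
    (1,3,5,4,4), (1,3,0,1,12), (1,3,0,12,1), (1,0,1,1,14), (1,0,1,14,1), (1,0,3,1,12), (1,0,3,12,1),
    (3,1,1,12,0), (3,1,1,4,8), (3,1,1,0,12), (3,1,12,1,0), (3,1,12,0,1), (3,1,4,4,5), (3,1,4,5,4),
    (3,1,5,4,4), (3,1,0,1,12), (3,1,0,12,1), (3,3,3,4,4), (3,3,4,3,4), (3,3,4,4,3), (3,5,1,4,4),
    (3,5,1,8,0), (3,5,1,0,8), (3,5,8,1,0), (3,5,8,0,1), (3,5,0,1,8), (3,5,0,8,1), (3,0,1,1,12),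
    (3,0,1,12,1), (3,0,5,1,8), (3,0,5,8,1), (0,1,1,1,14), (0,1,1,14,1), (0,1,3,1,12), (0,1,3,12,1),
    (0,3,1,1,12), (0,3,1,12,1), (0,3,5,1,8), (0,3,5,8,1)]

/-- The class in `(QP_5)_17` of a sum of monomials given by exponent vectors of total degree 17. -/
noncomputable def classOf (L : List (ℕ × ℕ × ℕ × ℕ × ℕ))
    (h : ∀ t ∈ L, t.1 + t.2.1 + t.2.2.1 + t.2.2.2.1 + t.2.2.2.2 = 17) : QP 5 17 :=
  (hitDeg 5 17).mkQ ⟨ofExponents L, ofExponents_mem L h⟩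

set_option maxRecDepth 20000 in
theorem sigmaExponents_degree : ∀ i, ∀ t ∈ sigmaExponents i,
    t.1 + t.2.1 + t.2.2.1 + t.2.2.2.1 + t.2.2.2.2 = 17 := by
  decide

set_option maxRecDepth 20000 in
theorem glExponents_degree : ∀ t ∈ glExponents,
    t.1 + t.2.1 + t.2.2.1 + t.2.2.2.1 + t.2.2.2.2 = 17 := by
  decide

/-- The class `[Sigma_5[i + 1]]` in `(QP_5)_17`. -/
noncomputable def sigmaClass (i : Fin 16) : QP 5 17 :=
  classOf (sigmaExponents i) (sigmaExponents_degree i)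

/-- The class `[GL_5[1]]` in `(QP_5)_17`. -/
noncomputable def glClass : QP 5 17 :=
  classOf glExponents glExponents_degree

end HitProblem

namespace HitProblem

open MvPolynomial

/-- A binary trie of natural numbers indexed by natural numbers; the value `0` means absence. -/
inductive Trie : Type
  | nil : Trie
  | node (value : ℕ) (left right : Trie) : Trie

namespace Trie

/-- Evaluate the root of `t` before continuing with `f`. -/
noncomputable def force {α : Type} (t : Trie) (f : Trie → α) : α :=
  Trie.rec (f nil) (fun v l r _ _ => f (node v l r)) t

/-- The value stored at the index `k`. -/
noncomputable def find (t : Trie) : ℕ → ℕ :=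
  Trie.rec (fun _ => 0)
    (fun v _ _ findL findR k =>
      Nat.rec v (fun _ _ => Nat.rec (findL (Nat.div k 2)) (fun _ _ => findR (Nat.div k 2))
        (Nat.land k 1)) k) t

/-- Store the value `v` at the index `k`, provided that `k < 2 ^ fuel`. -/
noncomputable def insert (fuel : ℕ) : Trie → ℕ → ℕ → Trie :=
  Nat.rec (fun t _ _ => t)
    (fun _ ins t k v =>
      Trie.rec
        (Nat.rec (node v nil nil)
          (fun _ _ => Nat.rec (force (ins nil (Nat.div k 2) v) fun l => node 0 l nil)
            (fun _ _ => force (ins nil (Nat.div k 2) v) fun r => node 0 nil r) (Nat.land k 1)) k)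
        (fun w l r _ _ => Nat.rec (node v l r)
          (fun _ _ => Nat.rec (force (ins l (Nat.div k 2) v) fun l' => node w l' r)
            (fun _ _ => force (ins r (Nat.div k 2) v) fun r' => node w l r') (Nat.land k 1)) k)
        t) fuel

/-- The code of the monomial `k`: the table stores the successor of the code. -/
noncomputable def code (t : Trie) (k : ℕ) : ℕ := Nat.sub (t.find k) 1

/-- The code of a sum of monomials. -/
noncomputable def sumCode (t : Trie) (ks : List ℕ) : ℕ :=
  List.rec 0 (fun k _ ih => Nat.xor (t.code k) ih) ks

end Trie

/-- The number with the digits `l` in base 32, the least significant digit first. -/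
noncomputable def encode (l : List ℕ) : ℕ :=
  List.rec 0 (fun a _ ih => Nat.add a (Nat.mul 32 ih)) l

/-- The five digits of `k` in base 32. -/
noncomputable def digits (k : ℕ) : List ℕ :=
  [Nat.mod k 32, Nat.mod (Nat.div k 32) 32, Nat.mod (Nat.div k 1024) 32,
    Nat.mod (Nat.div k 32768) 32, Nat.div k 1048576]

/-- The codes of the terms of `Sq^j` of the monomial with the exponents `a :: l`, in front of
`rest`, where `w` is the weight of the digit `a` in the code `k` of the monomial. -/
noncomputable def termsAux (l : List ℕ) : ℕ → ℕ → ℕ → ℕ → List ℕ → List ℕ :=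
  List.rec
    (fun a w j k rest =>
      Bool.rec rest (Nat.add k (Nat.mul w j) :: rest) (Nat.beq (Nat.land a j) j))
    (fun b _ f a w j k rest => Nat.rec (k :: rest) (fun _ _ => Nat.rec rest
      (fun c acc => Bool.rec acc
        (f b (Nat.mul w 32) (Nat.sub j c) (Nat.add k (Nat.mul w c)) acc)
        (Nat.beq (Nat.land a c) c)) (Nat.succ j)) j) l

/-- The terms of `Sq^j` of the monomial `k`. -/
noncomputable def terms (j k : ℕ) : List ℕ :=
  termsAux [Nat.mod (Nat.div k 32) 32, Nat.mod (Nat.div k 1024) 32,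
    Nat.mod (Nat.div k 32768) 32, Nat.div k 1048576] (Nat.mod k 32) 1 j k []

/-- The sum of the five digits of `k` in base 32. -/
noncomputable def digitSum (k : ℕ) : ℕ :=
  List.rec 0 (fun a _ ih => Nat.add a ih) (digits k)

/-- The terms of `Sq^j` of the monomial `k`, if the degree is at most 31. -/
noncomputable def hitTerms (j k : ℕ) : List ℕ :=
  Bool.rec [] (terms j k) (Nat.ble (Nat.add (digitSum k) j) 31)

/-- Add `k` to a set without repetitions, or remove it if it is there. -/
noncomputable def toggle (k : ℕ) (l : List ℕ) : List ℕ :=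
  List.rec [k] (fun x xs ih => Bool.rec (x :: ih) xs (Nat.beq k x)) l

/-- Split the monomials `ks` into those in the table, the sum of whose codes is added to `acc`,
and the others, which are added to `unk`. -/
noncomputable def scan (t : Trie) (ks : List ℕ) : ℕ → List ℕ → ℕ × List ℕ :=
  List.rec (fun acc unk => (acc, unk))
    (fun k _ f acc unk => Nat.rec (f acc (toggle k unk)) (fun c _ => f (Nat.xor acc c) unk)
      (t.find k)) ks

/-- A table of codes together with a relation: the sum of the basis elements in `acc` and of the
monomials in `unk` is hit. -/
structure State where
  table : Trie
  acc : ℕ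
  unk : List ℕ

namespace State

/-- If the relation involves one unknown monomial, put that monomial into the table. -/
noncomputable def finish (t : Trie) (acc : ℕ) (unk : List ℕ) : State :=
  List.rec ⟨t, 0, []⟩ (fun k ks _ => List.rec
    (Nat.rec ((t.insert 26 k 1).force fun t' => ⟨t', 0, []⟩)
      (fun c _ => (t.insert 26 k (Nat.add c 2)).force fun t' => ⟨t', 0, []⟩) acc)
    (fun _ _ _ => ⟨t, 0, []⟩) ks) unk

/-- Add the hit polynomial with the code `e` to the relation. -/
noncomputable def step (s : State) (e : ℕ) : State :=
  State.rec (fun t acc unk =>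
    Prod.rec (fun acc' unk' => Nat.rec (finish t acc' unk') (fun _ _ => ⟨t, acc', unk'⟩)
      (Nat.div e 134217728))
    (scan t (hitTerms (Nat.pow 2 (Nat.mod (Nat.div e 33554432) 4)) (Nat.mod e 33554432))
      acc unk)) s

/-- Evaluate `s` before continuing with `f`. -/
noncomputable def force {α : Type} (s : State) (f : State → α) : α :=
  State.rec (fun t acc unk => f ⟨t, acc, unk⟩) s

/-- Use the hit polynomials encoded in the digits of `N` in base `2 ^ 28`. -/
noncomputable def steps (m : ℕ) : ℕ → State → State :=
  Nat.rec (fun _ s => s) (fun _ f N s =>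
    (s.step (Nat.mod N 268435456)).force (f (Nat.div N 268435456))) m

/-- Use the hit polynomials encoded in the numbers `Ns`, 14 in each. -/
noncomputable def run (Ns : List ℕ) : State → State :=
  List.rec (fun s => s) (fun N _ f s => (steps 14 N s).force f) Ns

end State

/-- Put the monomials `ks` into the table, with the codes `v`, `2 * v`, `4 * v`, and so on. -/
noncomputable def insertBasis (ks : List ℕ) : ℕ → Trie → Trie :=
  List.rec (fun _ t => t)
    (fun k _ f v t => (t.insert 26 k (Nat.succ v)).force (f (Nat.mul 2 v))) ks

/-- The table obtained from the basis `ks` and the hit polynomials `Ns`. -/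
noncomputable def table (ks Ns : List ℕ) : Trie :=
  State.table (State.run Ns ⟨insertBasis ks 1 .nil, 0, []⟩)

/-- Whether `p` holds for all lists of `m` numbers with the sum `n`. -/
noncomputable def allComps (m : ℕ) : ℕ → (List ℕ → Bool) → Bool :=
  Nat.rec (fun n p => Nat.rec (p []) (fun _ _ => true) n)
    (fun _ f n p => Nat.rec true
      (fun a ih => Bool.rec false ih (f (Nat.sub n a) fun l => p (a :: l))) (Nat.succ n)) m

/-- Whether `p` holds for all numbers less than `n`. -/
noncomputable def allLt (n : ℕ) (p : ℕ → Bool) : Bool :=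
  Nat.rec true (fun a ih => Bool.rec false ih (p a)) n

/-- Whether `p` holds for all elements of `l`. -/
noncomputable def allMem {α : Type} (l : List α) (p : α → Bool) : Bool :=
  List.rec true (fun a _ ih => Bool.rec false ih (p a)) l

/-- Whether the codes vanish on `Sq^j` of all monomials of degree `n - j`. -/
noncomputable def checkSq (t : Trie) (n j : ℕ) : Bool :=
  allComps 5 (Nat.sub n j) fun u => Nat.beq (t.sumCode (terms j (encode u))) 0

/-- Whether the table contains all monomials of degree `n`. -/
noncomputable def checkComplete (t : Trie) (n : ℕ) : Bool :=
  allComps 5 n fun l => Nat.rec false (fun _ _ => true) (t.find (encode l))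

/-- Whether the monomials `ks` have degree `n` and the codes `v`, `2 * v`, and so on. -/
noncomputable def checkBasis (t : Trie) (n : ℕ) (ks : List ℕ) : ℕ → Bool :=
  List.rec (fun _ => true) (fun k _ f v => Bool.rec false (Bool.rec false (f (Nat.mul 2 v))
    (Nat.beq (t.code k) v)) (Nat.beq (digitSum k) n)) ks

/-- The lowest bit of `v`. -/
noncomputable def lowBit (v : ℕ) : ℕ := Nat.xor v (Nat.land v (Nat.sub v 1))

/-- Subtract from `v` the stored vectors with the same lowest bit as long as possible. -/
noncomputable def reduce (t : Trie) (fuel : ℕ) : ℕ → ℕ :=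
  Nat.rec (fun v => v) (fun _ f v => Nat.rec 0 (fun _ _ => Nat.rec v
    (fun p _ => f (Nat.xor v (Nat.succ p))) (t.find (Nat.mod (lowBit v) 2029))) v) fuel

/-- Whether at least `r` elements are found to be independent of their predecessors and the
vectors in `t`, the lowest bits of which are the bits of `mask`. -/
noncomputable def rankGe (vs : List ℕ) : Trie → ℕ → ℕ → Bool :=
  List.rec (fun _ _ r => Nat.beq r 0) (fun v _ f t mask r =>
    Nat.rec (f t mask r) (fun p _ =>
      Nat.rec (Nat.rec true (fun r' _ =>
          (t.insert 26 (Nat.mod (lowBit (Nat.succ p)) 2029) (Nat.succ p)).force fun t' =>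
            f t' (Nat.lor mask (lowBit (Nat.succ p))) r') r)
        (fun _ _ => f t mask r)
        (Nat.land mask (lowBit (Nat.succ p))))
      (reduce t 1000 v)) vs

/-- The images of the monomial `k` under `g - 1` for `g` in `gs`, as one vector. -/
noncomputable def row (t : Trie) (d : ℕ) (gs : List (ℕ → List ℕ)) (k : ℕ) : ℕ :=
  List.rec 0 (fun g _ ih => Nat.xor (Nat.xor (t.sumCode (g k)) (t.code k)) (Nat.shiftLeft ih d)) gs

/-- The list of the images of the elements of a list. -/
noncomputable def mapList {α β : Type} (f : α → β) (l : List α) : List β :=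
  List.rec [] (fun a _ ih => f a :: ih) l

/-- The exchange of the first two variables. -/
noncomputable def swapKey (k : ℕ) : List ℕ :=
  [encode [Nat.mod (Nat.div k 32) 32, Nat.mod k 32, Nat.mod (Nat.div k 1024) 32,
    Nat.mod (Nat.div k 32768) 32, Nat.div k 1048576]]

/-- The cyclic permutation of the variables. -/
noncomputable def cycleKey (k : ℕ) : List ℕ :=
  [encode [Nat.div k 1048576, Nat.mod k 32, Nat.mod (Nat.div k 32) 32, Nat.mod (Nat.div k 1024) 32,
    Nat.mod (Nat.div k 32768) 32]]

/-- The substitution that adds the second variable to the first one. -/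
noncomputable def transvectionKey (k : ℕ) : List ℕ :=
  Nat.rec [] (fun c ih => Bool.rec ih (Nat.add k (Nat.mul 31 c) :: ih)
    (Nat.beq (Nat.land (Nat.mod k 32) c) c)) (Nat.succ (Nat.mod k 32))

/-- The list of the monomials in the images of the monomials `ks`. -/
noncomputable def imageList (g : ℕ → List ℕ) (ks : List ℕ) : List ℕ :=
  List.rec [] (fun k _ ih => List.rec ih (fun x _ ih' => x :: ih') (g k)) ks

/-- Hit polynomials that determine the classes of all monomials of degree 17. -/
def hits17 : List ℕ := [
  0x418c630320c630528c220519422032942201394220709422006842107284220d084200d084010d080210d004210c08421,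
  0x60100070000c0d6000807000006d6000047010000f6100008000800f6008008000040f6000408000002f60000286000009,
  0x20006b010006c6100046001006b000806c6008046000086b000046c600044600000ab6000066030000d6200007001800d,
  0x30002c62000266008027000804d201004b001804b001802c60100266000427000044d200084b0000c4b0000c2c6000826,
  0x1840c60104060200c0b0100c0c61008060010c0b0008c0c6008806000140b6000c066100027010004d220004b030004b,
  0x11800c6110006002800b60180066100407010080d220080b030080b030040c62004066008407000880d201080b001880b,
  0x40000e600000e9000012740000c76000085050000b63000066108007011000d221000b031000b030800c6208006021800b,
  0x148720018476000c25000142a2000c4a0000c890001c280001c47400104700004e80000507400088760008450000165,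
  0x2001c46600142300024454001845400108540008c5600046500004aa40004c660004a3000052620008e60000ce64000c86,
  0x80e800081074010087601004540010660000ca8200186640014a36000c6300014a62000cc60000cc720008c70001c66,
  0x60080a3000812620100e600180e64018086002808720300476018025002802a201804a0018089003802800380474020047,
  0x280a620180c600180c720100c700380662038046602802300480454030045402008540100c5600806500080aa40080c6,
  0x230004a030008907000280700047440004701000e8010010742000876200045402006600180a8203006640280a36018063,
  0x440008542000c5610006501000aa41000c661000a3010012622000e603000e64300086050008726000476300025050002a,
  0x440006603000a8260006645000a3630006305000a623000c603000c722000c707000662700046650002309000454600045,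
  0x190090038408003880740208070009c08000a007401100760108050002c054001c060001c09000240740018076001005,
  0x40118056008c05000940a40098066009403000a4062011c060019c064019006002900720308076018405002840a201880a,
  0x194082030c0640294036018c0300294062019806001980720118070038c0620388066028403004880540308054021005,
  0x50100726008076300405050040a230080a03010090700408070080744008070101c080102007420100762008054020c06,
  0x2700806650040309008054600805440100542018056100c05010140a4101806610140301024062201c060301c064301006,
  0x380090048007403000760200054400c0603014082600c0645014036300c0305014062301806030180722018070700c06,
  0x26100076308005050800a231000a0320009070800807100074410007013800801400074220007621000500580054038006,
  0x650800309100054610005442000542300056118005012800a4130006612800301480062238006033800643200060520007,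
  0x9000074600007640000544180060328008261800645280036318003052800623300060330007223000707180062710006,
  0x188680018488601044402010670200c680100c88610084400110670010c680008c8860088440b0000547000060700009,
  0x40204a3601046300188a600184c620104c64010486600844500088892010887002086700104c7600846400088a82010868,
  0x20c8500118656008c4300094862010c860018c86003086560184430028486201888600190664010866201106620108a6,
  0x2004c7610046401008a8220086803008680300488620044400088e60010cc540090a3600886320088c660084834010885,
  0x3010664200866220106622008a644004a3620046303008a603004c622004c642004866100445010088922008870400867,
  0x610086321008c6610048342008850400c8502018656100c4301014862200c860300c860600865630044305004862300886,
  0x2080c7610806401100a82210068031006803080886208044022006702180680118088611004401008e60200cc541010a3,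
  0x3200664210066222006622100a644080a3620806303100a603080c622080c642080866108045011008922100870410067,
  0x611006321100c6610808342100850418085023006561180430128086221808603180860610065630804305080862310086,
  0x384460030827601842420304464020446001844a4018846202884620188480019028601082401100e602180c541200a3,
  0x4010c462010c48201144640214236010c23001944600198452011845401104520108496010425402084560204230038826,
  0x20308454010847001044b6008426000882c201082a0009c4600118276008c2420098466009023401102660088250008c4a,
  0x7004460600827630042426004464400446030044a430084625008462300848030102862008240030c2640290236018823,
  0x4200c462200c48220144644014236200c23030144603018452201845420104522008496200425440084564004230700826,
  0x26008454200847020044b6100426010082c220082a0101c4602018276100c2421018466101023420102661008250100c4a,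
  0x7080460610027630802426080464408046030804a431004625100462310048032002862100240600c2645010236300823,
  0x42180462218048222804644280236218023032804603300452230045422004522100496208025441004564080230710026,
  0x26100454210047020804b6108026011002c221002a0138046023002761180242130046612002342200266110025011804a,
  0x2098076108c0401114082210c080310c08030900862088040220c070218c0801190086110804061802645200236310023,
  0x320c064210c062220c06221140644094036208c0303114060309806220980642090066108805011100922110070410c07,
  0x6110c0321118066109003421100504190050230c0561188030129006221900603190060610c05630880305090062311006,
  0x7088060610407630840426088064408806030880a431080625108062310808032040862104040111c0602198054121403,
  0x42188062218808222880644284036218403032880603308052230805422080522108096208405441080564084030710406,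
  0x26108054210807020880b6108406011040c221040a0138806023040761184042130806612040342204066110405011880a,
  0xd434000cc440014840002464400186440010a440008e4000056460004c200001a360000e2061840645204036310403,
  0x2001ca32001c654000c672000ca74000ce320014e32000ce54000ca52000c6940014652002463400188320018c340010c3,
  0x40004a720004e740004e5200056320009432000c2b40014272001c274001c252002c230002c240002c4320028434001c63,
  0x2048063403008320300c340200c3001814340180c440280840048064403006440200a440100e4000816460080c2200046b,
  0x5802400580432050043403806320380a32038065401806720180a740180e320280e320180e540180a520180694028065,
  0x42000e4010016461000c2200806b40080a720080e740080e520081632010143201802b4028027203802740380252058023,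
  0x23000e543000a5230006945000652900063460008326000c344000c3030014343000c445000840900064460006444000a4,
  0x4500027270002747000252b000230b000240b000432a00043470006327000a32700065430006723000a743000e325000e3,
  0xa064401106440108a460084a2000854440088c46008882210006b41000a721000e741000e521001632200143230002b,
  0x19c4440190444018884001850440204844030444602842200488244030824402102440118246009422000a4444009844,
  0x400902720098274009825200a823401184320218434021043203104320308834020883201090340110830011c832011c44,
  0x40104a520104e520204e320108e40010ce44010c844020c442040c232030c254020c252010c2940114252012423200882b,
  0x40188272019027201982540190252018829402882520388252039023203884400388642040463203046540204652010469,
  0x20188c400190c340108c340104e3201052340104672020467201042b402042720304274030425205042340388232048823,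
  0x2011864001986420198444030c234019823202982340294226018c2200294442030c440030c642030864601846200284c4,
  0x20084e640084e4000856340088e320088e540088a520088694009065200986520098a300114c32010cc46008c6200098a4,
  0x403046320304a3400986300084e74008867000846b000842d200844b400848720084c740084c500084a9200846a40084a6,
  0x6101422010244441018440102064420106442008a461004a2010054441008c461008824011c232011c254010c272020c27,
  0x42010830201c832201c440301c444301044430088403005044400484460044465004220900824460082444010244201824,
  0x42014252202423210082b41010272101827410182521028234201843240184344010432601043260088344008832200903,
  0x26004654400465220046942004a522004e524004e322008e40200ce44200c844400c442800c232600c254400c252200c29,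
  0x2a004234700823290082343008272301027230182543010252300829450082527008252701023270084407008642800463,
  0x2600864630046205004c423008c403010c342008c342004e3220052342004672400467220042b440042726004274600425,
  0x2200cc46100c6201018a42201864030186423018444600c234301823250182345014226300c2205014442600c440600c64,
  0x1004a9210046a41004a621004e641004e4010056341008e321008e541008a521008694101065210186521018a302014c3,
  0x2201c254200c272400c27460046326004a3410186301004e74100867010046b010042d210044b410048721004c741004c5,
  0x4610024442002442300246128022014804441300440140064422006442100a461080a2010814441100c461100824201c23,
  0x26100834410083221010342200830238083223804403380444320044431008403081044408084460804465080220910024,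
  0x26180254418025221802942280252248023211002b41200272130027413002521500234230043243004344200432620043,
  0x27100440710064280806326080654408065220806942080a522080e524080e322100e402180e4421808444180442818023,
  0x4408027260802746080252a080234710023291002343100272320027233002543200252310029451002527100252720023,
  0x528044261804406180642610064630806205080c423100c403200c342100c342080e3220812342080672408067220802b,
  0x213006521300a302280c322180c4611806201300a422300640330064233004446180234330023253002345280226318022,
  0x410808721080c741080c501080a9210806a41080a621080e641080e4010816341100e321100e541100a521100694120065,
  0x11908461108424238023223802542180272418027460806326080a3413006301080e74110067010806b010802d210804b,
  0x1110a422110640410c64021186302098646108c4201114842210c840310c840309084620884202210630220c640218c84,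
  0x630844205088842310884032048462104420210c660208c8661088430111085221108304110630210cc30208cc46108862,
  0x110868421086422108a422208640418864023086302304646118442012888422188840318884251086306108630610464,
  0x6208443031048603088862208886610844442104846108482010890422204a302188c302184c4611046221108c44110884,
  0x1088c601108a62210866041086502188664220463222046561104430120885242046302108e3421088322208832210885,
  0x2311044032102462108220208887441046342104a303088c4620846224104a322108c3421046522104a5610846302084c6,
  0x708844260902325110232510c430610c430610c240509c224509022630882226088444408844030884843108442510844,
  0x22288442428823043082344284226218422032884403304442230444422044422104486208424441082464084220710444,
  0x222902321310230230c430230c240129c22412902261188222130844612042242208246110424011884842188442219044,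
  0x61090220112024421102422108284130823213082542288236118423222882501288460130845223084302388430138844,
  0x412082561108232211045440902362088230410c260310c4603090464208846010884a4110846211104661088244209044,
  0x4410843281042344104252210429422042522404234420423621042342108456108425021042a421082622208264121023,
  0x2218846421902322190252419023431102323210230211c43440882522088294209025220a023411102521120234211043,
  0x25208232610843261042543108252510825460882363084230610426060844605088462310846031884644188234218825,
  0x2210c464210c4422114442220c440420c430218c4645108234320823251884306184440538422452042246104236310422,
  0x24104274208827240882722108474110827212082721110270210c47220982521118256108c23020982601098460111446,
  0x22114252411423420982322118434111823212182341214226110c22221182444094226208c22030984403114444210427,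
  0x34036001c02423042322304250418c252418c430320c252320c4302198434410c234220c234210c252220c254211423,
  0x4028c052048c03403100320318034021803001a803401980440290040048c044030c0440214044011c04000ac046009802,
  0x20584030058404005880320508034038c0320394032038c054018c0720194074019c032029c032019c0540194052018c09,
  0x44014044201c040102c0461018022008c0b40094072009c074009c05200ac032012803201840b402840720384074038405,
  0x2501c032301c0543014052300c094500c052900c034601003260180344018030302803430180445010040900c044600c04,
  0x230040b4500407270040747004052b004030b004040b008032a008034700c0327014032700c054300c0723014074301c03,
  0x41308040140c044220c0442114046109402010a804411180461110022100c0b41014072101c074101c052102c032202803,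
  0x2238804033880443208044311004030a004440900446088046508402091040446104044420404423040461284020148804,
  0x211040b4120407213040741304052150403423080324308034420803262080326110034411003221200342210030239003,
  0x2208c0942094052209c052409c032211c040219c0442190044418804281840326184054418405221840942284052248403,
  0x29104034310407232040723304054320405231040945104052710405272040327108040710c042808c032608c054408c05,
  0x5098042311804032180342118034209c03220a4034208c072408c07220840b4408407260840746084052a084034710403,
  0x1314042230c040330c04233080446184034330403253040345284026318402052880426188040618c042610c046308c02,
  0x41094062109c064109c04010ac034111c032111c0541114052110c094120c052130c052131403022980322198046118c02,
  0x24184074608c0326094034130c030109c074110c070108c0b010840d210880b41090072109807410980501094092108c0a,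
  0x3500034330004452000409180044618004442800442380040158004613000200680036038002423840322384054218407,
  0x27280032718005431800723280074338003253800323380054328005231800945180052918003462000326300034430003,
  0x41280072138007413800521580032250003230800b4508007270800747080052b080030b080040b100032a100034718003,
  0x6001c2100034222002c424001c822001cc240014c22000d420000d8160008c100001e160001010d000036700002211800b,
  0x4001ca12002c61000306160004e100005a2200096240010e200020e140018c16000ca140018a2600146120028620002c62,
  0x20500620058062603802100680222058042403808220380c240280c22018142001818160100c12000d6140014e12001ce1,
  0x40280e120380e140380a12058061006006160080e100081a2201016240200e200400e140300c160180a140300a26028061,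
  0x46000a265000612a000620b0006267000210d000222b00042470008227000c245000c22300142030018162000c12018161,
  0x6010881230016145000e127000e147000a12b000610c0006161000e101001a2220016244000e208000e146000c163000a1,
  0x2010d024020c822030c82203146100318616018c4120314424021442001a44240198422029842201988240190820019101,
  0x20388820039081402108140118816008c814009882200a86100128616009441200a842000ac424011c422011c824011482,
  0x50c220048c4240388420058442205044260284414030881601848120304c240204c2001854240188c220288c24028882,
  0x2009c264009c24200ac224009c81200ac4160098212012822601142140218416020c212031822601902140310416028821,
  0x4009c434008cc32008cc54008c474008c852008d0340094832009c832009c45400944500094290008c2b2008c2a4009426,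
  0x4018c262028c260038c252038c430048c2300394234038c2220394222038c244028c242018c284019424201a4220009c27,
  0x2029c222019c240028c270019c252019c4340194430018ce32018cc34018c834028c434018c45201944500294250018c29,
  0x2038483203844540284450028429001842b201842a4028426203842640384242058422603042120508410029c234019c22,
  0x58c21201a82140298212039821403902120588210038427403844340184c320184c54018447401848520185034028483,
  0x4038c4120394414029441002a4210039c21001ac21000b4212012c214021c212031c2140314212050c2140384812058441,
  0x60104a140208c1602046100388a200384c200308e120504612048861005046200394614019c4140194812018d014028c81,
  0x20288e10029c612029861201a06140190a1201892140288a1601886140308624021062401186220118a240110a22010922,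
  0x4010cc26010c6120118c140094c12009cc10009cc240098a1600906140110c160088a12008942000896240108e220190e1,
  0x2018ce20018d214018cc120194c12028cc10048c614030c612030ca14020ca12010d2140114a1201246140214612008d41,
  0x4010ce120114e12020ce1002946300194272018c470018c674018c644028c624018ca220194a200294a1001a4614019861,
  0x94e34008ce24008ca42008c6840094642009c642009ca240094a2000952100194e10009ce10008d6140090e120098e1,
  0x2038c620038c634020c63401146320214634010c652010ca500094a50008c694008c662008ca60008ce52010ce30008d23,
  0x2008961200856260084c120109410009c652011c630009ca34011c61000ac614009c620008ca72010c67000946700194a3,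
  0x40284c120384c100384e100085a1201056140204e120304e140304a10038ca10058461403886120390610028ce140188e1,
  0x184e520188e3001852300284e340184e240184a420184684028464403846220384a240284a2002852100185612018541,
  0x2019c620019c630019465201986340190632029063401886520188a500284a500184a720188670018469401846620184a6,
  0x23018824301082030110162008810038465203886300384a300284672018c660028c652030c630028ca340288630019ca1,
  0x4201c422201c8242014822200d024400c822600c82260146106018616300c4126014424401442030244243018422501842,
  0x43008c225008c2450088227008820701081440108142018816100c81410188221028610202861610144121028420102c42,
  0x6301021460104165008210a00c220900c4247008420b004422a0044265004414600881630048126004c244004c20300542,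
  0x100c2b2100c2a41014262101c264101c242102c224101c812102c4161018212202822620142144018416400c212601822,
  0x430142423024220101c274101c434100cc32100cc54100c474100c852100d0341014832101c832101c4541014450101429,
  0x230144505014250300c294300c262500c260700c252700c430900c2307014234700c2227014222700c244500c242300c28,
  0x2a008410501c234301c222501c222301c240500c270301c252301c4343014430300ce32300cc34300c834500c434300c45,
  0x4300485230050345004832700483270044545004450500429030042b230042a4500426270042647004242b004226600421,
  0x2a00c2147004812b004410b00c2123028214501821270182147010212b008210700427470044343004c323004c54300447,
  0x43014812300d014500c814700c412701441450144105024210701c210302c2101034212202c214401c212601c214601421,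
  0x22018a242010a2220092262004a144008c1640046107008a207004c206008e12a0046129008610a0046207014614301c41,
  0x10096242008e223010e125008e10501c612501861230206143010a1230092145008a16300861460086244010624201862,
  0x220246144014612100d414200cc26200c6122018c141014c12101cc10101cc241018a1610106142010c161008a12100942,
  0x5014a1030246143018612300ce20300d214300cc123014c12500cc10900c614600c612600ca14400ca12200d2142014a1,
  0x100d6141010e121018e14200ce122014e12400ce1050146303014272300c470300c674300c644500c624300ca223014a2,
  0x100ce52200ce30100d2301014e34100ce24100ca42100c6841014642101c642101ca241014a2010152103014e10101ce1,
  0x2200c67010146703014a32700c620700c634400c63420146324014634200c652200ca501014a50100c694100c662100ca6,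
  0x27010610500ce143008e12100961210056261004c122009410101c652201c630101ca34201c610102c614101c620100ca7,
  0x5005210300561230054145004c127004c107004e101005a1220056144004e126004e146004a10700ca10b004614700861,
  0x300469430046623004a603004e523008e3030052305004e343004e243004a423004684500464470046227004a245004a2,
  0x500ca345008630301ca12301c620301c630301465230186343010632501063430086523008a505004a503004a72300867,
  0x3480424330042253004223300824320082032010162100810700465270086307004a305004672300c660500c652600c63,
  0x61280412150042015804242380422238082422808222181024418082261808226280610630061631804126280424428042,
  0x26080c244080c2030814243100c225100c2451008227100820720081442008142300816118081413008221500610250061,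
  0x4430041641802126300226320021462004165100210a18022091804247100420b080422a08042650804146100816308081,
  0x213804541280450128029011802b211802a412802621380264138024215802241380812158041613002122500226228021,
  0x271802445180242318028432802423480220138027413804341180c321180c541180474118085211810341280832138083,
  0x43180834518043431804523280450528025031802943180262518026071802527180430918023072802347180222728022,
  0x47080242b0802266080212a100410538023433802225380222338024051802703380252338043432804303180e323180c3,
  0x43080c323080c543080474308085230810345080832708083270804545080450508029030802b230802a45080262708026,
  0x4438021263802146280212a1802147080812b080410b1802123500214530021273002147200212b1002107080274708043,
  0xa080620728061433804143280812318101451808147180412728041452804105480210738021035802101680212258021,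
  0x46100624420062423006222300a242200a2221012262080a144100c1640806107100a207080c206100e12a080612910061,
  0x42200c161100a12110142011016242100e223200e125100e105380612530061234006143200a1231012145100a16310061,
  0x44180a1221812142280a122480614428061211814142180c2621806122300c141280c121380c101380c241300a16120061,
  0x451806243180a223280a205280a10348061433006123180e2031812143180c123280c125180c10918061461806126180a1,
  0x12812103280e101380e1011816141200e121300e142180e122280e124180e105280630328027231804703180674318064,
  0x118069411806621180a601180e522180e3011812301280e341180e241180a421180684128064213806421380a241280a2,
  0x158061413806201180a72218067012806703280a327180620718063441806342280632428063421806522180a501280a5,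
  0x7180a10b080614710061272006105180e143100e12110161210816261080c122101410138065223806301380a34238061,
  0x470806227080a245080a205081210308161230814145080c127080c107080e101081a1220816144080e126080e146080a1,
  0x5080a503080a723100670308069430806623080a603080e523100e3030812305080e343080e243080a423080684508064,
  0x23180660518065261806305180a3451006303380a1233806203380630328065233006343200632520063431006523100a5,
  0x610c816308841260888244088820308902431088225108822311082032108162108410708065271006307080a30508067,
  0x2105220110542010894242088c222090c24209082220a04244090422609042260906125110610510c632510c620610c62,
  0x41208820140862422086242108a222210624311061232106123110a1440906162088610410ca20310cc203090c261084a1,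
  0x6110c4122118816208c41031148203098824209842010a8424111842212184221118826109041421108161088812110902,
  0x10882b210882a410902621098264109824210a8226109421021242242114422420c422320c620210ce24210c822220c82,
  0x2110c2841114242112422410984341088c321088c541088474108885210890341090832109883210984541090450109029,
  0x4110c834120c434110c45211144501214252110c470110c294110c262120c262130c430140c2301314232130c244120c24,
  0x4208c262408c260808c232608c244408c242208c284209424220a4220121c232111c240120c272111c4341114432110cc3,
  0x41094444108c462108c484108c840108d034208c834408c434208c452209445040942541094252108c290108c490108c2a,
  0x44088a1220892142090a1220a0610211c624109c422109c824109482210a4420109c452209c43210a4230109c832109c44,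
  0x2209c244108c27210942701114272210c270408c270108cc52208cc301094c32108cc401094472208c470108c8722090e1,
  0x21504416128421025042202484420148842413084221310420140c424220c424109c232109c250111c252211c230409c23,
  0x2128883411884521190450129025011882941188262119026011a023012982321198244119024211882841288242148822,
  0x213044541204450120429011042b211042a412042621304264130424215042201390232138824213884341288434118883,
  0x81842326184244418424221842842284242248422413044341104c321104c541104474110485211050341204832130483,
  0x21184484118484011850342184834418443421844522284450428425412842521184290118449011842a42184262418426,
  0x211884701184872218447012844701284e2412848221484420138445223844321484230138483213844441284444118446,
  0x213842501388252238823043842322384244118427212842701288272218827041842722184c301284c321184c40119027,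
  0x6120441422088161104812118502421888224188822219082222906121310610230c620230c81611884101290824138423,
  0x1390612138881412888101285014418481221850142284812248441442844162184412230482413844221384824130481,
  0x1290a121288c1611846121284c201288c201308a222308620330862033088122384814119081211890141290412148841,
  0x22284c1211054141204c121304c1222886301288a301290632138862412886201188674118864211906421188a421288a2,
  0x62084814410482640844126108814520441631044126204424420442423044241184c242288610148861413086121308a1,
  0x42104e124104e10710862281046144104a1221052142204a122404614420461621046124108c122108e242088e124088e1,
  0x4120464011846842184642418464422846222284a204284a141284a1214846101484620150461423046122304a104184e1,
  0x41108a32121063411086521108a501204a521108670110469411046621104a641104a4211052241204a241304622130464,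
  0x12052101204e3011056141104e221104e401384a2223846202384630138863012886521308634120863411106321108e3,
  0x441846201190e121188e2011852201188e301184e422184e242184a224184a2012046721284a301304a341108e12110921,
  0x211206141110a1611086141188a222188c241184e121284e101288e122188e12118521011854142184c144188610818461,
  0x240986122118624111861212186121118a16108c6102098a24108cc221094c201114c22210cc20220cc1011a0614219061,
  0x23108c203188c20129861211988102198620320ca14410c614220c614210ca12220ca1421146122114a124114614209861,
  0x251886206188624610461262046145108614320861252086143108a125108a14608861630846106104a206084c205088c2,
  0x221886502184a522184662138463412846321284650130465223046304284630418465241886304184a326184810518863,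
  0x21384a101388a122388610438461211886621184e341184a32118467411846521184a501184c521188c301190a34218863,
  0x158422413882221390226120821422104161110212121c222211c420311c4243110424510842091044246104424138461,
  0x5288234318824251882423190242329022621882103290420331041423084162204214238422223884201584414138841,
  0x221942422294226118c2121298224130c22213142201314422230c420430c2223308230329023051882526188230519023,
  0x4194230130c252230c230428c232138c420148c220138c430138c242238c224228c220118c470118c284218c242418c24,
  0x128c260128c452228c4301294430128c83012946241194420118ce24118c824128c424118c44211944401294242219823,
  0x4128c2341194232118c274118c25211942501194262118c460119445211984301194834218c432218c4502194252218c26,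
  0x6210c214219422221984241198412119c230119c430119c622119c420119c242219c22011a422411982242190422138c23,
  0x2320c242520c220618c420319c22431902225190226310821261104164088214411022010ac224209c2262090214211841,
  0x609442050984223118420338c220328c430328c622328c420328c242330c224320c22232142205114234310c242311424,
  0x2618842071884227108420710c424211c212221c214230c212430c2122314214221421221242144114212810c212610c42,
  0x43204812310501451048129104414610841641042127204222710424451042423104284320424234042223308420528842,
  0x5104a345104624310464251046443104a223204a205204a123104e2031052143104c123204c1034046105304612330481,
  0x43090242308828450882429088220b10421471042265084210a0884107204614710441271048103204e1232086303204a3,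
  0x4510c222309c42030a4220309c430311c230309c242311c22431142243098224610c2126114216308c2125098222309824,
  0x230902625094230609423050944305094624308c824308c444508c424309442230944405094240908c224608c222710c22,
  0x470882227088240508c452608c430508c83270884345088434308883250888343088452309045050902503088294308826,
  0x210844a010842c220842a4408426260842646084242a084220710c230708c432708c420708c242b084210b084410b08422,
  0x460844342084c344084832608483260844544084452208449420848501085050108543210854241084c421084c64108486,
  0x4310426030842a430844623084864308484230850245084824708442270844445084440508428210842b42084472408447,
  0x51046526104630520463432044323104c3431048345104432908423450842523084294310445231048523204450520425,
  0x5084e205084c343084c223084c44310863231086503104a5231046603204650310c270308c47230884703084872310447,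
  0x2608c8126094414409441040a421020ac21220a8214409821260982146090212a088210508447070844527104430708483,
  0x4208c642408c644208ca222094a204094a10208d214208cc122094c1020a4610409c614209c4142094812208d014408c81,
  0x432102123120214511021471082127208214520821054042146204212a104214608c410408ce104094630708c624408c62,
  0x4310c812510c814311441232144105214214509421230a421030a441030a821431182123218210340c210530c212331021,
  0x460848126084c144084c1030854143088c125088c145088814708841270904145090414309841230988143090810308d01,
  0x23088a405084a446084624408464220846842084a4220852244084a208084a145084a12908461270886209084620a08461,
  0x508ca22608c620508c640311c610309c62430906243088a2450886201104a722104670310467030886743088642309064,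
  0x270846345084632508465050886526088630708863071046307084a22710462070846425084a305088a32508c630608c63,
  0x210886841088a4210852342088a34408863420886522088a504084a541084a521084690108869010846a42084662408466,
  0x23108e10310ce10308ce223088e203084e442084e2010856241088e221090e241090a221098a2210986441090644108866,
  0x410988121098c141090c1210894121085610108581020856101104e522104e303104e303088e343084e125084e105088e1,
  0x4430421225042121584210258421015882121508214131021213182141218212112821210ac210112c21010ac41210a841,
  0x31850143188812518881431904123190812329041052902126190214419021221a0214229021224882144288210828421,
  0x71842427188224518822034882103384430338424233882243288226318421253044145188414328841252884103184e2,
  0x29184210918441071886107184622718442091842246184220918821470842327084250708825271082307188230718443,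
  0x3184474318444431848243284422328444052842423484210338861033846223384420348422433042225304224528421,
  0x5284432528461062846105184a22618462052846225184630618463051846443084272508427050882723108270318827,
  0x3290612718461451846125184a105188a1261886105190612718423451842325284232518425051842605184452618443,
  0x21314414121441011a441021a42142198212419821471842127284210728441271884107190212528c210528c412330861,
  0x109ca22209c620109c642111c6201124610111ca12211c610219c610119c814111c4141114812110d014120c812130c81,
  0x1094e22208ce20108ce42110ce22108d214110cc121114c10209c630111c634109c61210a46141094a12109ca10109cc1,
  0x22088670208c670110c674110c642120c644110ca221114a201214a141084e321084e501088e522088e30208ce30110ce3,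
  0x120ca301214630238c610138c622128c630228c630128ca22228c620128c642130c624120c62410846721084a701088a7,
  0x12948141294212148c210148c414130c414108ce121094e101114e12210ce10218ce10118d010118c660120c652220c63,
  0x4518c21251942105194412618c410518c810518c622518c420518c242618c220818c214418c414228c414218c812219481,
  0x2718c210718c410718c222708c234508c232508c252310c260510c252610c232518c230618c230518c432518c610618c61,
  0x4310c432310c45031142523118230319823031944303194244318c422318c820319481231984103294412330c410328c81,
  0x3288a123188c103190a123190620318c642309c2343094232308c274308c2523094252308c46030944523098430309483,
  0x2318c6303190632338461432846123184e143184a123284a103184c323184c203284a223304620328464431886223188a2,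
  0x431842523284250318466231844603284452330443032848343188432318845032882523188260318c260318c452319043,
  0x22946123118610319861221986104194610330c614328c214319421232942103194620330463233842343284232318427,
  0x509c412311c410319c414119c212129c210129c412219c410419c212138c614128c612128ca10130ca12230c612129461,
  0x4138c21213942101394412238c410338c414338421253842105384412338841033902142388212319c214309c212509c21,
  0x308c660310c652410c630408ca3230886623084e343084a32308467430846523084a503084c523088c303090a32338c21,
  0x2509461060946105098614708c21270942107094412710c412908c21470846127084a107088a127108610710c610708c81,
  0x2309c61430946123094a10308cc32308cc203094a2230986203094644310c622310ca203114a12310cc10510ca12610c61,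
  0x1194644218c622218ca202194a12218cc10318cc10318ca22418c622708c614508c612308ce14308ca12508ca10309863,
  0x1b00160118010003c01600200101198632119c6141194612118ce14118ca121194a10118cc32118cc201194a22119862,
  0x41c014031801601940140314026028c012050c020058c02603840100684022058802403900220398024029802201a802,
  0x4501802230280203030016201801201ac014029c012039c0140394012058c010060c016009c01000b4022012c024021c02,
  0x2202c024401c020801c014601801630140146014026500c012a00c020b00c0267004010d004022b0080247010022701802,
  0x4330802253080223310024321002032200162110012302c014501c012701c0147014012b00c010c00c016101c010103402,
  0x21508020158802423880222390024229002221a002441900226190022628c010630c016318801262880244288020348802,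
  0x4409802030a8024311802251180245110022711002072100144210014231001611900141310022150c010250c016128801,
  0x641840126304026320401462080165104010a18402091880247108020b088022a088026508801461100163090012609802,
  0x41288050128409011840b211840a4128406213840641384042158402413900121588016130401225040262284014430801,
  0x4518404231840843284042348402013840741388034119803211980541188074119005211a003412900321390032138805,
  0x45188034318805232880505284050318409431840625184060718405271880309184030728403471840227284022718404,
  0x2b0840266084012a10801053840343384022538402233840405184070338405233880343288030319c0323198034319003,
  0x230980543088074309005230a00345090032709003270880545088050508409030840b230840a450840627084064708404,
  0x263840146284012a1840147090012b088010b1840123504014530401273040147204012b10401070840747088034309803,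
  0x728c0143388014329001231a0014519001471880127288014528801054840107384010358401016840122584014438401,
  0x4420c024230c02223140242214022212402620940144118016408c01071140207098020611c012a08c012910c010a08c02,
  0x611140121128020112c024211c022321c012511c010538c012530c012340c014321401231240145114016310c014610c02,
  0x221a40142294012248c014428c01211a80142198026218c01223180141298012139801013980241314016120c014221801,
  0x4319402232940205294010348c014330c012319c02031a4014319801232980125198010918c014618c0126194014419401,
  0x329c010139c01011ac014121c012131c014219c012229c012419c010528c03032840723188070318c074318c044518c02,
  0x4118c0621194060119c052219c03011a4030129c034119c0241194042118c084128c042138c0421394024129402012a401,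
  0x4138c0201194072218c070128c0703294032718c020718c034418c034228c032428c034218c05221940501294050118c09,
  0xb08c014710c012720c010519c014311c012112c01210ac02610980122128010138c052238c0301394034238c010158c01,
  0x27094024509402050a401030ac01230a801450980127098010709c01010b401220ac014409c012609c0146094010719401,
  0x3094072310c070308c094308c0623094060309c052311c03030a4030509c034309c0243094042308c084508c044708c02,
  0x518c052618c0305194034510c0303394012338c020338c030328c052330c034320c032520c034310c0523114050509405,
  0x2b10002472000227300024530002235000203600016230001007800160400010708c052710c0307094030508c072318c06,
  0xc180016138001016800222580024438002083800146300016328001462800265180012a180020b1800267080010d08002,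
  0x1001e0610010000081e0600810000005e0600050060001200f00001680000123580014538001273800147280012b18001,
  0x200d600100d8061008c00010d600008d8060088c000015606000cc003001a062000e000181a060100e00000da060008e0,
  0x2816060180c061004e001009a022009600300960030058062004c060084e000089a020109600018960001858060104c0,
  0x24e040018e060010a0050016063000c061080e001101a022101600310160030818062080c00218160011818061100c0,
  0x60184a0002854020189400019120003850000388e040208e00009d00000a0e040110e060108a00002ca04001cc00001d20,
  0x488a040308a040210a040118a06008ca0000954040098c06009460000a4c02011cc00019cc040190c000290e020308e0,
  0x42010e062008a04020cc000195002030cc040294606018c6000294c020198c000198e020118e00038cc020388c06028460,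
  0x2201cc00301cc043010c005010e026008e063004a0050054023009400301120070050007008e044008e00101d0001020e0,
  0x3018e022018e00700cc027008c0650046009008a046008a044010a042018a06100ca0010154041018c0610146001024c0,
  0x62100a000580a040380c0003812000480e040300e060200a04400cc003015002600cc045014606300c6005014c023018c0,
  0x3380c043200c005200e026100e063080a0050814023101400320120070810007100e044100e0013810001400e042200e0,
  0x22300e007180c027100c0650806009100a046100a044200a042300a061180a0012814041300c0612806001480c022380c0,
  0xb000a047000c0070012009000e046000e064000a044180c0032810026180c04528060631806005280c023300c003300e0,
  0x11112022110e00410ce002098e06108c8001115002210d000310d00030910062088800220ce00218d0001191006110880,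
  0x630886005090c023110c00320cc04210cc02220cc022114c044094606208c6003114c003098c022098c042090c061088a0,
  0x111cc002198a041214606110c6021118c0610906042110a004190a00230ca0611886001290c022190c003190c00610ca0,
  0x44108a0640846007104c007088c006104e0630848026088c044088c0030894043108c025108c0231090003205006210480,
  0x42204c061104a0011894042188c0221890022288c04428460621846003288c003308a022308a042208a0221092062084a0,
  0x6184c04520460631046026108a042108e0020896061084c00110580221054001388c002304e0611848021308c06120460,
  0x403106020318604021860001a860401988040290800048c804030c8040214804011c80000ac80600984000034606001c40,
  0x5886020508604038c6020394602038ca04018ce020194e04019c602029c602019ca040194a02018d204028ca02048c60,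
  0x102c8061018402008d6040094e02009ce04009ca0200ac602012860201856040284e020384e040384a020584600058480,
  0x43014a02300d204500ca02900c604601060260186044018600302860430188045010800900c804600c8044014804201c80,
  0x27004e047004a02b004600b004800b008602a008604700c6027014602700ca04300ce023014e04301c602501c602301ca0,
  0x4220c8042114806109440010a880411188061110402100d6041014e02101ce04101ca02102c602202860230056045004e0,
  0x43208804311080030a08044090804608880650844009104804610480442048042304806128440014888041308800140c80,
  0x21304e041304a0215046042308602430860442086026208602611060441106022120604221060023906022388800338880,
  0x2209ca02409c602211c800219c8042190804418880281846026184a044184a0221852042284a02248460211056041204e0,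
  0x23204e023304a043204a0231052045104a027104a0272046027108800710c802808c602608ca04408ca02208d2042094a0,
  0x32186042118604209c60220a4604208ce02408ce0220856044084e026084e046084a02a084604710460291046043104e0,
  0x330c80233088046184604330460253046045284406318440052888026188800618c802610c806308c4005098802311880,
  0x4109c80010ac604111c602111ca041114a02110d204120ca02130ca02131460022986022198806118c4001314802230c80,
  0x26094604130c600109ce04110ce00108d6001085a0210896041090e021098e041098a001095202108d4041094c02109cc0,
  0x452008009180804618080442808042380800158080613004000680606038040423846022384a042184e024184e04608c60,
  0x43180e023280e04338060253806023380a043280a0231812045180a0291806046200602630060443006003500604330080,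
  0x41380a021580602250060230816045080e027080e047080a02b080600b080800b100602a100604718060272806027180a0,
  0x2058840403904020398404029840201a840001b02060118200003c2060020200d000606700040211816041280e021380e0,
  0x60c206009c20000b4402012c404021c400041c204031820601942040314406028c202050c400058c4060384200068440,
  0x67004200d004402b00840470104027018404501840230284003030206201820201ac204029c202039c2040394202058c20,
  0x47014202b00c200c00c206101c2001034402202c404401c400801c204601820630142046014406500c202a00c400b00c40,
  0x630c2063188202628840442884003488404330840253084023310404321040032202062110202302c204501c202701c20,
  0x611902041310402150c200250c20612882021508400158840423884022390404229040221a040441904026190402628c20,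
  0x2a0884065088204611020630902026098404409840030a8404311840251184045110402711040072102044210204231020,
  0x21588206130420225044062284204430820641842026304406320420462082065104200a18440091884047108400b08840,
  0x41190a0211a0604129060213906021388a041288a001285200118560211854041284c021384c0413848021584404139020,
  0x9184600728460471844027284402718480451848023185004328480234844001384e04138860411986021198a041188e0,
  0x233886043288600319c6023198604319060451886043188a023288a005284a0031852043184c025184c007184a02718860,
  0x308560230854045084c027084c047084802b0844066084202a10820053846043384402538440233848005184e003384a0,
  0x47204202b1042007084e04708860430986023098a043088e043090a0230a0604509060270906027088a045088a00508520,
  0x7384200358420016842022584204438420263842046284202a1842047090202b088200b18420235042045304202730420,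
  0x7098400611c202a08c202910c200a08c400728c2043388204329020231a02045190204718820272882045288200548420,
  0x4321420231242045114206310c204610c404420c404230c40223144042214402212440620942044118206408c200711440,
  0x2139820013984041314206120c204221820611142021128400112c404211c402321c202511c200538c202530c202340c20,
  0x25198200918c204618c2026194204419420221a42042294202248c204428c20211a82042198406218c2022318204129820,
  0x3284e023188e00318ce04318c804518c404319440232944005294200348c204330c202319c40031a42043198202329820,
  0x4128c802138c8021394404129440012a4200329c200139c20011ac204121c202131c204219c202229c202419c200528c60,
  0x2428c604218ca022194a001294a00118d204118cc021194c00119ca02219c60011a4600129c604119c4041194802118d00,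
  0x138ca02238c6001394604238c200158c204138c4001194e02218ce00128ce003294602718c400718c604418c604228c60,
  0x220ac204409c202609c20460942007194200b08c204710c202720c200519c204311c202112c20210ac4061098202212820,
  0x4309c4043094802308d004508c804708c4027094404509440050a420030ac20230a820450982027098200709c20010b420,
  0x4320c602520c604310ca023114a005094a003094e02310ce00308d204308cc023094c00309ca02311c60030a4600509c60,
  0x708ca02710c6007094600508ce02318cc00518ca02618c6005194604510c6003394202338c400338c600328ca02330c60,
  0x65180202a180400b1804067080200d080402b1004047200402730040453004023500400360020623002000780206040020,
  0x23580204538020273802047280202b180200c1802061380200168040225804044380400838020463002063280204628040,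
  0x6111800002ac00601980003034006201c00001b4006011c000103c006102000000bc00600a00060024000f000206800020,
  0x3a4000049c004031c0060214000502c0063018006109c0001134002212c000312c00030b0006209800021ac00011b000,
  0x2611c006309400050a80023128000322400070a0000711c004411c00013a0000141c004221c00621140000594004039800,
  0x6508c0009114004611400442140042314006119400012a80041318006128c0001498002239800033980043218000521c00,
  0x901c004601c0064014004419800032a00026198004528c006318c00052980023318000331c002231c0007198002711800,
  0x350c00433100045210000919000461900044290004239000015900061308000068c0060388000b0140047018000702400,
  0x2728c0027194004319c002329c004338c002538c0023394004329400231a40045194002918c004620c002630c004430c00,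
  0x4129c002139c0041394002158c002250c00230ac004509c002709c0047094002b08c000b090000b10c002a10c004718c00,
  0x67084000d088002b10800472080027308004530800235080003604006230400007840060404000d00c006700800211ac00,
  0x47284002b184000c184006138400016880022588004438800083840046304006328400462880065184002a188000b18800,
  0x4638000642800005580006330000036800062380000178000614000060480000f004006800400235840045384002738400,
  0xa328c234318c6123194614318c61a328c6169000000f0800068080000d1800067100000b28000473000007480000938000,
  0x2210ca34210c63a2114634308c632308ca34308c63a309463431846323184a34318463a3284634318c2323194234318c23,
  0x4108ca321094a32108c674108c652109465010986501094662208c660108ca62110c660111465211186301114a34210c63,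
  0x4118c632118ca34118c63a1194632109c6341094632108ce3]

/-- Monomials whose classes are a basis of the space of cohits of degree 17. -/
def basis17 : List ℕ := [
  3247143, 3245159, 3181671, 1150055, 3247329, 3247267, 3245283, 3181795, 1150179, 3251297,
  3251235, 3249251, 3185763, 1154147, 3378273, 3378211, 3376227, 3312739, 1281123, 7441505,
  7441443, 7439459, 7375971, 5344355, 1082599, 1088551, 1086567, 1279015, 1215527, 1213543,
  7373863, 5342247, 5278759, 5276775, 1088737, 1088675, 1086691, 1279201, 1215713, 1279139,
  1215651, 1213667, 7374049, 5342433, 5278945, 7373987, 5342371, 5278883, 5276899, 1285153,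
  1283169, 1219681, 1283107, 1219619, 1217635, 7380001, 5348385, 7378017, 5346401, 5282913,
  7377955, 5346339, 5282851, 5280867, 7570465, 7506977, 5475361, 7504993, 5473377, 5409889,
  7504931, 5473315, 5409827, 5407843, 3145959, 1114343, 98535, 1050855, 35047, 3303, 3152903,
  1121287, 105479, 1119303, 1055815, 40007, 3149927, 1118311, 102503, 1054823, 39015, 7271,
  3375111, 1280007, 3279879, 1248263, 232455, 1278023, 3277895, 1246279, 230471, 1214535, 1182791,
  166983, 3276903, 1245287, 229479, 1181799, 165991, 134247, 7438343, 7374855, 5343239, 7343111,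
  5311495, 4295687, 7372871, 5341255, 7341127, 5309511, 4293703, 5277767, 5246023, 4230215,
  7340135, 5308519, 4292711, 5245031, 4229223, 4197479, 3153120, 1121504, 105696, 1121442, 1119458,
  1055970, 40162, 3153027, 1121411, 105603, 3151043, 1119427, 103619, 1087683, 1055939, 40131,
  3150051, 1118435, 102627, 1054947, 39139, 7395, 3375328, 1280224, 3280096, 1248480, 232672,
  1280162, 1248418, 1278178, 3278050, 1246434, 230626, 1214690, 1182946, 167138, 3375235, 1280131,
  3280003, 1248387, 232579, 1247395, 3309763, 1278147, 3278019, 1246403, 230595, 1214659, 1182915,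
  167107, 3277027, 1245411, 229603, 1181923, 166115, 134371, 7438560, 7375072, 5343456, 7343328,
  5311712, 4295904, 7375010, 5343394, 5311650, 7373026, 5341410, 7341282, 5309666, 4293858,
  5277922, 5246178, 4230370, 7438467, 7374979, 5343363, 7343235, 5311619, 4295811, 5310627,
  7372995, 5341379, 7341251, 5309635, 4293827, 5277891, 5246147, 4230339, 7340259, 5308643,
  4292835, 5245155, 4229347, 4197603, 3382272, 1285184, 3379296, 3315808, 1284192, 3284064,
  1252448, 236640, 1251425, 1285122, 3379234, 3315746, 1284130, 3284002, 1252386, 236578, 3314754,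
  1283138, 1219650, 3313762, 1282146, 3282018, 1250402, 234594, 1218658, 1186914, 171106, 3379203,
  3315715, 1284099, 3283971, 1252355, 236547, 1251363, 3313731, 1282115, 3281987, 1250371, 234563,
  1218627, 1186883, 171075, 3280995, 1249379, 233571, 1185891, 170083, 138339, 7445504, 7380032,
  5348416, 7442528, 7379040, 5347424, 7347296, 5315680, 4299872, 5314657, 7379970, 5348354,
  7442466, 7378978, 5347362, 7347234, 5315618, 4299810, 7377986, 5346370, 5282882, 7376994,
  5345378, 7345250, 5313634, 4297826, 5281890, 5250146, 4234338, 7442435, 7378947, 5347331,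
  7347203, 5315587, 4299779, 5314595, 7376963, 5345347, 7345219, 5313603, 4297795, 5281859,
  5250115, 4234307, 7344227, 5312611, 4296803, 5249123, 4233315, 4201571, 7572480, 7570496,
  7507008, 5475392, 7569504, 7506016, 5474400, 7474272, 5442656, 4426848, 5442625, 5441633,
  7570434, 7506946, 5475330, 7569442, 7505954, 5474338, 7474210, 5442594, 4426786, 7504962,
  5473346, 5409858, 7503970, 5472354, 7472226, 5440610, 4424802, 5408866, 5377122, 4361314,
  7569411, 7505923, 5474307, 7474179, 5442563, 4426755, 5441571, 7503939, 5472323, 7472195,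
  5440579, 4424771, 5408835, 5377091, 4361283, 7471203, 5439587, 4423779, 5376099, 4360291,
  4328547, 4326563, 5378145, 4362337, 4330593, 5410850, 5379106, 4363298, 5378083, 4362275,
  4330531, 1081359, 1049615, 33807, 1048623, 32815, 1071, 1081824, 1050080, 34272, 1049057, 33249,
  1505, 1081731, 1049987, 34179, 1048995, 33187, 1443, 1056931, 41123, 9379, 1310883, 295075,
  263331, 9437347, 8421539, 8389795, 1096704, 1063968, 48160, 1093728, 1061984, 46176, 1063937,
  48129, 15393, 1061953, 46145, 1060961, 45153, 13409, 1093666, 1061922, 46114, 1093635, 1061891,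
  46083, 1060899, 45091, 13347, 1315936, 300128, 1314913, 299105, 267361, 1347618, 1315874, 300066,
  1315843, 300035, 1314851, 299043, 267299, 9442400, 8426592, 9441377, 8425569, 8393825, 9474082,
  9442338, 8426530, 9442307, 8426499, 9441315, 8425507, 8393763, 1541120, 1477632, 1540128, 492576,
  1476640, 1444896, 429088, 1475648, 1474656, 1442912, 427104, 1540097, 492545, 1476609, 1444865,
  429057, 491553, 428065, 396321, 1474625, 1442881, 427073, 1441889, 426081, 394337, 1475586,
  1474594, 1442850, 427042, 1474563, 1442819, 427011, 1441827, 426019, 394275, 9604096, 9571360,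
  8555552, 9602112, 9601120, 9569376, 8553568, 9571329, 8555521, 8522785, 9569345, 8553537,
  9568353, 8552545, 8520801, 9602050, 9601058, 9569314, 8553506, 9601027, 9569283, 8553475,
  9568291, 8552483, 8520739, 15762432, 13730816, 13667328, 15761440, 13729824, 15729696, 13698080,
  12682272, 13666336, 13634592, 12618784, 13665344, 13664352, 13632608, 12616800, 15761409,
  13729793, 15729665, 13698049, 12682241, 13666305, 13634561, 12618753, 15728673, 13697057,
  12681249, 13633569, 12617761, 12586017, 13664321, 13632577, 12616769, 13631585, 12615777,
  12584033, 13665282, 13664290, 13632546, 12616738, 13664259, 13632515, 12616707, 13631523,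
  12615715, 12583971]

theorem Trie.force_eq {α : Type} (t : Trie) (f : Trie → α) : t.force f = f t := by
  cases t <;> rfl

theorem State.force_eq {α : Type} (s : State) (f : State → α) : s.force f = f s := by
  cases s; rfl

theorem land_one (k : ℕ) : Nat.land k 1 = k % 2 := Nat.and_one_is_mod k

theorem Trie.find_nil (k : ℕ) : Trie.nil.find k = 0 := rfl

theorem Trie.find_node_zero (v : ℕ) (l r : Trie) : (Trie.node v l r).find 0 = v := rfl

theorem Trie.find_node (v : ℕ) (l r : Trie) {k : ℕ} (hk : k ≠ 0) :
    (Trie.node v l r).find k = if k % 2 = 0 then l.find (k / 2) else r.find (k / 2) := by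
  obtain ⟨m, rfl⟩ := Nat.exists_eq_succ_of_ne_zero hk
  change Nat.rec (motive := fun _ => ℕ) (l.find (Nat.div (m + 1) 2)) (fun _ _ => r.find (Nat.div (m + 1) 2))
    (Nat.land (m + 1) 1) = _
  rw [land_one]
  rcases Nat.mod_two_eq_zero_or_one (m + 1) with h | h <;> rw [Nat.succ_eq_add_one, h] <;> rfl

theorem Trie.insert_zero (f : ℕ) (t : Trie) (v : ℕ) : t.insert (f + 1) 0 v =
    match t with
    | nil => node v nil nil
    | node _ l r => node v l r := by
  cases t <;> rfl

theorem Trie.insert_succ (f : ℕ) (t : Trie) {k : ℕ} (hk : k ≠ 0) (v : ℕ) : t.insert (f + 1) k v =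
    match t with
    | nil => if k % 2 = 0 then node 0 (nil.insert f (k / 2) v) nil
        else node 0 nil (nil.insert f (k / 2) v)
    | node w l r => if k % 2 = 0 then node w (l.insert f (k / 2) v) r
        else node w l (r.insert f (k / 2) v) := by
  obtain ⟨m, rfl⟩ := Nat.exists_eq_succ_of_ne_zero hk
  cases t with
  | nil =>
    change Nat.rec (motive := fun _ => Trie) ((nil.insert f (Nat.div (m + 1) 2) v).force fun l => node 0 l nil)
      (fun _ _ => (nil.insert f (Nat.div (m + 1) 2) v).force fun r => node 0 nil r)
      (Nat.land (m + 1) 1) = _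
    simp only [land_one, Trie.force_eq]
    rcases Nat.mod_two_eq_zero_or_one (m + 1) with h | h <;> simp only [Nat.succ_eq_add_one, h] <;>
      rfl
  | node w l r =>
    change Nat.rec (motive := fun _ => Trie) ((l.insert f (Nat.div (m + 1) 2) v).force fun l' => node w l' r)
      (fun _ _ => (r.insert f (Nat.div (m + 1) 2) v).force fun r' => node w l r')
      (Nat.land (m + 1) 1) = _
    simp only [land_one, Trie.force_eq]
    rcases Nat.mod_two_eq_zero_or_one (m + 1) with h | h <;> simp only [Nat.succ_eq_add_one, h] <;>
      rfl

/-- An entry of the table after an insertion is the inserted one or an old one. -/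
theorem Trie.find_insert {f : ℕ} {t : Trie} {k v k' c : ℕ}
    (h : (t.insert f k v).find k' = c + 1) : (k' = k ∧ v = c + 1) ∨ t.find k' = c + 1 := by
  induction f generalizing t k k' with
  | zero => exact Or.inr h
  | succ f ih =>
    by_cases hk : k = 0
    · subst hk
      rw [Trie.insert_zero] at h
      by_cases hk' : k' = 0
      · subst hk'
        left
        cases t <;> exact ⟨rfl, h⟩
      · cases t with
        | nil => simp [Trie.find_node _ _ _ hk', Trie.find_nil] at h
        | node w l r =>
          right
          rwa [Trie.find_node _ _ _ hk'] at h ⊢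
    · rw [Trie.insert_succ _ _ hk] at h
      by_cases hk' : k' = 0
      · subst hk'
        right
        cases t with
        | nil =>
          simp only at h
          split_ifs at h <;> simp [Trie.find_node_zero] at h
        | node w l r =>
          simp only at h
          split_ifs at h <;> exact h
      · have key : ∀ {s : Trie}, (s.insert f (k / 2) v).find (k' / 2) = c + 1 →
            k' % 2 = k % 2 → (k' = k ∧ v = c + 1) ∨ s.find (k' / 2) = c + 1 := by
          intro s hs hpar
          rcases ih hs with ⟨h1, h2⟩ | h1
          · exact Or.inl ⟨by omega, h2⟩
          · exact Or.inr h1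
        cases t with
        | nil =>
          simp only at h
          change _ ∨ nil.find (k' / 2) = c + 1
          split_ifs at h with hp <;> rw [Trie.find_node _ _ _ hk'] at h <;> split_ifs at h with hp'
          · exact key h (by omega)
          · simp [Trie.find_nil] at h
          · simp [Trie.find_nil] at h
          · exact key h (by omega)
        | node w l r =>
          rw [Trie.find_node _ _ _ hk']
          simp only at h
          split_ifs at h with hp <;> rw [Trie.find_node _ _ _ hk'] at h <;>
            split_ifs at h ⊢ with hp'
          · exact key h (by omega)
          · exact Or.inr h
          · exact Or.inr h
          · exact key h (by omega)

/-- The binary digits of a number, as a vector over `F_2`. -/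
def bits (c : ℕ) : ℕ → ZMod 2 := fun i => if c.testBit i then 1 else 0

theorem bits_zero : bits 0 = 0 := by
  ext i
  simp [bits]

theorem bits_xor (a b : ℕ) : bits (Nat.xor a b) = bits a + bits b := by
  ext i
  change (if (a ^^^ b).testBit i then 1 else 0) = bits a i + bits b i
  rw [Nat.testBit_xor, bits, bits]
  cases a.testBit i <;> cases b.testBit i <;> decide

theorem bits_two_pow (i : ℕ) : bits (2 ^ i) = Pi.single i 1 := by
  ext j
  rw [bits, Nat.testBit_two_pow, Pi.single_apply]
  simp [eq_comm]

theorem bits_injective {a b : ℕ} (h : bits a = bits b) : a = b := by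
  refine Nat.eq_of_testBit_eq fun i => ?_
  have := congrFun h i
  rw [bits, bits] at this
  revert this
  cases a.testBit i <;> cases b.testBit i <;> decide

theorem vec_add_self {M : Type*} [AddCommGroup M] [Module (ZMod 2) M] (v : M) : v + v = 0 := by
  rw [← two_smul (ZMod 2) v, show (2 : ZMod 2) = 0 from rfl, zero_smul]

theorem vec_add_eq_zero {M : Type*} [AddCommGroup M] [Module (ZMod 2) M] {v w : M} :
    v + w = 0 ↔ v = w :=
  ⟨fun h => by rw [← add_zero v, ← vec_add_self w, ← add_assoc, h, zero_add],
    fun h => h ▸ vec_add_self v⟩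

theorem choose_mod_two (a c : ℕ) :
    (a.choose c : ZMod 2) = if Nat.land a c = c then 1 else 0 := by
  change _ = if a &&& c = c then 1 else 0
  induction a using Nat.strong_induction_on generalizing c with
  | _ a ih =>
    by_cases ha : a = 0
    · subst ha
      rcases c with _ | c <;> simp
    · have hl : (a.choose c : ZMod 2) =
          ((a % 2).choose (c % 2) : ZMod 2) * ((a / 2).choose (c / 2) : ZMod 2) := by
        have : Fact (Nat.Prime 2) := ⟨Nat.prime_two⟩
        have := (ZMod.natCast_eq_natCast_iff _ _ 2).2
          (Choose.choose_modEq_choose_mod_mul_choose_div_nat (n := a) (k := c) (p := 2))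
        rw [this, Nat.cast_mul]
      have h1 : a &&& c = c ↔ (c % 2 ≤ a % 2 ∧ (a / 2) &&& (c / 2) = c / 2) := by
        have e1 : (a &&& c) / 2 = (a / 2) &&& (c / 2) := Nat.and_div_two
        have e2 : (a &&& c) % 2 = (a % 2) &&& (c % 2) := by
          have := Nat.and_mod_two_pow (a := a) (b := c) (n := 1)
          simpa using this
        rw [← e1]
        rcases Nat.mod_two_eq_zero_or_one a with ha2 | ha2 <;>
          rcases Nat.mod_two_eq_zero_or_one c with hc2 | hc2 <;>
          rw [ha2, hc2] at e2 <;> simp only [Nat.zero_and, Nat.and_zero, Nat.and_self] at e2 <;>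
          rw [ha2, hc2] <;> omega
      rw [hl, ih (a / 2) (by omega)]
      simp only [h1]
      rcases Nat.mod_two_eq_zero_or_one a with ha2 | ha2 <;>
        rcases Nat.mod_two_eq_zero_or_one c with hc2 | hc2 <;>
        simp [ha2, hc2]

/-- The product of the powers `x ^ a`. -/
def listMonomial {A : Type*} [Monoid A] (xs : List A) (l : List ℕ) : A :=
  (List.zipWith (fun x a => x ^ a) xs l).prod

theorem listMonomial_cons {A : Type*} [Monoid A] (x : A) (xs : List A) (a : ℕ) (l : List ℕ) :
    listMonomial (x :: xs) (a :: l) = x ^ a * listMonomial xs l := by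
  simp [listMonomial]

theorem coeff_pow_totalSq {k : ℕ} (x : P k) (a c : ℕ) :
    ((Polynomial.C x + Polynomial.C (x ^ 2) * Polynomial.X) ^ a).coeff c =
      (a.choose c : ZMod 2) • x ^ (a + c) := by
  have h : (Polynomial.C x + Polynomial.C (x ^ 2) * Polynomial.X) ^ a =
      ∑ m ∈ Finset.range (a + 1), Polynomial.monomial m (x ^ (a + m) * (a.choose m : P k)) := by
    rw [add_comm, add_pow]
    refine Finset.sum_congr rfl fun m hm => ?_
    have hm : m ≤ a := by simpa [Nat.lt_succ_iff] using hm
    rw [← Polynomial.C_mul_X_pow_eq_monomial, mul_pow, ← map_pow, ← map_pow, map_mul,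
      map_natCast, show a + m = 2 * m + (a - m) by omega, pow_add, pow_mul, map_mul]
    ring
  rw [h, Polynomial.finsetSum_coeff]
  simp only [Polynomial.coeff_monomial]
  rw [Finset.sum_ite_eq']
  by_cases hc : c ∈ Finset.range (a + 1)
  · rw [if_pos hc, Algebra.smul_def, mul_comm, map_natCast]
  · rw [if_neg hc, Nat.choose_eq_zero_of_lt (by simpa using hc), Nat.cast_zero, zero_smul]

theorem coeff_pow_totalSq_mul {k : ℕ} (x : P k) (a j : ℕ) (G : Polynomial (P k)) :
    ((Polynomial.C x + Polynomial.C (x ^ 2) * Polynomial.X) ^ a * G).coeff j =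
      ∑ c ∈ Finset.range (j + 1),
        if Nat.land a c = c then x ^ (a + c) * G.coeff (j - c) else 0 := by
  rw [Polynomial.coeff_mul, Finset.Nat.sum_antidiagonal_eq_sum_range_succ_mk]
  refine Finset.sum_congr rfl fun c _ => ?_
  rw [coeff_pow_totalSq, choose_mod_two]
  split_ifs <;> simp

theorem encode_cons (a : ℕ) (l : List ℕ) : encode (a :: l) = a + 32 * encode l := rfl

theorem bool_rec_beq {α : Type*} (x y : α) (a b : ℕ) :
    (Bool.rec x y (Nat.beq a b) : α) = if a = b then y else x := by
  by_cases h : a = b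
  · subst h
    simp [Nat.beq_refl]
  · have : Nat.beq a b = false := by
      rw [← Bool.not_eq_true, Nat.beq_eq]
      exact h
    rw [this, if_neg h]

theorem termsAux_nil (a w j k : ℕ) (rest : List ℕ) : termsAux [] a w j k rest =
    if Nat.land a j = j then (k + w * j) :: rest else rest :=
  bool_rec_beq _ _ _ _

theorem termsAux_cons_zero (b : ℕ) (l : List ℕ) (a w k : ℕ) (rest : List ℕ) :
    termsAux (b :: l) a w 0 k rest = k :: rest := rfl

theorem termsAux_cons_succ (b : ℕ) (l : List ℕ) (a w j k : ℕ) (rest : List ℕ) :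
    termsAux (b :: l) a w (j + 1) k rest =
      Nat.rec rest (fun c acc => if Nat.land a c = c then
        termsAux l b (w * 32) (j + 1 - c) (k + w * c) acc else acc) (j + 2) := by
  refine Eq.trans (b := Nat.rec rest (fun c acc => Bool.rec acc
    (termsAux l b (w * 32) (j + 1 - c) (k + w * c) acc) (Nat.beq (Nat.land a c) c)) (j + 2)) rfl ?_
  simp only [bool_rec_beq]

/-- The exponents after adding the increments `cs`. -/
def addList (l cs : List ℕ) : List ℕ := List.zipWith (· + ·) l cs

theorem addList_replicate_zero (l : List ℕ) : addList l (List.replicate l.length 0) = l := by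
  induction l with
  | nil => rfl
  | cons a l ih => rw [addList] at ih ⊢; simp [List.replicate_succ, ih]

theorem encode_replicate_zero (n : ℕ) : encode (List.replicate n 0) = 0 := by
  induction n with
  | zero => rfl
  | succ n ihn => rw [List.replicate_succ, encode_cons, ihn]

theorem coeff_zero_totalSq {k : ℕ} (f : P k) : (totalSq k f).coeff 0 = f := by
  induction f using MvPolynomial.induction_on with
  | C a => simp [totalSq, MvPolynomial.algebraMap_eq]
  | add f g hf hg => simp [hf, hg]
  | mul_X f i hf => rw [map_mul, Polynomial.mul_coeff_zero, hf, totalSq_X]; simp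

theorem sum_termsAux {k : ℕ} (φ : ℕ → P k) (xs : List (P k))
    (hxs : ∀ x ∈ xs, totalSq k x = Polynomial.C x + Polynomial.C (x ^ 2) * Polynomial.X)
    (l : List ℕ) (a : ℕ) (hlen : xs.length = l.length + 1) (w j m : ℕ) (B : P k)
    (rest : List ℕ)
    (hφ : ∀ cs : List ℕ, cs.length = l.length + 1 → cs.sum = j →
      φ (m + w * encode cs) = B * listMonomial xs (addList (a :: l) cs)) :
    ((termsAux l a w j m rest).map φ).sum =
      B * (totalSq k (listMonomial xs (a :: l))).coeff j + (rest.map φ).sum := by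
  induction l generalizing xs a w j m B rest with
  | nil =>
    obtain ⟨x, rfl⟩ := List.length_eq_one_iff.1 hlen
    have h1 := hφ [j] rfl (by simp)
    simp only [addList, List.zipWith_cons_cons, List.zipWith_nil_left, encode_cons] at h1
    have h2 : encode [] = 0 := rfl
    rw [h2, mul_zero, add_zero] at h1
    have h3 : ∀ e : ℕ, listMonomial [x] [e] = x ^ e := fun e => by simp [listMonomial]
    rw [h3] at h1
    rw [termsAux_nil, h3, map_pow, hxs x (by simp), coeff_pow_totalSq, choose_mod_two]
    split_ifs
    · rw [List.map_cons, List.sum_cons, h1, one_smul]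
    · rw [zero_smul, mul_zero, zero_add]
  | cons b l ih =>
    obtain ⟨x, xs, rfl⟩ : ∃ x xs', xs = x :: xs' := by
      cases xs with
      | nil => simp at hlen
      | cons x xs => exact ⟨x, xs, rfl⟩
    have hlen' : xs.length = l.length + 1 := by simpa using hlen
    have hsq : totalSq k (listMonomial (x :: xs) (a :: b :: l)) =
        (Polynomial.C x + Polynomial.C (x ^ 2) * Polynomial.X) ^ a *
          totalSq k (listMonomial xs (b :: l)) := by
      rw [listMonomial_cons, map_mul, map_pow, hxs x (by simp)]
    rw [hsq, coeff_pow_totalSq_mul]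
    have step : ∀ c ≤ j, Nat.land a c = c → ∀ acc : List ℕ,
        ((termsAux l b (w * 32) (j - c) (m + w * c) acc).map φ).sum =
          B * (x ^ (a + c) * (totalSq k (listMonomial xs (b :: l))).coeff (j - c)) +
            (acc.map φ).sum := by
      intro c hc _ acc
      rw [← mul_assoc]
      refine ih xs (fun y hy => hxs y (by simp [hy])) b hlen' _ _ _ _ _ ?_
      intro cs hcs hsum
      have := hφ (c :: cs) (by simpa using hcs) (by simp [hsum]; omega)
      rw [encode_cons] at this
      rw [show m + w * c + w * 32 * encode cs = m + w * (c + 32 * encode cs) by ring, this]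
      simp only [addList, List.zipWith_cons_cons]
      rw [listMonomial_cons, mul_assoc]
    rcases j with _ | j
    · have h0 := hφ (List.replicate (l.length + 2) 0) (by simp) (by simp)
      rw [encode_replicate_zero, mul_zero, add_zero] at h0
      have ha := addList_replicate_zero (a :: b :: l)
      rw [List.length_cons, List.length_cons] at ha
      rw [ha] at h0
      rw [termsAux_cons_zero, ← coeff_pow_totalSq_mul, ← hsq, coeff_zero_totalSq, List.map_cons,
        List.sum_cons, h0]
    · rw [termsAux_cons_succ, Finset.mul_sum]
      have gen : ∀ n ≤ j + 2, (List.map φ (Nat.rec rest (fun c acc => if Nat.land a c = c then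
          termsAux l b (w * 32) (j + 1 - c) (m + w * c) acc else acc) n)).sum =
          (∑ c ∈ Finset.range n, B * if Nat.land a c = c then
            x ^ (a + c) * (totalSq k (listMonomial xs (b :: l))).coeff (j + 1 - c) else 0) +
            (rest.map φ).sum := by
        intro n hn
        induction n with
        | zero => simp
        | succ n ihn =>
          rw [Finset.sum_range_succ]
          have ihn := ihn (by omega)
          by_cases hc : Nat.land a n = n
          · simp only [hc, if_true]
            rw [step n (by omega) hc, ihn]
            ring
          · simp only [hc, if_false]
            rw [ihn, mul_zero, add_zero]
      exact gen (j + 2) le_rfl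

/-- The variables of `P 5`. -/
noncomputable def vars : List (P 5) := [X 0, X 1, X 2, X 3, X 4]

/-- The monomial with the code `k`. -/
noncomputable def mon (k : ℕ) : P 5 := listMonomial vars (digits k)

theorem encode_five (a b c d e : ℕ) :
    encode [a, b, c, d, e] = a + 32 * (b + 32 * (c + 32 * (d + 32 * (e + 32 * 0)))) := rfl

theorem digits_eq (k : ℕ) :
    digits k = [k % 32, k / 32 % 32, k / 1024 % 32, k / 32768 % 32, k / 1048576] := rfl

theorem encode_digits (k : ℕ) : encode (digits k) = k := by
  rw [digits_eq, encode_five]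
  omega

theorem digits_encode {a b c d e : ℕ} (ha : a < 32) (hb : b < 32) (hc : c < 32) (hd : d < 32) :
    digits (encode [a, b, c, d, e]) = [a, b, c, d, e] := by
  rw [digits_eq, encode_five]
  simp only [List.cons.injEq, and_true]
  refine ⟨?_, ?_, ?_, ?_, ?_⟩ <;> omega

theorem digitSum_eq (k : ℕ) : digitSum k = (digits k).sum := rfl

theorem exists_five {l : List ℕ} (h : l.length = 5) : ∃ a b c d e, l = [a, b, c, d, e] := by
  match l, h with
  | [a, b, c, d, e], _ => exact ⟨a, b, c, d, e, rfl⟩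

theorem digits_encode_of_sum {l : List ℕ} (hl : l.length = 5) (hs : l.sum ≤ 31) :
    digits (encode l) = l := by
  obtain ⟨a, b, c, d, e, rfl⟩ := exists_five hl
  simp only [List.sum_cons, List.sum_nil] at hs
  exact digits_encode (by omega) (by omega) (by omega) (by omega)

theorem mon_encode {l : List ℕ} (hl : l.length = 5) (hs : l.sum ≤ 31) :
    mon (encode l) = listMonomial vars l := by
  rw [mon, digits_encode_of_sum hl hs]

theorem Sq_apply {k : ℕ} (j : ℕ) (f : P k) : Sq k j f = (totalSq k f).coeff j := rfl

theorem add_encode (k a b c d e : ℕ) : k + 1 * encode [a, b, c, d, e] =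
    encode [k % 32 + a, k / 32 % 32 + b, k / 1024 % 32 + c, k / 32768 % 32 + d,
      k / 1048576 + e] := by
  rw [encode_five, encode_five]
  omega

theorem terms_eq (j k : ℕ) : terms j k = termsAux [k / 32 % 32, k / 1024 % 32, k / 32768 % 32,
    k / 1048576] (k % 32) 1 j k [] := rfl

/-- `terms j k` is the list of the terms of `Sq^j` of the monomial `k`. -/
theorem sum_terms {j k : ℕ} (h : digitSum k + j ≤ 31) :
    ((terms j k).map mon).sum = Sq 5 j (mon k) := by
  have := sum_termsAux (k := 5) mon vars (by simp [vars, totalSq_X])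
    [k / 32 % 32, k / 1024 % 32, k / 32768 % 32, k / 1048576] (k % 32) rfl 1 j k 1 [] ?_
  · rw [List.map_nil, List.sum_nil, add_zero, one_mul] at this
    rw [terms_eq, this, Sq_apply, mon, digits_eq]
  · intro cs hcs hsum
    obtain ⟨a, b, c, d, e, rfl⟩ := exists_five hcs
    rw [digitSum_eq, digits_eq] at h
    simp only [List.sum_cons, List.sum_nil] at h hsum
    refine (congrArg mon (add_encode k a b c d e)).trans ((mon_encode rfl ?_).trans ?_)
    · simp only [List.sum_cons, List.sum_nil]
      linarith
    · simp only [addList, List.zipWith_cons_cons, List.zipWith_nil_left, one_mul]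

theorem Sq_mem_hit {k j : ℕ} (hj : 0 < j) (f : P k) : Sq k j f ∈ hit k :=
  Submodule.mem_iSup_of_mem j (Submodule.mem_iSup_of_mem hj ⟨f, rfl⟩)

/-- The class of the monomial `k` modulo hit elements. -/
noncomputable def monClass (k : ℕ) : P 5 ⧸ hit 5 := (hit 5).mkQ (mon k)

theorem sum_monClass (ks : List ℕ) :
    (ks.map monClass).sum = (hit 5).mkQ (ks.map mon).sum := by
  rw [map_list_sum, List.map_map]
  rfl

theorem sum_hitTerms {j : ℕ} (hj : 0 < j) (k : ℕ) : ((hitTerms j k).map monClass).sum = 0 := by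
  have h : hitTerms j k = Bool.rec [] (terms j k) (Nat.ble (digitSum k + j) 31) := rfl
  rw [h]
  cases hb : Nat.ble (digitSum k + j) 31 with
  | false => rfl
  | true =>
    rw [sum_monClass, sum_terms (Nat.le_of_ble_eq_true hb)]
    exact (Submodule.Quotient.mk_eq_zero _).2 (Sq_mem_hit hj _)

/-- The linear combination of the classes of the monomials `bs` with given coefficients. -/
noncomputable def comb (bs : List ℕ) : (ℕ → ZMod 2) →ₗ[ZMod 2] P 5 ⧸ hit 5 :=
  ∑ i : Fin bs.length, (LinearMap.proj (i : ℕ)).smulRight (monClass bs[i])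

theorem comb_apply (bs : List ℕ) (w : ℕ → ZMod 2) :
    comb bs w = ∑ i : Fin bs.length, w i • monClass bs[i] := by
  simp [comb]

theorem comb_single (bs : List ℕ) {i : ℕ} (hi : i < bs.length) :
    comb bs (Pi.single i 1) = monClass bs[i] := by
  rw [comb_apply, Finset.sum_eq_single ⟨i, hi⟩]
  · simp
  · intro j _ hj
    rw [Pi.single_eq_of_ne (fun h => hj (Fin.ext h)), zero_smul]
  · simp

/-- The monomials in the table are the linear combinations of `bs` given by their codes. -/
def Trie.Reduces (bs : List ℕ) (t : Trie) : Prop :=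
  ∀ k c, t.find k = c + 1 → monClass k = comb bs (bits c)

theorem Trie.Reduces.insert {bs : List ℕ} {t : Trie} (ht : t.Reduces bs) (f : ℕ) {k c : ℕ}
    (h : monClass k = comb bs (bits c)) : (t.insert f k (c + 1)).Reduces bs := by
  intro k' c' h'
  rcases Trie.find_insert h' with ⟨rfl, h1⟩ | h1
  · rw [h, Nat.succ_injective h1]
  · exact ht _ _ h1

theorem reduces_insertBasis {bs : List ℕ} (ks : List ℕ) (i : ℕ) (hks : bs.drop i = ks) {t : Trie}
    (ht : t.Reduces bs) : (insertBasis ks (2 ^ i) t).Reduces bs := by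
  induction ks generalizing i t with
  | nil => exact ht
  | cons k ks ih =>
    have hi : i < bs.length := by
      by_contra hi
      rw [List.drop_eq_nil_of_le (by omega)] at hks
      cases hks
    rw [List.drop_eq_getElem_cons hi, List.cons.injEq] at hks
    have : insertBasis (k :: ks) (2 ^ i) t =
        insertBasis ks (2 * 2 ^ i) (t.insert 26 k (2 ^ i + 1)) := Trie.force_eq _ _
    rw [this, ← pow_succ']
    refine ih (i + 1) hks.2 (ht.insert _ ?_)
    rw [bits_two_pow, comb_single bs hi, hks.1]

theorem sum_toggle {M : Type*} [AddCommGroup M] [Module (ZMod 2) M] (f : ℕ → M) (k : ℕ)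
    (l : List ℕ) : ((toggle k l).map f).sum = f k + (l.map f).sum := by
  induction l with
  | nil => rfl
  | cons x xs ih =>
    have h : toggle k (x :: xs) = if k = x then xs else x :: toggle k xs := bool_rec_beq _ _ _ _
    rw [h]
    split_ifs with hx
    · rw [List.map_cons, List.sum_cons, ← add_assoc, hx, vec_add_self, zero_add]
    · rw [List.map_cons, List.sum_cons, List.map_cons, List.sum_cons, ih]
      abel

theorem scan_cons (t : Trie) (k : ℕ) (ks : List ℕ) (acc : ℕ) (unk : List ℕ) :
    scan t (k :: ks) acc unk = Nat.rec (scan t ks acc (toggle k unk))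
      (fun c _ => scan t ks (Nat.xor acc c) unk) (t.find k) := rfl

theorem scan_spec {bs : List ℕ} {t : Trie} (ht : t.Reduces bs) (ks : List ℕ) (acc : ℕ)
    (unk : List ℕ) :
    comb bs (bits (scan t ks acc unk).1) + ((scan t ks acc unk).2.map monClass).sum =
      comb bs (bits acc) + (unk.map monClass).sum + (ks.map monClass).sum := by
  induction ks generalizing acc unk with
  | nil =>
    rw [List.map_nil, List.sum_nil, add_zero]
    rfl
  | cons k ks ih =>
    rw [scan_cons, List.map_cons, List.sum_cons]
    rcases h : t.find k with _ | c
    · change comb bs (bits (scan t ks acc (toggle k unk)).1) +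
        ((scan t ks acc (toggle k unk)).2.map monClass).sum = _
      rw [ih, sum_toggle]
      abel
    · change comb bs (bits (scan t ks (Nat.xor acc c) unk).1) +
        ((scan t ks (Nat.xor acc c) unk).2.map monClass).sum = _
      rw [ih, bits_xor, map_add, ht k c h]
      abel

/-- The table is correct, and the relation holds. -/
def State.Valid (bs : List ℕ) (s : State) : Prop :=
  s.table.Reduces bs ∧ comb bs (bits s.acc) + (s.unk.map monClass).sum = 0

theorem State.valid_reset {bs : List ℕ} {t : Trie} (ht : t.Reduces bs) :
    State.Valid bs ⟨t, 0, []⟩ :=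
  ⟨ht, by simp [bits_zero]⟩

theorem State.valid_finish {bs : List ℕ} {t : Trie} (ht : t.Reduces bs) {acc : ℕ} {unk : List ℕ}
    (h : comb bs (bits acc) + (unk.map monClass).sum = 0) :
    (State.finish t acc unk).Valid bs := by
  match unk with
  | [] => exact State.valid_reset ht
  | [k] =>
    have hk : monClass k = comb bs (bits acc) := by
      rw [List.map_cons, List.sum_cons, List.map_nil, List.sum_nil, add_zero] at h
      exact (vec_add_eq_zero.1 h).symm
    have : State.finish t acc [k] = ⟨t.insert 26 k (acc + 1), 0, []⟩ := by
      cases acc with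
      | zero => exact Trie.force_eq (t.insert 26 k 1) fun t' => State.mk t' 0 []
      | succ c => exact Trie.force_eq (t.insert 26 k (c + 2)) fun t' => State.mk t' 0 []
    rw [this]
    exact State.valid_reset (ht.insert _ hk)
  | k :: k' :: ks => exact State.valid_reset ht

theorem State.Valid.step {bs : List ℕ} {s : State} (hs : s.Valid bs) (e : ℕ) :
    (s.step e).Valid bs := by
  obtain ⟨t, acc, unk⟩ := s
  obtain ⟨ht, h⟩ := hs
  have hsc := scan_spec ht (hitTerms (2 ^ (e / 33554432 % 4)) (e % 33554432)) acc unk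
  rw [sum_hitTerms (by positivity), add_zero] at hsc
  replace hsc := hsc.trans h
  have : State.step ⟨t, acc, unk⟩ e = Nat.rec
      (finish t (scan t (hitTerms (2 ^ (e / 33554432 % 4)) (e % 33554432)) acc unk).1
        (scan t (hitTerms (2 ^ (e / 33554432 % 4)) (e % 33554432)) acc unk).2)
      (fun _ _ => ⟨t, (scan t (hitTerms (2 ^ (e / 33554432 % 4)) (e % 33554432)) acc unk).1,
        (scan t (hitTerms (2 ^ (e / 33554432 % 4)) (e % 33554432)) acc unk).2⟩)
      (e / 134217728) := rfl
  rw [this]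
  rcases e / 134217728 with _ | m
  · exact State.valid_finish ht hsc
  · exact ⟨ht, hsc⟩

theorem State.Valid.steps {bs : List ℕ} (m N : ℕ) {s : State} (hs : s.Valid bs) :
    (State.steps m N s).Valid bs := by
  induction m generalizing N s with
  | zero => exact hs
  | succ m ih =>
    have : State.steps (m + 1) N s = State.steps m (N / 268435456) (s.step (N % 268435456)) :=
      State.force_eq _ _
    rw [this]
    exact ih _ (hs.step _)

theorem State.Valid.run {bs : List ℕ} (Ns : List ℕ) {s : State} (hs : s.Valid bs) :
    (State.run Ns s).Valid bs := by
  induction Ns generalizing s with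
  | nil => exact hs
  | cons N Ns ih =>
    have : State.run (N :: Ns) s = State.run Ns (State.steps 14 N s) := State.force_eq _ _
    rw [this]
    exact ih (hs.steps _ _)

theorem reduces_table (bs Ns : List ℕ) : (table bs Ns).Reduces bs := by
  have h : (insertBasis bs 1 .nil).Reduces bs := by
    have := reduces_insertBasis (bs := bs) bs 0 rfl (t := .nil) (fun k c h => by cases h)
    rwa [pow_zero] at this
  exact (State.Valid.run Ns (State.valid_reset h)).1

theorem mem_termsAux {l : List ℕ} {a w j m : ℕ} {rest : List ℕ} {x : ℕ}
    (h : x ∈ termsAux l a w j m rest) :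
    x ∈ rest ∨ ∃ cs : List ℕ, cs.length = l.length + 1 ∧ cs.sum = j ∧ x = m + w * encode cs := by
  induction l generalizing a w j m rest with
  | nil =>
    rw [termsAux_nil] at h
    split_ifs at h
    · rcases List.mem_cons.1 h with rfl | h
      · exact Or.inr ⟨[j], rfl, by simp, by simp [encode_cons, show encode [] = 0 from rfl]⟩
      · exact Or.inl h
    · exact Or.inl h
  | cons b l ih =>
    rcases j with _ | j
    · rw [termsAux_cons_zero] at h
      rcases List.mem_cons.1 h with rfl | h
      · exact Or.inr ⟨List.replicate (l.length + 2) 0, by simp, by simp,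
          by rw [encode_replicate_zero, mul_zero, add_zero]⟩
      · exact Or.inl h
    · rw [termsAux_cons_succ] at h
      have gen : ∀ n ≤ j + 2, x ∈ (Nat.rec rest (fun c acc => if Nat.land a c = c then
          termsAux l b (w * 32) (j + 1 - c) (m + w * c) acc else acc) n : List ℕ) →
          x ∈ rest ∨ ∃ cs : List ℕ, cs.length = (b :: l).length + 1 ∧ cs.sum = j + 1 ∧
            x = m + w * encode cs := by
        intro n hn hx
        induction n with
        | zero => exact Or.inl hx
        | succ n ihn =>
          simp only at hx
          split_ifs at hx
          · rcases ih hx with hx | ⟨cs, h1, h2, h3⟩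
            · exact ihn (by omega) hx
            · refine Or.inr ⟨n :: cs, by simp [h1], by simp [h2]; omega, ?_⟩
              rw [h3, encode_cons]
              ring
          · exact ihn (by omega) hx
      exact gen _ le_rfl h

theorem digitSum_of_mem_terms {j k x : ℕ} (h : digitSum k + j ≤ 31) (hx : x ∈ terms j k) :
    digitSum x = digitSum k + j := by
  rw [terms_eq] at hx
  rcases mem_termsAux hx with hx | ⟨cs, hcs, hsum, rfl⟩
  · simp at hx
  · obtain ⟨a, b, c, d, e, rfl⟩ := exists_five hcs
    rw [digitSum_eq k, digits_eq] at h ⊢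
    simp only [List.sum_cons, List.sum_nil] at h hsum ⊢
    rw [add_encode, digitSum_eq, digits_encode_of_sum rfl]
    · simp only [List.sum_cons, List.sum_nil]
      linarith
    · simp only [List.sum_cons, List.sum_nil]
      linarith

/-- The list of the exponents. -/
def expo (a : Fin 5 →₀ ℕ) : List ℕ := [a 0, a 1, a 2, a 3, a 4]

theorem monomial_eq_listMonomial (a : Fin 5 →₀ ℕ) :
    (monomial a 1 : P 5) = listMonomial vars (expo a) := by
  rw [MvPolynomial.monomial_eq, Finsupp.prod_fintype _ _ (by simp), Fin.prod_univ_five]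
  simp [listMonomial, vars, expo, mul_assoc]

theorem exists_expo {l : List ℕ} (h : l.length = 5) : ∃ a, expo a = l := by
  obtain ⟨a, b, c, d, e, rfl⟩ := exists_five h
  exact ⟨Finsupp.equivFunOnFinite.symm ![a, b, c, d, e], rfl⟩

/-- The linear map given by the codes of the monomials of degree `n`. -/
noncomputable def codeMap (n : ℕ) (t : Trie) : P 5 →ₗ[ZMod 2] ℕ → ZMod 2 :=
  (basisMonomials (Fin 5) (ZMod 2)).constr (ZMod 2) fun a =>
    if (expo a).sum = n then bits (t.code (encode (expo a))) else 0

theorem codeMap_listMonomial (n : ℕ) (t : Trie) {l : List ℕ} (h : l.length = 5) :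
    codeMap n t (listMonomial vars l) = if l.sum = n then bits (t.code (encode l)) else 0 := by
  obtain ⟨a, rfl⟩ := exists_expo h
  have h : (monomial a 1 : P 5) = basisMonomials (Fin 5) (ZMod 2) a := by simp
  rw [← monomial_eq_listMonomial, h, codeMap, Module.Basis.constr_basis]

theorem codeMap_mon {n : ℕ} (t : Trie) {k : ℕ} (h : digitSum k = n) :
    codeMap n t (mon k) = bits (t.code k) := by
  rw [mon, codeMap_listMonomial n t rfl, encode_digits, ← digitSum_eq, if_pos h]

theorem codeMap_sum {n : ℕ} (t : Trie) {ks : List ℕ} (h : ∀ k ∈ ks, digitSum k = n) :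
    codeMap n t (ks.map mon).sum = bits (t.sumCode ks) := by
  induction ks with
  | nil => exact (map_zero _).trans bits_zero.symm
  | cons k ks ih =>
    have : t.sumCode (k :: ks) = Nat.xor (t.code k) (t.sumCode ks) := rfl
    rw [List.map_cons, List.sum_cons, map_add, codeMap_mon t (h k (by simp)),
      ih fun k' hk' => h k' (by simp [hk']), this, bits_xor]

theorem codeMap_of_isHomogeneous {n m : ℕ} (t : Trie) (hm : m ≠ n) {f : P 5}
    (hf : f.IsHomogeneous m) : codeMap n t f = 0 := by
  rw [MvPolynomial.as_sum f, map_sum]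
  refine Finset.sum_eq_zero fun a ha => ?_
  have hdeg : (expo a).sum = m := by
    have h0 := hf (MvPolynomial.mem_support_iff.1 ha)
    have h1 : a.degree = Finsupp.weight 1 a := by
      rw [Finsupp.degree_eq_weight_one]
      rfl
    rw [← h0, ← h1, Finsupp.degree_eq_sum, Fin.sum_univ_five]
    simp [expo, add_assoc]
  have hc : (monomial a (f.coeff a) : P 5) = f.coeff a • monomial a 1 := by
    rw [smul_monomial, smul_eq_mul, mul_one]
  rw [hc, map_smul, monomial_eq_listMonomial, codeMap_listMonomial n t rfl, hdeg, if_neg hm,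
    smul_zero]

theorem totalSq_listMonomial {k : ℕ} (xs : List (P k)) (hxs : ∀ x ∈ xs, ∃ i, x = X i)
    (l : List ℕ) (hlen : xs.length = l.length) (j : ℕ) :
    ((totalSq k (listMonomial xs l)).coeff j).IsHomogeneous (l.sum + j) ∧
      (l.sum < j → (totalSq k (listMonomial xs l)).coeff j = 0) := by
  induction xs generalizing l j with
  | nil =>
    obtain rfl : l = [] := List.length_eq_zero_iff.1 hlen.symm
    simp only [listMonomial, List.zipWith_nil_left, List.prod_nil, map_one, List.sum_nil, zero_add,
      Polynomial.coeff_one]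
    split_ifs with h
    · subst h
      exact ⟨isHomogeneous_one _ _, fun h => absurd h (lt_irrefl 0)⟩
    · exact ⟨isHomogeneous_zero _ _ _, fun _ => rfl⟩
  | cons x xs ih =>
    obtain ⟨a, l, rfl⟩ : ∃ a l', l = a :: l' := by
      cases l with
      | nil => simp at hlen
      | cons a l => exact ⟨a, l, rfl⟩
    obtain ⟨i, rfl⟩ := hxs x (by simp)
    have ih := ih (fun y hy => hxs y (by simp [hy])) l (by simpa using hlen)
    rw [listMonomial_cons, map_mul, map_pow, totalSq_X, coeff_pow_totalSq_mul, List.sum_cons]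
    refine ⟨IsHomogeneous.sum _ _ _ fun c hc => ?_, fun hj => Finset.sum_eq_zero fun c hc => ?_⟩
    · split_ifs
      · have h1 := (isHomogeneous_X_pow (R := ZMod 2) i (a + c)).mul (ih (j - c)).1
        have hc : c ≤ j := by simpa [Nat.lt_succ_iff] using hc
        rwa [show a + c + (l.sum + (j - c)) = a + l.sum + j by omega] at h1
      · exact isHomogeneous_zero _ _ _
    · split_ifs with h
      · have : c ≤ a := h ▸ Nat.and_le_left
        rw [(ih (j - c)).2 (by omega), mul_zero]
      · rfl

/-- The derivation `Sq^1` of the total square is the formal derivative in `T`. -/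
theorem coeff_one_totalSq_coeff {k : ℕ} (f : P k) (j : ℕ) :
    (totalSq k ((totalSq k f).coeff j)).coeff 1 = (j + 1) • (totalSq k f).coeff (j + 1) := by
  have hD : ∀ f g : P k, (totalSq k (f * g)).coeff 1 =
      f * (totalSq k g).coeff 1 + (totalSq k f).coeff 1 * g := by
    intro f g
    rw [map_mul, Polynomial.mul_coeff_one, coeff_zero_totalSq, coeff_zero_totalSq]
  have hX : ∀ i : Fin k, (totalSq k (X i)).coeff 1 = X i ^ 2 := by
    intro i
    rw [totalSq_X, Polynomial.coeff_add, Polynomial.coeff_C, if_neg one_ne_zero,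
      Polynomial.coeff_C_mul, Polynomial.coeff_X_one, mul_one, zero_add]
  have hX2 : ∀ i : Fin k, (totalSq k (X i ^ 2)).coeff 1 = 0 := by
    intro i
    rw [pow_two, hD, mul_comm, vec_add_self]
  induction f using MvPolynomial.induction_on generalizing j with
  | C a =>
    have h : totalSq k (C a) = Polynomial.C (C a) := by simp [totalSq, algebraMap_eq]
    have h0 : (Polynomial.C (C a : P k)).coeff (j + 1) = 0 := by simp
    rw [h, h0, smul_zero, Polynomial.coeff_C]
    split_ifs
    · rw [h, Polynomial.coeff_C, if_neg one_ne_zero]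
    · simp
  | add f g hf hg => simp only [map_add, Polynomial.coeff_add, hf, hg, smul_add]
  | mul_X f i hf =>
    have hc : ∀ m, (totalSq k (f * X i)).coeff (m + 1) =
        (totalSq k f).coeff (m + 1) * X i + (totalSq k f).coeff m * X i ^ 2 := by
      intro m
      rw [map_mul, totalSq_X, mul_add, Polynomial.coeff_add, ← mul_assoc, Polynomial.coeff_mul_C,
        Polynomial.coeff_mul_X, Polynomial.coeff_mul_C]
    rcases j with _ | j
    · rw [coeff_zero_totalSq, zero_add, one_smul]
    · rw [hc, hc, map_add, Polynomial.coeff_add, hD, hD, hX, hX2, hf, hf]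
      simp only [nsmul_eq_mul]
      push_cast
      ring

theorem Sq_succ {k j : ℕ} (hj : Even j) (f : P k) : Sq k (j + 1) f = Sq k 1 (Sq k j f) := by
  obtain ⟨m, rfl⟩ := hj
  rw [Sq_apply, Sq_apply, Sq_apply, coeff_one_totalSq_coeff, succ_nsmul, ← two_mul, mul_nsmul,
    two_nsmul, vec_add_self, smul_zero, zero_add]

theorem bool_rec_eq_true {b c : Bool} : (Bool.rec false c b : Bool) = true ↔ b = true ∧ c = true := by
  cases b <;> simp

theorem allLt_spec {n : ℕ} {p : ℕ → Bool} (h : allLt n p = true) {a : ℕ} (ha : a < n) :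
    p a = true := by
  induction n with
  | zero => omega
  | succ n ih =>
    have h' := bool_rec_eq_true.1 h
    rcases Nat.lt_succ_iff_lt_or_eq.1 ha with ha | rfl
    · exact ih h'.2 ha
    · exact h'.1

theorem allComps_spec {m n : ℕ} {p : List ℕ → Bool} (h : allComps m n p = true) {l : List ℕ}
    (hl : l.length = m) (hs : l.sum = n) : p l = true := by
  induction m generalizing n p l with
  | zero =>
    obtain rfl : l = [] := List.length_eq_zero_iff.1 hl
    obtain rfl : n = 0 := hs.symm
    exact h
  | succ m ih =>
    obtain ⟨a, l, rfl⟩ : ∃ a l', l = a :: l' := by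
      cases l with
      | nil => simp at hl
      | cons a l => exact ⟨a, l, rfl⟩
    rw [List.sum_cons] at hs
    have h' : allLt (n + 1) (fun a => allComps m (n - a) fun l => p (a :: l)) = true := h
    exact ih (allLt_spec h' (a := a) (by omega)) (by simpa using hl) (by omega)

theorem checkSq_spec {t : Trie} {n j : ℕ} (h : checkSq t n j = true) (hn : n ≤ 31) {l : List ℕ}
    (hl : l.length = 5) (hs : l.sum + j = n) :
    codeMap n t (Sq 5 j (listMonomial vars l)) = 0 := by
  have h1 := Nat.eq_of_beq_eq_true (allComps_spec h hl (Nat.eq_sub_of_add_eq hs))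
  have hd : digitSum (encode l) = l.sum := by
    rw [digitSum_eq, digits_encode_of_sum hl (by omega)]
  rw [← mon_encode hl (by omega), ← sum_terms (by omega), codeMap_sum t, h1, bits_zero]
  intro k hk
  rw [digitSum_of_mem_terms (by omega) hk, hd, hs]

/-- Whether the codes vanish on the hit polynomials of degree `n`. -/
noncomputable def checkHits (t : Trie) (n : ℕ) : Bool :=
  Bool.rec false (allLt (Nat.div n 4) fun i => checkSq t n (Nat.mul 2 (Nat.succ i)))
    (checkSq t n 1)

theorem codeMap_Sq_of_even {t : Trie} {n : ℕ} (h : checkHits t n = true) (hn : n ≤ 31) {j : ℕ}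
    (hj : j = 1 ∨ Even j ∧ 0 < j) (f : P 5) : codeMap n t (Sq 5 j f) = 0 := by
  have h := bool_rec_eq_true.1 h
  induction f using induction_monomial with
  | h0 => simp
  | hadd f g hf hg => rw [map_add, map_add, hf, hg, add_zero]
  | hmon a =>
    rw [monomial_eq_listMonomial]
    have hh := totalSq_listMonomial vars (by simp [vars]) (expo a) rfl j
    by_cases hdeg : (expo a).sum + j = n
    · by_cases hlt : (expo a).sum < j
      · rw [Sq_apply, hh.2 hlt, map_zero]
      · refine checkSq_spec ?_ hn rfl hdeg
        rcases hj with rfl | ⟨⟨i, rfl⟩, hi⟩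
        · exact h.1
        · have := allLt_spec h.2 (a := i - 1) (show i - 1 < n / 4 by omega)
          have e : Nat.mul 2 (Nat.succ (i - 1)) = i + i := by
            change 2 * (i - 1 + 1) = _
            omega
          rwa [e] at this
    · exact codeMap_of_isHomogeneous t hdeg hh.1

theorem hit_le_ker_codeMap {t : Trie} {n : ℕ} (h : checkHits t n = true) (hn : n ≤ 31) :
    hit 5 ≤ LinearMap.ker (codeMap n t) := by
  refine iSup₂_le fun j hj => ?_
  rintro _ ⟨f, rfl⟩
  rw [LinearMap.mem_ker]
  rcases Nat.even_or_odd j with he | ⟨i, rfl⟩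
  · exact codeMap_Sq_of_even h hn (Or.inr ⟨he, hj⟩) f
  · rw [Sq_succ (even_two_mul i)]
    exact codeMap_Sq_of_even h hn (Or.inl rfl) _

theorem lowBit_spec {v : ℕ} (hv : v ≠ 0) :
    ∃ t, lowBit v = 2 ^ t ∧ v.testBit t = true ∧ ∀ s < t, v.testBit s = false := by
  induction v using Nat.strong_induction_on with
  | _ v ih =>
    have hdiv : lowBit v / 2 = (v / 2) ^^^ ((v / 2) &&& ((v - 1) / 2)) := by
      change (v ^^^ (v &&& (v - 1))) / 2 = _
      rw [Nat.xor_div_two, Nat.and_div_two]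
    have hmod : lowBit v % 2 = v % 2 := by
      change (v ^^^ (v &&& (v - 1))) % 2 = _
      have h1 := Nat.xor_mod_two_pow (a := v) (b := v &&& (v - 1)) (n := 1)
      have h2 := Nat.and_mod_two_pow (a := v) (b := v - 1) (n := 1)
      rw [pow_one] at h1 h2
      rw [h1, h2]
      rcases Nat.mod_two_eq_zero_or_one v with h | h
      · rw [h]; simp
      · rw [h, show (v - 1) % 2 = 0 by omega]; rfl
    rcases Nat.mod_two_eq_zero_or_one v with h | h
    · obtain ⟨t, h1, h2, h3⟩ := ih (v / 2) (by omega) (by omega)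
      refine ⟨t + 1, ?_, ?_, ?_⟩
      · have : lowBit v / 2 = lowBit (v / 2) := by
          rw [hdiv, show (v - 1) / 2 = v / 2 - 1 by omega]
          rfl
        rw [pow_succ, ← h1, ← this]
        omega
      · rw [Nat.testBit_succ, h2]
      · intro s hs
        rcases s with _ | s
        · rw [Nat.testBit_zero, h]
          rfl
        · rw [Nat.testBit_succ, h3 s (by omega)]
    · refine ⟨0, ?_, ?_, fun s hs => absurd hs (Nat.not_lt_zero s)⟩
      · have : lowBit v / 2 = 0 := by
          rw [hdiv, show (v - 1) / 2 = v / 2 by omega, Nat.and_self, Nat.xor_self]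
        rw [pow_zero]
        omega
      · rw [Nat.testBit_zero, h]
        rfl

theorem bits_reduce_mem {W : Submodule (ZMod 2) (ℕ → ZMod 2)} {t : Trie}
    (ht : ∀ k p, t.find k = p + 1 → bits (p + 1) ∈ W) (fuel : ℕ) {v : ℕ} (hv : bits v ∈ W) :
    bits (reduce t fuel v) ∈ W := by
  induction fuel generalizing v with
  | zero => exact hv
  | succ f ih =>
    rcases v with _ | v
    · exact hv
    · have : reduce t (f + 1) (v + 1) = Nat.rec (v + 1)
          (fun p _ => reduce t f (Nat.xor (v + 1) (p + 1)))
          (t.find (lowBit (v + 1) % 2029)) := rfl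
      rw [this]
      rcases h : t.find (lowBit (v + 1) % 2029) with _ | p
      · exact hv
      · refine ih ?_
        rw [bits_xor]
        exact W.add_mem hv (ht _ _ h)

/-- The lowest indices of nonzero coordinates of nonzero elements of `U` are bits of `mask`. -/
def LowestIn (U : Submodule (ZMod 2) (ℕ → ZMod 2)) (mask : ℕ) : Prop :=
  ∀ u ∈ U, u ≠ 0 → ∃ s, mask.testBit s = true ∧ u s ≠ 0 ∧ ∀ s' < s, u s' = 0

theorem lowestIn_bot (mask : ℕ) : LowestIn ⊥ mask :=
  fun _ hu h => absurd ((Submodule.mem_bot _).1 hu) h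

theorem LowestIn.sup_span {U : Submodule (ZMod 2) (ℕ → ZMod 2)} {mask : ℕ}
    (hU : LowestIn U mask) {v : ℕ → ZMod 2} {t : ℕ} (hmask : mask.testBit t = false)
    (hvt : v t ≠ 0) (hv : ∀ s < t, v s = 0) :
    v ∉ U ∧ LowestIn (U ⊔ Submodule.span (ZMod 2) {v}) (mask ||| 2 ^ t) := by
  have hbit : ∀ s, (mask ||| 2 ^ t).testBit s = (mask.testBit s || decide (t = s)) := fun s => by
    rw [Nat.testBit_or, Nat.testBit_two_pow]
  constructor
  · intro hvU
    obtain ⟨s, h1, h2, h3⟩ := hU v hvU (fun h => hvt (by rw [h]; rfl))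
    rcases lt_trichotomy s t with h | h | h
    · exact h2 (hv s h)
    · rw [h, hmask] at h1
      cases h1
    · exact hvt (h3 t h)
  · intro w hw hw0
    obtain ⟨u, hu, x, hx, rfl⟩ := Submodule.mem_sup.1 hw
    obtain ⟨a, rfl⟩ := Submodule.mem_span_singleton.1 hx
    have ha : a = 0 ∨ a = 1 := (by decide : ∀ a : ZMod 2, a = 0 ∨ a = 1) a
    rcases ha with rfl | rfl
    · rw [zero_smul, add_zero] at hw0 ⊢
      obtain ⟨s, h1, h2, h3⟩ := hU u hu hw0
      exact ⟨s, by rw [hbit, h1]; rfl, h2, h3⟩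
    · rw [one_smul] at hw0 ⊢
      by_cases hu0 : u = 0
      · subst hu0
        refine ⟨t, by simp [hbit], ?_, ?_⟩
        · simpa using hvt
        · intro s hs
          simpa using hv s hs
      · obtain ⟨s, h1, h2, h3⟩ := hU u hu hu0
        have hst : s ≠ t := by
          rintro rfl
          rw [hmask] at h1
          cases h1
        rcases lt_or_gt_of_ne hst with h | h
        · refine ⟨s, by rw [hbit, h1]; rfl, ?_, ?_⟩
          · rw [Pi.add_apply, hv s h, add_zero]
            exact h2
          · intro s' hs'
            rw [Pi.add_apply, h3 s' hs', hv s' (hs'.trans h), add_zero]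
        · refine ⟨t, by simp [hbit], ?_, ?_⟩
          · rw [Pi.add_apply, h3 t h, zero_add]
            exact hvt
          · intro s' hs'
            rw [Pi.add_apply, h3 s' (hs'.trans h), hv s' hs', add_zero]

theorem rankGe_spec {W : Submodule (ZMod 2) (ℕ → ZMod 2)} [FiniteDimensional (ZMod 2) W]
    (vs : List ℕ) (hvs : ∀ v ∈ vs, bits v ∈ W) {t : Trie}
    (ht : ∀ k p, t.find k = p + 1 → bits (p + 1) ∈ W) {U : Submodule (ZMod 2) (ℕ → ZMod 2)}
    (hUW : U ≤ W) {mask : ℕ} (hU : LowestIn U mask) {r : ℕ} (h : rankGe vs t mask r = true) :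
    Module.finrank (ZMod 2) U + r ≤ Module.finrank (ZMod 2) W := by
  induction vs generalizing t U mask r with
  | nil =>
    obtain rfl : r = 0 := Nat.eq_of_beq_eq_true h
    exact Submodule.finrank_mono hUW
  | cons v vs ih =>
    have hvs' : ∀ v ∈ vs, bits v ∈ W := fun v hv => hvs v (by simp [hv])
    have hred := bits_reduce_mem ht 1000 (hvs v (by simp))
    have heq : rankGe (v :: vs) t mask r = Nat.rec (rankGe vs t mask r) (fun p _ =>
      Nat.rec (Nat.rec true (fun r' _ =>
          (t.insert 26 (lowBit (p + 1) % 2029) (p + 1)).force fun t' =>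
            rankGe vs t' (mask ||| lowBit (p + 1)) r') r)
        (fun _ _ => rankGe vs t mask r) (mask &&& lowBit (p + 1)))
      (reduce t 1000 v) := rfl
    rw [heq] at h
    rcases hp : reduce t 1000 v with _ | p
    · rw [hp] at h
      exact ih hvs' ht hUW hU h
    · rw [hp] at h hred
      rcases hm : mask &&& lowBit (p + 1) with _ | m
      · simp only [hm] at h
        rcases r with _ | r
        · exact Submodule.finrank_mono hUW
        · simp only [Trie.force_eq] at h
          obtain ⟨s, h1, h2, h3⟩ := lowBit_spec (Nat.succ_ne_zero p)
          rw [Nat.succ_eq_add_one] at h1 h2 h3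
          have hmask : mask.testBit s = false := by
            have := congrArg (fun x => x.testBit s) hm
            simpa [h1] using this
          rw [h1] at h
          obtain ⟨h4, h5⟩ := hU.sup_span (v := bits (p + 1)) hmask (by simp [bits, h2])
            (fun s' hs' => by simp [bits, h3 s' hs'])
          have hle : U ⊔ Submodule.span (ZMod 2) {bits (p + 1)} ≤ W :=
            sup_le hUW ((Submodule.span_singleton_le_iff_mem _ _).2 hred)
          have hlt : U < U ⊔ Submodule.span (ZMod 2) {bits (p + 1)} :=
            lt_of_le_of_ne le_sup_left fun he => h4 (he ▸
              (le_sup_right : Submodule.span (ZMod 2) {bits (p + 1)} ≤ _)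
                (Submodule.mem_span_singleton_self _))
          have : FiniteDimensional (ZMod 2)
              (U ⊔ Submodule.span (ZMod 2) {bits (p + 1)} : Submodule (ZMod 2) (ℕ → ZMod 2)) :=
            Submodule.finiteDimensional_of_le hle
          have hfin := Submodule.finrank_lt_finrank_of_lt hlt
          have := ih hvs' (t := t.insert 26 (2 ^ s % 2029) (p + 1)) (fun k q hq => by
            rcases Trie.find_insert hq with ⟨_, hq⟩ | hq
            · rw [← hq]
              exact hred
            · exact ht _ _ hq) hle h5 h
          omega
      · simp only [hm] at h
        exact ih hvs' ht hUW hU h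

theorem le_finrank_of_rankGe {W : Submodule (ZMod 2) (ℕ → ZMod 2)} [FiniteDimensional (ZMod 2) W]
    {vs : List ℕ} (hvs : ∀ v ∈ vs, bits v ∈ W) {r : ℕ} (h : rankGe vs .nil 0 r = true) :
    r ≤ Module.finrank (ZMod 2) W := by
  have := rankGe_spec vs hvs (t := .nil) (fun k p hp => by cases hp) bot_le (lowestIn_bot 0) h
  rwa [finrank_bot, zero_add] at this

/-- Whether `t` is a table for the basis `bs` in degree `n`. -/
noncomputable def checkTable (t : Trie) (n : ℕ) (bs : List ℕ) : Bool :=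
  Bool.rec false (Bool.rec false (checkHits t n) (checkBasis t n bs 1)) (checkComplete t n)

/-- The table `t` gives the coordinates of the monomials of degree `n` with respect to the basis
`bs` of the space of cohits. -/
structure IsTable (n : ℕ) (bs : List ℕ) (t : Trie) : Prop where
  le : n ≤ 31
  reduces : t.Reduces bs
  complete : ∀ l : List ℕ, l.length = 5 → l.sum = n → ∃ c, t.find (encode l) = c + 1
  degree : ∀ (i : ℕ) (h : i < bs.length), digitSum bs[i] = n
  code : ∀ (i : ℕ) (h : i < bs.length), t.code bs[i] = 2 ^ i
  hit_le : hit 5 ≤ LinearMap.ker (codeMap n t)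

theorem checkBasis_spec {t : Trie} {n v : ℕ} {bs : List ℕ} (h : checkBasis t n bs v = true) (i : ℕ)
    (hi : i < bs.length) : digitSum bs[i] = n ∧ t.code bs[i] = 2 ^ i * v := by
  induction bs generalizing v i with
  | nil => simp at hi
  | cons b bs ih =>
    have h' := bool_rec_eq_true.1 h
    have h'' := bool_rec_eq_true.1 h'.2
    rcases i with _ | i
    · exact ⟨Nat.eq_of_beq_eq_true h'.1,
        (Nat.eq_of_beq_eq_true h''.1).trans (by rw [pow_zero, one_mul])⟩
    · have := ih h''.2 i (by simpa using hi)
      refine ⟨this.1, this.2.trans ?_⟩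
      change 2 ^ i * (2 * v) = _
      ring

theorem isTable {n : ℕ} (hn : n ≤ 31) {bs Ns : List ℕ}
    (h : checkTable (table bs Ns) n bs = true) : IsTable n bs (table bs Ns) := by
  have h1 := bool_rec_eq_true.1 h
  have h2 := bool_rec_eq_true.1 h1.2
  refine ⟨hn, reduces_table bs Ns, fun l hl hs => ?_, fun i hi => (checkBasis_spec h2.1 i hi).1,
    fun i hi => by rw [(checkBasis_spec h2.1 i hi).2, mul_one], hit_le_ker_codeMap h2.2 hn⟩
  have h3 := allComps_spec h1.1 hl hs
  rcases h4 : (table bs Ns).find (encode l) with _ | c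
  · rw [h4] at h3
    cases h3
  · exact ⟨c, rfl⟩

theorem listMonomial_mem {l : List ℕ} (hl : l.length = 5) :
    listMonomial vars l ∈ PDeg 5 l.sum := by
  have := (totalSq_listMonomial vars (by simp [vars]) l hl.symm 0).1
  rwa [coeff_zero_totalSq, add_zero] at this

theorem mon_mem {n k : ℕ} (h : digitSum k = n) : mon k ∈ PDeg 5 n :=
  h ▸ listMonomial_mem rfl

/-- The class of a homogeneous polynomial in the space of cohits. -/
noncomputable def cohit {n : ℕ} (f : P 5) (hf : f ∈ PDeg 5 n) : QP 5 n :=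
  (hitDeg 5 n).mkQ ⟨f, hf⟩

theorem exists_cohit {n : ℕ} (v : QP 5 n) : ∃ f hf, v = cohit f hf := by
  obtain ⟨f, rfl⟩ := (hitDeg 5 n).mkQ_surjective v
  exact ⟨f.1, f.2, rfl⟩

/-- The space of cohits of degree `n` inside all cohits. -/
noncomputable def ofCohit (n : ℕ) : QP 5 n →ₗ[ZMod 2] P 5 ⧸ hit 5 :=
  (hitDeg 5 n).mapQ (hit 5) (PDeg 5 n).subtype le_rfl

theorem ofCohit_cohit {n : ℕ} {f : P 5} (hf : f ∈ PDeg 5 n) :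
    ofCohit n (cohit f hf) = (hit 5).mkQ f := rfl

theorem ofCohit_injective (n : ℕ) : Function.Injective (ofCohit n) := by
  rw [injective_iff_map_eq_zero]
  intro v hv
  obtain ⟨f, hf, rfl⟩ := exists_cohit v
  rw [ofCohit_cohit] at hv
  have hf' : f ∈ hit 5 := (Submodule.Quotient.mk_eq_zero _).1 hv
  exact (Submodule.Quotient.mk_eq_zero (hitDeg 5 n)).2 hf'

namespace IsTable

variable {n : ℕ} {bs : List ℕ} {t : Trie}

/-- The coordinates of a class. -/
noncomputable def coord (ht : IsTable n bs t) : QP 5 n →ₗ[ZMod 2] ℕ → ZMod 2 :=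
  (hitDeg 5 n).liftQ ((codeMap n t).comp (PDeg 5 n).subtype) fun _ hf => ht.hit_le hf

theorem coord_cohit (ht : IsTable n bs t) {f : P 5} (hf : f ∈ PDeg 5 n) :
    ht.coord (cohit f hf) = codeMap n t f := rfl

theorem comb_codeMap (ht : IsTable n bs t) {f : P 5} (hf : f ∈ PDeg 5 n) :
    comb bs (codeMap n t f) = (hit 5).mkQ f := by
  have hf' : f.IsHomogeneous n := hf
  rw [MvPolynomial.as_sum f, map_sum, map_sum, map_sum]
  refine Finset.sum_congr rfl fun a ha => ?_
  have hdeg : (expo a).sum = n := by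
    have h0 := hf' (MvPolynomial.mem_support_iff.1 ha)
    have h1 : a.degree = Finsupp.weight 1 a := by
      rw [Finsupp.degree_eq_weight_one]
      rfl
    rw [← h0, ← h1, Finsupp.degree_eq_sum, Fin.sum_univ_five]
    simp [expo, add_assoc]
  have hc : (monomial a (f.coeff a) : P 5) = f.coeff a • monomial a 1 := by
    rw [smul_monomial, smul_eq_mul, mul_one]
  obtain ⟨c, hc'⟩ := ht.complete (expo a) rfl hdeg
  have h2 := ht.reduces _ _ hc'
  have h3 : t.code (encode (expo a)) = c := by
    rw [Trie.code, hc']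
    rfl
  rw [hc, map_smul, map_smul, map_smul, monomial_eq_listMonomial, codeMap_listMonomial n t rfl,
    if_pos hdeg, h3, ← h2, monClass, mon_encode rfl (hdeg.trans_le ht.le)]

theorem comb_coord (ht : IsTable n bs t) (v : QP 5 n) : comb bs (ht.coord v) = ofCohit n v := by
  obtain ⟨f, hf, rfl⟩ := exists_cohit v
  exact ht.comb_codeMap hf

theorem coord_injective (ht : IsTable n bs t) : Function.Injective ht.coord := by
  intro v w h
  apply ofCohit_injective
  rw [← ht.comb_coord, ← ht.comb_coord, h]

/-- The elements of the basis. -/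
noncomputable def vec (ht : IsTable n bs t) (i : Fin bs.length) : QP 5 n :=
  cohit (mon bs[i]) (mon_mem (ht.degree i i.2))

theorem coord_vec (ht : IsTable n bs t) (i : Fin bs.length) :
    ht.coord (ht.vec i) = Pi.single (i : ℕ) 1 := by
  refine (codeMap_mon t (ht.degree i i.2)).trans ?_
  rw [ht.code i i.2, bits_two_pow]

theorem linearIndependent_vec (ht : IsTable n bs t) : LinearIndependent (ZMod 2) ht.vec := by
  refine LinearIndependent.of_comp ht.coord ?_
  have h : ht.coord ∘ ht.vec = (fun i : ℕ => (Pi.single i 1 : ℕ → ZMod 2)) ∘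
      (fun i : Fin bs.length => (i : ℕ)) := funext fun i => ht.coord_vec i
  rw [h]
  exact (Pi.linearIndependent_single_one ℕ (ZMod 2)).comp _ Fin.val_injective

theorem span_vec (ht : IsTable n bs t) : ⊤ ≤ Submodule.span (ZMod 2) (Set.range ht.vec) := by
  intro v _
  have h : v = ∑ i : Fin bs.length, ht.coord v i • ht.vec i := by
    apply ofCohit_injective
    rw [← ht.comb_coord, comb_apply, map_sum]
    refine Finset.sum_congr rfl fun i _ => ?_
    rw [map_smul]
    rfl
  rw [h]
  exact Submodule.sum_mem _ fun i _ => Submodule.smul_mem _ _ (Submodule.subset_span ⟨i, rfl⟩)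

/-- The basis of the space of cohits. -/
noncomputable def basis (ht : IsTable n bs t) : Module.Basis (Fin bs.length) (ZMod 2) (QP 5 n) :=
  Module.Basis.mk ht.linearIndependent_vec ht.span_vec

theorem finrank_eq (ht : IsTable n bs t) : Module.finrank (ZMod 2) (QP 5 n) = bs.length := by
  rw [Module.finrank_eq_card_basis ht.basis, Fintype.card_fin]

theorem finite (ht : IsTable n bs t) : Module.Finite (ZMod 2) (QP 5 n) :=
  Module.Finite.of_basis ht.basis

end IsTable

theorem repQP_cohit {n : ℕ} (g : GLk 5) {f : P 5} (hf : f ∈ PDeg 5 n) :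
    repQP 5 n g (cohit f hf) = cohit (subst g.val f) (subst_mem g.val hf) := rfl

/-- The map `gk` gives the terms of the images of the monomials of degree `n` under `g`. -/
def Realizes (n : ℕ) (g : GLk 5) (gk : ℕ → List ℕ) : Prop :=
  ∀ k, digitSum k = n →
    subst g.val (mon k) = ((gk k).map mon).sum ∧ ∀ x ∈ gk k, digitSum x = n

/-- The shift of coordinates by `d`. -/
def shift (d : ℕ) : (ℕ → ZMod 2) →ₗ[ZMod 2] ℕ → ZMod 2 where
  toFun w i := if d ≤ i then w (i - d) else 0
  map_add' v w := by
    ext i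
    simp only [Pi.add_apply]
    split_ifs <;> simp
  map_smul' c v := by
    ext i
    simp

theorem bits_shiftLeft (x d : ℕ) : bits (Nat.shiftLeft x d) = shift d (bits x) := by
  ext i
  change (if (x <<< d).testBit i then (1 : ZMod 2) else 0) =
    if d ≤ i then (if x.testBit (i - d) then 1 else 0) else 0
  rw [Nat.testBit_shiftLeft]
  by_cases h : d ≤ i <;> simp [h]

theorem mapList_eq {α β : Type} (f : α → β) (l : List α) : mapList f l = l.map f := by
  induction l with
  | nil => rfl
  | cons a l ih => exact congrArg (f a :: ·) ih

namespace IsTable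

variable {n : ℕ} {bs : List ℕ} {t : Trie}

/-- The coordinates of the images of a class under `g - 1` for `g` in `gs`. -/
noncomputable def defect (ht : IsTable n bs t) (d : ℕ) :
    List (GLk 5 × (ℕ → List ℕ)) → QP 5 n →ₗ[ZMod 2] ℕ → ZMod 2
  | [] => 0
  | g :: gs => ht.coord ∘ₗ (repQP 5 n g.1 - LinearMap.id) + shift d ∘ₗ ht.defect d gs

theorem defect_vec (ht : IsTable n bs t) (d : ℕ) (gs : List (GLk 5 × (ℕ → List ℕ)))
    (hgs : ∀ g ∈ gs, Realizes n g.1 g.2) (i : Fin bs.length) :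
    ht.defect d gs (ht.vec i) = bits (row t d (gs.map Prod.snd) bs[i]) := by
  induction gs with
  | nil => exact bits_zero.symm
  | cons g gs ih =>
    have hrow : row t d ((g :: gs).map Prod.snd) bs[i] =
        Nat.xor (Nat.xor (t.sumCode (g.2 bs[i])) (t.code bs[i]))
          (Nat.shiftLeft (row t d (gs.map Prod.snd) bs[i]) d) := rfl
    have hg := hgs g (by simp) bs[i] (ht.degree i i.2)
    have h1 : ht.coord (repQP 5 n g.1 (ht.vec i)) = bits (t.sumCode (g.2 bs[i])) := by
      rw [vec, repQP_cohit, coord_cohit, hg.1, codeMap_sum t hg.2]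
    have h2 : ht.coord (ht.vec i) = bits (t.code bs[i]) := codeMap_mon t (ht.degree i i.2)
    rw [hrow, bits_xor, bits_xor, bits_shiftLeft, ← ih fun g hg => hgs g (by simp [hg]), ← h1,
      ← h2, defect]
    simp only [LinearMap.add_apply, LinearMap.comp_apply, LinearMap.sub_apply, LinearMap.id_apply,
      map_sub]
    rw [sub_eq_add_neg, neg_eq_of_add_eq_zero_left (vec_add_self (ht.coord (ht.vec i)))]

theorem defect_eq_zero (ht : IsTable n bs t) (d : ℕ) (gs : List (GLk 5 × (ℕ → List ℕ)))
    {v : QP 5 n} (hv : ∀ g ∈ gs, repQP 5 n g.1 v = v) : ht.defect d gs v = 0 := by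
  induction gs with
  | nil => rfl
  | cons g gs ih =>
    rw [defect, LinearMap.add_apply, LinearMap.comp_apply, LinearMap.comp_apply,
      ih fun g hg => hv g (by simp [hg]), LinearMap.sub_apply, LinearMap.id_apply,
      hv g (by simp), sub_self, map_zero, map_zero, add_zero]

theorem finrank_invariants_add_le (ht : IsTable n bs t) {d r : ℕ}
    (gs : List (GLk 5 × (ℕ → List ℕ))) (hgs : ∀ g ∈ gs, Realizes n g.1 g.2)
    (h : rankGe (mapList (row t d (gs.map Prod.snd)) bs) .nil 0 r = true)
    {W : Submodule (ZMod 2) (QP 5 n)} (hW : ∀ v ∈ W, ∀ g ∈ gs, repQP 5 n g.1 v = v) :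
    Module.finrank (ZMod 2) W + r ≤ bs.length := by
  have := ht.finite
  have h1 : r ≤ Module.finrank (ZMod 2) (LinearMap.range (ht.defect d gs)) := by
    refine le_finrank_of_rankGe (fun v hv => ?_) h
    rw [mapList_eq] at hv
    obtain ⟨k, hk, rfl⟩ := List.mem_map.1 hv
    obtain ⟨i, hi, rfl⟩ := List.getElem_of_mem hk
    exact ⟨ht.vec ⟨i, hi⟩, ht.defect_vec d gs hgs ⟨i, hi⟩⟩
  have h2 : W ≤ LinearMap.ker (ht.defect d gs) := fun v hv => ht.defect_eq_zero d gs (hW v hv)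
  have h3 := Submodule.finrank_mono h2
  have h4 := LinearMap.finrank_range_add_finrank_ker (ht.defect d gs)
  rw [ht.finrank_eq] at h4
  omega

end IsTable

theorem subst_listMonomial (g : Matrix (Fin 5) (Fin 5) (ZMod 2)) (l : List ℕ) :
    subst g (listMonomial vars l) = listMonomial (vars.map (subst g)) l := by
  rw [listMonomial, listMonomial, map_list_prod, List.map_zipWith, List.zipWith_map_left]
  simp only [map_pow]

theorem subst_permGL_X {k : ℕ} (σ : Equiv.Perm (Fin k)) (j : Fin k) :
    subst (permGL k σ).val (X j) = X (σ j) := by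
  have h : (permGL k σ).val = (σ⁻¹).permMatrix (ZMod 2) := rfl
  rw [h, subst_X, Finset.sum_eq_single (σ j)]
  · simp [Equiv.Perm.permMatrix, PEquiv.toMatrix_apply]
  · intro i _ hi
    have : (Equiv.symm σ) i ≠ j := fun h => hi ((Equiv.symm_apply_eq σ).1 h)
    simp [Equiv.Perm.permMatrix, PEquiv.toMatrix_apply, this]
  · simp

theorem realizes_swap {n : ℕ} (hn : n ≤ 31) : Realizes n (permGL 5 (Equiv.swap 0 1)) swapKey := by
  intro k hk
  have hv : vars.map (subst (permGL 5 (Equiv.swap 0 1)).val) = [X 1, X 0, X 2, X 3, X 4] := by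
    simp only [vars, List.map_cons, List.map_nil, subst_permGL_X]
    rfl
  have hkey : swapKey k =
      [encode [k / 32 % 32, k % 32, k / 1024 % 32, k / 32768 % 32, k / 1048576]] := rfl
  rw [digitSum_eq, digits_eq] at hk
  simp only [List.sum_cons, List.sum_nil] at hk
  have hs : [k / 32 % 32, k % 32, k / 1024 % 32, k / 32768 % 32, k / 1048576].sum = n := by
    simp only [List.sum_cons, List.sum_nil]
    linarith
  constructor
  · rw [hkey, List.map_singleton, List.sum_singleton, mon_encode rfl (hs.trans_le hn), mon,
      subst_listMonomial, hv, digits_eq]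
    simp only [listMonomial, vars, List.zipWith_cons_cons, List.zipWith_nil_left, List.prod_cons,
      List.prod_nil]
    ring
  · intro x hx
    rw [hkey] at hx
    rw [List.mem_singleton.1 hx, digitSum_eq, digits_encode_of_sum rfl (hs.trans_le hn), hs]

theorem realizes_cycle {n : ℕ} (hn : n ≤ 31) : Realizes n (permGL 5 (finRotate 5)) cycleKey := by
  intro k hk
  have hv : vars.map (subst (permGL 5 (finRotate 5)).val) = [X 1, X 2, X 3, X 4, X 0] := by
    simp only [vars, List.map_cons, List.map_nil, subst_permGL_X]
    rfl
  have hkey : cycleKey k =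
      [encode [k / 1048576, k % 32, k / 32 % 32, k / 1024 % 32, k / 32768 % 32]] := rfl
  rw [digitSum_eq, digits_eq] at hk
  simp only [List.sum_cons, List.sum_nil] at hk
  have hs : [k / 1048576, k % 32, k / 32 % 32, k / 1024 % 32, k / 32768 % 32].sum = n := by
    simp only [List.sum_cons, List.sum_nil]
    linarith
  constructor
  · rw [hkey, List.map_singleton, List.sum_singleton, mon_encode rfl (hs.trans_le hn), mon,
      subst_listMonomial, hv, digits_eq]
    simp only [listMonomial, vars, List.zipWith_cons_cons, List.zipWith_nil_left, List.prod_cons,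
      List.prod_nil]
    ring
  · intro x hx
    rw [hkey] at hx
    rw [List.mem_singleton.1 hx, digitSum_eq, digits_encode_of_sum rfl (hs.trans_le hn), hs]

/-- The substitution that adds the second variable to the first one. -/
noncomputable def addGL : GLk 5 :=
  Matrix.GeneralLinearGroup.mkOfDetNeZero (Matrix.transvection 1 0 1)
    (by rw [Matrix.det_transvection_of_ne _ _ (by decide)]; exact one_ne_zero)

theorem addGL_val : addGL.val = Matrix.transvection 1 0 1 := rfl

theorem subst_addGL_X (j : Fin 5) :
    subst addGL.val (X j) = if j = 0 then X 0 + X 1 else X j := by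
  rw [addGL_val, subst_X]
  simp only [Matrix.transvection, Matrix.add_apply, Matrix.one_apply, Matrix.single_apply,
    Fin.sum_univ_five]
  fin_cases j <;> simp

theorem transvectionKey_aux (k a : ℕ) (φ : ℕ → P 5) (n : ℕ) :
    ((Nat.rec [] (fun c ih => Bool.rec ih (Nat.add k (Nat.mul 31 c) :: ih)
      (Nat.beq (Nat.land a c) c)) n : List ℕ).map φ).sum =
      ∑ c ∈ Finset.range n, if Nat.land a c = c then φ (k + 31 * c) else 0 := by
  induction n with
  | zero => rfl
  | succ n ih =>
    rw [Finset.sum_range_succ, ← ih]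
    simp only [bool_rec_beq]
    split_ifs
    · rw [List.map_cons, List.sum_cons]
      exact add_comm _ _
    · rw [add_zero]

theorem mem_transvectionKey_aux {k a x : ℕ} (n : ℕ)
    (hx : x ∈ (Nat.rec [] (fun c ih => Bool.rec ih (Nat.add k (Nat.mul 31 c) :: ih)
      (Nat.beq (Nat.land a c) c)) n : List ℕ)) : ∃ c < n, x = k + 31 * c := by
  induction n with
  | zero => simp at hx
  | succ n ih =>
    simp only [bool_rec_beq] at hx ih
    split_ifs at hx
    · rcases List.mem_cons.1 hx with rfl | hx
      · exact ⟨n, by omega, rfl⟩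
      · obtain ⟨c, h1, h2⟩ := ih hx
        exact ⟨c, by omega, h2⟩
    · obtain ⟨c, h1, h2⟩ := ih hx
      exact ⟨c, by omega, h2⟩

theorem add_mul_eq_encode {k c : ℕ} (hc : c ≤ k % 32) : k + 31 * c =
    encode [k % 32 - c, k / 32 % 32 + c, k / 1024 % 32, k / 32768 % 32, k / 1048576] := by
  rw [encode_five]
  omega

theorem realizes_add {n : ℕ} (hn : n ≤ 31) : Realizes n addGL transvectionKey := by
  intro k hk
  have hv : vars.map (subst addGL.val) = [X 0 + X 1, X 1, X 2, X 3, X 4] := by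
    simp only [vars, List.map_cons, List.map_nil, subst_addGL_X]
    rfl
  rw [digitSum_eq, digits_eq] at hk
  simp only [List.sum_cons, List.sum_nil] at hk
  have hs : ∀ c ≤ k % 32, [k % 32 - c, k / 32 % 32 + c, k / 1024 % 32, k / 32768 % 32,
      k / 1048576].sum = n := by
    intro c hc
    simp only [List.sum_cons, List.sum_nil]
    rw [← hk]
    generalize k % 32 = x at *
    omega
  constructor
  · refine Eq.trans ?_ (transvectionKey_aux k (k % 32) mon (k % 32 + 1)).symm
    rw [mon, subst_listMonomial, hv, digits_eq, listMonomial_cons, add_comm (X 0) (X 1), add_pow,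
      Finset.sum_mul]
    refine Finset.sum_congr rfl fun c hc => ?_
    have hc : c ≤ k % 32 := by simpa [Nat.lt_succ_iff] using hc
    rw [add_mul_eq_encode hc, mon_encode rfl ((hs c hc).trans_le hn)]
    have h1 : (((k % 32).choose c : ℕ) : P 5) =
        algebraMap (ZMod 2) (P 5) (if Nat.land (k % 32) c = c then 1 else 0) := by
      rw [← choose_mod_two, map_natCast]
    rw [h1]
    split_ifs
    · simp only [listMonomial, vars, List.zipWith_cons_cons, List.zipWith_nil_left, List.prod_cons,
        List.prod_nil, map_one]
      ring
    · rw [map_zero, mul_zero, zero_mul]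
  · intro x hx
    obtain ⟨c, hc, rfl⟩ := mem_transvectionKey_aux (k := k) (a := k % 32) (k % 32 + 1) hx
    have hc : c ≤ k % 32 := Nat.lt_succ_iff.1 hc
    rw [add_mul_eq_encode hc, digitSum_eq, digits_encode_of_sum rfl ((hs c hc).trans_le hn),
      hs c hc]

/-- The stabilizer of a class. -/
def stabilizer {n : ℕ} (v : QP 5 n) : Subgroup (GLk 5) where
  carrier := {g | repQP 5 n g v = v}
  one_mem' := by simp
  mul_mem' := fun {g h} hg hh => by
    change repQP 5 n (g * h) v = v
    rw [map_mul, Module.End.mul_apply, hh, hg]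
  inv_mem' := fun {g} hg => by
    change repQP 5 n g⁻¹ v = v
    have hg : repQP 5 n g v = v := hg
    conv_lhs => rw [← hg]
    rw [← Module.End.mul_apply, ← map_mul, inv_mul_cancel, map_one, Module.End.one_apply]

theorem permGL_mem {H : Subgroup (GLk 5)} (h1 : permGL 5 (Equiv.swap 0 1) ∈ H)
    (h2 : permGL 5 (finRotate 5) ∈ H) (σ : Equiv.Perm (Fin 5)) : permGL 5 σ ∈ H := by
  have h := Equiv.Perm.closure_cycle_adjacent_swap (σ := finRotate 5) (isCycle_finRotate)
    support_finRotate 0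
  have h3 : Subgroup.closure {finRotate 5, Equiv.swap 0 (finRotate 5 0)} ≤
      H.comap (permGL 5) := by
    rw [Subgroup.closure_le]
    rintro x (rfl | rfl)
    · exact h2
    · exact h1
  rw [h] at h3
  exact h3 (Subgroup.mem_top σ)

theorem exists_perm {i j : Fin 5} (h : i ≠ j) : ∃ σ : Equiv.Perm (Fin 5), σ 1 = i ∧ σ 0 = j := by
  refine ⟨Equiv.swap (Equiv.swap 0 j 1) i * Equiv.swap 0 j, ?_, ?_⟩
  · rw [Equiv.Perm.mul_apply, Equiv.swap_apply_left]
  · rw [Equiv.Perm.mul_apply, Equiv.swap_apply_left, Equiv.swap_apply_of_ne_of_ne ?_ h.symm]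
    intro h'
    have h'' : Equiv.swap 0 j 0 = Equiv.swap 0 j 1 := by rw [Equiv.swap_apply_left, ← h']
    exact absurd ((Equiv.swap 0 j).injective h'') (by decide)

theorem transvection_mul_permGL {i j : Fin 5} {σ : Equiv.Perm (Fin 5)} (h1 : σ 1 = i)
    (h0 : σ 0 = j) : Matrix.transvection i j 1 * (permGL 5 σ).val =
      (permGL 5 σ).val * Matrix.transvection 1 0 1 := by
  have h : (permGL 5 σ).val = (σ⁻¹).permMatrix (ZMod 2) := rfl
  rw [h, Matrix.transvection, Matrix.transvection, add_mul, mul_add, one_mul, mul_one]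
  congr 1
  subst h1 h0
  ext a b
  rw [Matrix.single_mul_eq_updateRow_zero, Matrix.mul_single_eq_updateCol_zero]
  by_cases ha : a = σ 1 <;> by_cases hb : b = 0 <;>
    simp [Matrix.updateRow_apply, Equiv.Perm.permMatrix,
      PEquiv.toMatrix_apply, ha, hb, eq_comm, Equiv.eq_symm_apply]

/-- `GL_5(F_2)` is generated by two permutations and a transvection. -/
theorem eq_top_of_generators {H : Subgroup (GLk 5)} (h1 : permGL 5 (Equiv.swap 0 1) ∈ H)
    (h2 : permGL 5 (finRotate 5) ∈ H) (h3 : addGL ∈ H) (g : GLk 5) : g ∈ H := by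
  have hdet : g.val.det ≠ 0 := by
    have := (Matrix.isUnit_iff_isUnit_det _).1 g.isUnit
    exact this.ne_zero
  refine Matrix.diagonal_transvection_induction_of_det_ne_zero
    (fun M => ∀ u : GLk 5, u.val = M → u ∈ H) g.val hdet ?_ ?_ ?_ g rfl
  · intro D hD u hu
    have hD1 : ∀ i, D i = 1 := by
      intro i
      rw [Matrix.det_diagonal] at hD
      have := Finset.prod_ne_zero_iff.1 hD i (Finset.mem_univ i)
      revert this
      generalize D i = x
      revert x
      decide
    have : u = 1 := by
      apply Units.ext
      rw [hu, show D = 1 from funext hD1]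
      exact Matrix.diagonal_one
    rw [this]
    exact H.one_mem
  · rintro ⟨i, j, hij, c⟩ u hu
    have hc : c = 0 ∨ c = 1 := (by decide : ∀ c : ZMod 2, c = 0 ∨ c = 1) c
    rcases hc with rfl | rfl
    · have : u = 1 := by
        apply Units.ext
        rw [hu]
        exact Matrix.transvection_zero i j
      rw [this]
      exact H.one_mem
    · obtain ⟨σ, hσ1, hσ0⟩ := exists_perm hij
      have h4 : u * permGL 5 σ = permGL 5 σ * addGL := by
        apply Units.ext
        rw [Units.val_mul, Units.val_mul, hu, addGL_val]
        exact transvection_mul_permGL hσ1 hσ0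
      have h5 := permGL_mem h1 h2 σ
      rw [eq_mul_inv_of_mul_eq h4]
      exact H.mul_mem (H.mul_mem h5 h3) (H.inv_mem h5)
  · intro A B hA hB ihA ihB u hu
    have e : u = Matrix.GeneralLinearGroup.mkOfDetNeZero A hA *
        Matrix.GeneralLinearGroup.mkOfDetNeZero B hB := Units.ext hu
    rw [e]
    exact H.mul_mem (ihA _ rfl) (ihB _ rfl)

/-- Hit polynomials that determine the classes of all monomials of degree 6. -/
def hits6 : List ℕ := [
  0x20008022000403000040420000612000042200002300000240000005010842101084400108402010802201004220008422,
  0x4612000441000042320004220000442230000122000022100003010000420180012010002200800300080042000c01,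
  0x100061210004101000232100022010004200180212010021000806120080410008023200802200080420000c212000821,
  0x100c012100801010040321004020100802001840120104010008c01200880100084032008402000880203000212200021,
  0x2000c2020008402000460000048000000a0030800122080010118001211000101080032108002011000203004012200401,
  0x20104200008c20200882000084602008440000884023000202200040210006001000802018020201004020080600008080,
  0x220802001180202110020010806021080400110040030042022004200100c2021008200100460210044001008400018420,
  0x21104000108c0021088000110800230040022008002100c000101000201840020108002008c00000900000014000308020,
  0x81088200110401020840121084018108801050000023080002210000211800001200000028000030840022084000118400,
  0x2004212100421810082100088210010421200842180088210110021020802121080218108041011042002084202108420,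
  0x100821]

/-- Monomials whose classes are a basis of the space of cohits of degree 6. -/
def basis6 : List ℕ := [
  99, 1091, 32835, 1048643, 3075, 34819, 1050627, 98307, 1114115, 3145731, 1122, 32866, 1048674,
  33858, 1049666, 1081410, 3106, 34850, 1050658, 98338, 1114146, 3145762, 35842, 1051650, 1083394,
  99330, 1115138, 3146754, 1146882, 3178498, 3168, 34912, 1050720, 98400, 1114208, 3145824, 35904,
  1051712, 1083456, 99392, 1115200, 3146816, 1146944, 3178560, 101376, 1117184, 3148800, 1148928,
  3180544, 3244032, 33827, 1049635, 1081379, 1082371, 1082402, 33889, 1049697, 1081441, 1082433,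
  35873, 1051681, 1083425, 99361, 1115169, 3146785, 1146913, 3178529, 1084417, 1147905, 3179521,
  1082464, 1084448, 1147936, 3179552]

set_option maxRecDepth 100000 in
theorem checks6 : (table basis6 hits6).force (fun t => allMem [checkTable t 6 basis6,
    rankGe (mapList (row t 74 [swapKey, cycleKey, transvectionKey]) basis6) .nil 0 74] id) =
    true := by
  decide +kernel

theorem allMem_spec {α : Type} {l : List α} {p : α → Bool} (h : allMem l p = true) {a : α}
    (ha : a ∈ l) : p a = true := by
  induction l with
  | nil => cases ha
  | cons b l ih =>
    have h := bool_rec_eq_true.1 h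
    rcases List.mem_cons.1 ha with rfl | ha
    · exact h.1
    · exact ih h.2 ha

/-- The codes of the monomials with the exponents in `L`. -/
noncomputable def keys (L : List (ℕ × ℕ × ℕ × ℕ × ℕ)) : List ℕ :=
  mapList (fun t => encode [t.1, t.2.1, t.2.2.1, t.2.2.2.1, t.2.2.2.2]) L

/-- Whether the class of the sum of the monomials `ks` is fixed by the elements of `gs`. -/
noncomputable def checkFixed (t : Trie) (gs : List (ℕ → List ℕ)) (ks : List ℕ) : Bool :=
  allMem gs fun g => Nat.beq (t.sumCode (imageList g ks)) (t.sumCode ks)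

theorem keys_spec {n : ℕ} (hn : n ≤ 31) {L : List (ℕ × ℕ × ℕ × ℕ × ℕ)}
    (h : ∀ t ∈ L, t.1 + t.2.1 + t.2.2.1 + t.2.2.2.1 + t.2.2.2.2 = n) :
    ofExponents L = ((keys L).map mon).sum ∧ ∀ x ∈ keys L, digitSum x = n := by
  induction L with
  | nil => exact ⟨rfl, fun x hx => by cases hx⟩
  | cons t L ih =>
    have ih := ih fun t ht => h t (List.mem_cons_of_mem _ ht)
    have hs : [t.1, t.2.1, t.2.2.1, t.2.2.2.1, t.2.2.2.2].sum = n := by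
      rw [← h t List.mem_cons_self]
      simp only [List.sum_cons, List.sum_nil]
      ring
    have hk : keys (t :: L) =
      encode [t.1, t.2.1, t.2.2.1, t.2.2.2.1, t.2.2.2.2] :: keys L := rfl
    rw [hk]
    constructor
    · rw [List.map_cons, List.sum_cons, ← ih.1, mon_encode rfl (hs.trans_le hn), ofExponents,
        ofExponents, List.map_cons, List.sum_cons]
      refine congrArg (· + _) ?_
      simp only [listMonomial, vars, List.zipWith_cons_cons, List.zipWith_nil_left, List.prod_cons,
        List.prod_nil]
      ring
    · intro x hx
      rcases List.mem_cons.1 hx with rfl | hx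
      · rw [digitSum_eq, digits_encode_of_sum rfl (hs.trans_le hn), hs]
      · exact ih.2 x hx

theorem imageList_eq (g : ℕ → List ℕ) (ks : List ℕ) : imageList g ks = ks.flatMap g := by
  have happ : ∀ l m : List ℕ, (List.rec m (fun x _ ih => x :: ih) l : List ℕ) = l ++ m := by
    intro l m
    induction l with
    | nil => rfl
    | cons x l ih => exact congrArg (x :: ·) ih
  induction ks with
  | nil => rfl
  | cons k ks ih =>
    rw [List.flatMap_cons, ← ih]
    exact happ _ _

theorem Realizes.imageList {n : ℕ} {g : GLk 5} {gk : ℕ → List ℕ} (hg : Realizes n g gk)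
    {ks : List ℕ} (hks : ∀ k ∈ ks, digitSum k = n) :
    subst g.val (ks.map mon).sum = ((imageList gk ks).map mon).sum ∧
      ∀ x ∈ imageList gk ks, digitSum x = n := by
  rw [imageList_eq]
  constructor
  · induction ks with
    | nil => exact map_zero _
    | cons k ks ih =>
      rw [List.map_cons, List.sum_cons, map_add, ih fun k hk => hks k (List.mem_cons_of_mem _ hk),
        (hg k (hks k List.mem_cons_self)).1, List.flatMap_cons, List.map_append, List.sum_append]
  · intro x hx
    obtain ⟨k, hk, hx⟩ := List.mem_flatMap.1 hx
    exact (hg k (hks k hk)).2 x hx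

theorem IsTable.coord_classOf {bs : List ℕ} {t : Trie} (ht : IsTable 17 bs t)
    {L : List (ℕ × ℕ × ℕ × ℕ × ℕ)}
    (h : ∀ t ∈ L, t.1 + t.2.1 + t.2.2.1 + t.2.2.2.1 + t.2.2.2.2 = 17) :
    ht.coord (classOf L h) = bits (t.sumCode (keys L)) := by
  have hL := keys_spec (by norm_num) h
  rw [← codeMap_sum t hL.2, ← hL.1]
  exact ht.coord_cohit (ofExponents_mem L h)

theorem IsTable.repQP_classOf {bs : List ℕ} {t : Trie} (ht : IsTable 17 bs t)
    {L : List (ℕ × ℕ × ℕ × ℕ × ℕ)}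
    (h : ∀ t ∈ L, t.1 + t.2.1 + t.2.2.1 + t.2.2.2.1 + t.2.2.2.2 = 17) {g : GLk 5}
    {gk : ℕ → List ℕ} (hg : Realizes 17 g gk) {gs : List (ℕ → List ℕ)}
    (hf : checkFixed t gs (keys L) = true) (hgs : gk ∈ gs) :
    repQP 5 17 g (classOf L h) = classOf L h := by
  have hL := keys_spec (by norm_num) h
  have hI := hg.imageList hL.2
  apply ht.coord_injective
  rw [ht.coord_classOf, ← Nat.eq_of_beq_eq_true (allMem_spec hf hgs), ← codeMap_sum t hI.2, ← hI.1,
    ← hL.1]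
  exact ht.coord_cohit (subst_mem g.val (ofExponents_mem L h))

set_option maxRecDepth 100000 in
theorem checks17 : (table basis17 hits17).force (fun t => allMem [checkTable t 17 basis17,
    rankGe (mapList (row t 566 [swapKey, cycleKey]) basis17) .nil 0 550,
    rankGe (mapList (row t 566 [swapKey, cycleKey, transvectionKey]) basis17) .nil 0 565,
    allMem (List.finRange 16) fun i => checkFixed t [swapKey, cycleKey] (keys (sigmaExponents i)),
    rankGe (mapList (fun i => t.sumCode (keys (sigmaExponents i))) (List.finRange 16)) .nil 0 16,
    checkFixed t [swapKey, cycleKey, transvectionKey] (keys glExponents),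
    Nat.ble 1 (t.sumCode (keys glExponents))] id) = true := by
  decide +kernel

theorem allMem_cons {b : Bool} {l : List Bool} :
    allMem (b :: l) id = true ↔ b = true ∧ allMem l id = true := bool_rec_eq_true

/-- The table of codes in degree 6. -/
noncomputable def table6 : Trie := table basis6 hits6

theorem checkTable6 : checkTable table6 6 basis6 = true ∧
    rankGe (mapList (row table6 74 [swapKey, cycleKey, transvectionKey]) basis6) .nil 0 74 =
      true := by
  have h := checks6
  rw [Trie.force_eq, ← table6, allMem_cons, allMem_cons] at h
  exact ⟨h.1, h.2.1⟩

theorem isTable6 : IsTable 6 basis6 table6 := isTable (by norm_num) checkTable6.1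

theorem ne_zero_of_ble {n : ℕ} (h : Nat.ble 1 n = true) : n ≠ 0 := by
  rintro rfl
  cases h

/-- The table of codes in degree 17. -/
noncomputable def table17 : Trie := table basis17 hits17

theorem checkTable17 : checkTable table17 17 basis17 = true ∧
    rankGe (mapList (row table17 566 [swapKey, cycleKey]) basis17) .nil 0 550 = true ∧
    rankGe (mapList (row table17 566 [swapKey, cycleKey, transvectionKey]) basis17) .nil 0 565 =
      true ∧
    (∀ i, checkFixed table17 [swapKey, cycleKey] (keys (sigmaExponents i)) = true) ∧
    rankGe (mapList (fun i => table17.sumCode (keys (sigmaExponents i))) (List.finRange 16))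
      .nil 0 16 = true ∧
    checkFixed table17 [swapKey, cycleKey, transvectionKey] (keys glExponents) = true ∧
    table17.sumCode (keys glExponents) ≠ 0 := by
  have h := checks17
  rw [Trie.force_eq, ← table17] at h
  simp only [allMem_cons] at h
  obtain ⟨h1, h2, h3, h4, h5, h6, h7, -⟩ := h
  exact ⟨h1, h2, h3, fun i => allMem_spec h4 (List.mem_finRange i), h5, h6,
    ne_zero_of_ble h7⟩

theorem isTable17 : IsTable 17 basis17 table17 := isTable (by norm_num) checkTable17.1

set_option maxRecDepth 100000 in
theorem length_basis17 : basis17.length = 566 := rfl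

theorem length_basis6 : basis6.length = 74 := by decide +kernel

theorem mem_glInvariants {n : ℕ} {v : QP 5 n} :
    v ∈ glInvariants 5 n ↔ ∀ g, repQP 5 n g v = v := Iff.rfl

theorem mem_sigmaInvariants {n : ℕ} {v : QP 5 n} :
    v ∈ sigmaInvariants 5 n ↔ ∀ σ, repQP 5 n (permGL 5 σ) v = v := Iff.rfl

/-- Generators of the symmetric group together with their actions on codes. -/
noncomputable def sigmaGens : List (GLk 5 × (ℕ → List ℕ)) :=
  [(permGL 5 (Equiv.swap 0 1), swapKey), (permGL 5 (finRotate 5), cycleKey)]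

/-- Generators of the general linear group together with their actions on codes. -/
noncomputable def glGens : List (GLk 5 × (ℕ → List ℕ)) :=
  [(permGL 5 (Equiv.swap 0 1), swapKey), (permGL 5 (finRotate 5), cycleKey),
    (addGL, transvectionKey)]

theorem map_snd_sigmaGens : sigmaGens.map Prod.snd = [swapKey, cycleKey] := rfl

theorem map_snd_glGens : glGens.map Prod.snd = [swapKey, cycleKey, transvectionKey] := rfl

theorem realizes_sigmaGens {n : ℕ} (hn : n ≤ 31) : ∀ g ∈ sigmaGens, Realizes n g.1 g.2 := by
  simp only [sigmaGens, List.mem_cons, List.not_mem_nil, or_false, forall_eq_or_imp, forall_eq]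
  exact ⟨realizes_swap hn, realizes_cycle hn⟩

theorem realizes_glGens {n : ℕ} (hn : n ≤ 31) : ∀ g ∈ glGens, Realizes n g.1 g.2 := by
  simp only [glGens, List.mem_cons, List.not_mem_nil, or_false, forall_eq_or_imp, forall_eq]
  exact ⟨realizes_swap hn, realizes_cycle hn, realizes_add hn⟩

theorem repQP_sigmaGens {n : ℕ} {v : QP 5 n} (hv : v ∈ sigmaInvariants 5 n) :
    ∀ g ∈ sigmaGens, repQP 5 n g.1 v = v := by
  simp only [sigmaGens, List.mem_cons, List.not_mem_nil, or_false, forall_eq_or_imp, forall_eq]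
  exact ⟨mem_sigmaInvariants.1 hv _, mem_sigmaInvariants.1 hv _⟩

theorem finrank_glInvariants_6 : Module.finrank (ZMod 2) (glInvariants 5 6) = 0 := by
  have := isTable6.finrank_invariants_add_le glGens (d := 74) (r := 74)
    (realizes_glGens (by norm_num)) (by rw [map_snd_glGens]; exact checkTable6.2)
    (W := glInvariants 5 6) fun v hv g _ => mem_glInvariants.1 hv g.1
  rw [length_basis6] at this
  omega

set_option maxRecDepth 100000 in
theorem finrank_sigmaInvariants_le : Module.finrank (ZMod 2) (sigmaInvariants 5 17) ≤ 16 := by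
  have := isTable17.finrank_invariants_add_le sigmaGens (d := 566) (r := 550)
    (realizes_sigmaGens (by norm_num)) (by rw [map_snd_sigmaGens]; exact checkTable17.2.1)
    (W := sigmaInvariants 5 17) fun v hv => repQP_sigmaGens hv
  rw [length_basis17] at this
  omega

set_option maxRecDepth 100000 in
theorem finrank_glInvariants_le : Module.finrank (ZMod 2) (glInvariants 5 17) ≤ 1 := by
  have := isTable17.finrank_invariants_add_le glGens (d := 566) (r := 565)
    (realizes_glGens (by norm_num)) (by rw [map_snd_glGens]; exact checkTable17.2.2.1)
    (W := glInvariants 5 17) fun v hv g _ => mem_glInvariants.1 hv g.1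
  rw [length_basis17] at this
  omega

theorem sigmaClass_mem (i : Fin 16) : sigmaClass i ∈ sigmaInvariants 5 17 := by
  have hf := checkTable17.2.2.2.1 i
  refine mem_sigmaInvariants.2 fun σ => permGL_mem (H := stabilizer (sigmaClass i)) ?_ ?_ σ
  · exact isTable17.repQP_classOf _ (realizes_swap (by norm_num)) hf (by simp)
  · exact isTable17.repQP_classOf _ (realizes_cycle (by norm_num)) hf (by simp)

theorem glClass_mem : glClass ∈ glInvariants 5 17 := by
  have hf := checkTable17.2.2.2.2.2.1
  refine mem_glInvariants.2 fun g => eq_top_of_generators (H := stabilizer glClass) ?_ ?_ ?_ g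
  · exact isTable17.repQP_classOf _ (realizes_swap (by norm_num)) hf (by simp)
  · exact isTable17.repQP_classOf _ (realizes_cycle (by norm_num)) hf (by simp)
  · exact isTable17.repQP_classOf _ (realizes_add (by norm_num)) hf (by simp)

theorem glClass_ne_zero : glClass ≠ 0 := by
  intro h
  have h1 : bits (table17.sumCode (keys glExponents)) = bits 0 := by
    rw [← isTable17.coord_classOf glExponents_degree, ← glClass, h, map_zero, bits_zero]
  exact checkTable17.2.2.2.2.2.2 (bits_injective h1)

theorem linearIndependent_sigmaClass : LinearIndependent (ZMod 2) sigmaClass := by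
  refine LinearIndependent.of_comp isTable17.coord ?_
  rw [linearIndependent_iff_card_le_finrank_span, Fintype.card_fin]
  have := FiniteDimensional.span_of_finite (ZMod 2)
    (Set.finite_range (isTable17.coord ∘ sigmaClass))
  refine le_finrank_of_rankGe (fun v hv => ?_) checkTable17.2.2.2.2.1
  rw [mapList_eq] at hv
  obtain ⟨i, -, rfl⟩ := List.mem_map.1 hv
  rw [← isTable17.coord_classOf (sigmaExponents_degree i)]
  exact Submodule.subset_span ⟨i, rfl⟩

theorem span_sigmaClass :
    Submodule.span (ZMod 2) (Set.range sigmaClass) = sigmaInvariants 5 17 := by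
  have := isTable17.finite
  refine Submodule.eq_of_le_of_finrank_le ?_ ?_
  · rw [Submodule.span_le]
    rintro _ ⟨i, rfl⟩
    exact sigmaClass_mem i
  · rw [finrank_span_eq_card linearIndependent_sigmaClass, Fintype.card_fin]
    exact finrank_sigmaInvariants_le

theorem finrank_sigmaInvariants : Module.finrank (ZMod 2) (sigmaInvariants 5 17) = 16 := by
  rw [← span_sigmaClass, finrank_span_eq_card linearIndependent_sigmaClass, Fintype.card_fin]

theorem span_glClass : Submodule.span (ZMod 2) {glClass} = glInvariants 5 17 := by
  have := isTable17.finite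
  refine Submodule.eq_of_le_of_finrank_le ?_ ?_
  · rw [Submodule.span_singleton_le_iff_mem]
    exact glClass_mem
  · rw [finrank_span_singleton glClass_ne_zero]
    exact finrank_glInvariants_le

theorem finrank_glInvariants : Module.finrank (ZMod 2) (glInvariants 5 17) = 1 := by
  rw [← span_glClass, finrank_span_singleton glClass_ne_zero]

theorem halve_eq_zero {a b c d e : ℕ} (h : Even a ∨ Even b ∨ Even c ∨ Even d ∨ Even e) :
    halve 5 (X 0 ^ a * X 1 ^ b * X 2 ^ c * X 3 ^ d * X 4 ^ e) = 0 := by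
  have hm : (X 0 ^ a * X 1 ^ b * X 2 ^ c * X 3 ^ d * X 4 ^ e : P 5) =
      monomial (Finsupp.equivFunOnFinite.symm ![a, b, c, d, e]) 1 := by
    rw [monomial_eq, Finsupp.prod_fintype _ _ (by simp), Fin.prod_univ_five]
    simp
  rw [hm, halve_monomial, if_neg]
  intro hodd
  have h0 := hodd 0
  have h1 := hodd 1
  have h2 := hodd 2
  have h3 := hodd 3
  have h4 := hodd 4
  simp only [Finsupp.equivFunOnFinite_symm_apply_apply] at h0 h1 h2 h3 h4
  rcases h with h | h | h | h | h
  · exact Nat.not_odd_iff_even.2 h h0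
  · exact Nat.not_odd_iff_even.2 h h1
  · exact Nat.not_odd_iff_even.2 h h2
  · exact Nat.not_odd_iff_even.2 h h3
  · exact Nat.not_odd_iff_even.2 h h4

set_option maxRecDepth 20000 in
theorem glExponents_even : ∀ t ∈ glExponents,
    Even t.1 ∨ Even t.2.1 ∨ Even t.2.2.1 ∨ Even t.2.2.2.1 ∨ Even t.2.2.2.2 := by
  decide +kernel

theorem kameko_glClass : kameko (k := 5) (n := 17) (m := 6) rfl glClass = 0 := by
  have h : halve 5 (ofExponents glExponents) = 0 := by
    rw [ofExponents, map_list_sum, List.map_map]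
    refine List.sum_eq_zero fun x hx => ?_
    obtain ⟨t, ht, rfl⟩ := List.mem_map.1 hx
    exact halve_eq_zero (glExponents_even t ht)
  refine (Submodule.Quotient.mk_eq_zero (hitDeg 5 6)).2 ?_
  change halve 5 (ofExponents glExponents) ∈ hit 5
  rw [h]
  exact Submodule.zero_mem _

theorem glInvariants_le_ker_kameko :
    glInvariants 5 17 ≤ LinearMap.ker (kameko (k := 5) (n := 17) (m := 6) rfl) := by
  rw [← span_glClass, Submodule.span_singleton_le_iff_mem]
  exact kameko_glClass

end HitProblem

theorem mainTheorem3 :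
    -- the whole space of cohits of degree 17
    Module.finrank (ZMod 2) (HitProblem.QP 5 17) = 566 ∧
    -- the `Σ_5`-invariants of degree 17, with an explicit basis
    Module.finrank (ZMod 2) (HitProblem.sigmaInvariants 5 17) = 16 ∧
    LinearIndependent (ZMod 2) HitProblem.sigmaClass ∧
    Submodule.span (ZMod 2) (Set.range HitProblem.sigmaClass) =
      HitProblem.sigmaInvariants 5 17 ∧
    -- the `GL_5(F_2)`-invariants of degree 17
    Module.finrank (ZMod 2) (HitProblem.glInvariants 5 17) = 1 ∧
    Submodule.span (ZMod 2) {HitProblem.glClass} = HitProblem.glInvariants 5 17 ∧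
    -- the `GL_5(F_2)`-invariants of degree 6
    HitProblem.glInvariants 5 6 = ⊥ ∧
    -- the `GL_5(F_2)`-invariants of the kernel of the Kameko map of degree 17
    Module.finrank (ZMod 2)
      (LinearMap.ker (HitProblem.kameko (k := 5) (n := 17) (m := 6) rfl) ⊓
        HitProblem.glInvariants 5 17 : Submodule (ZMod 2) (HitProblem.QP 5 17)) = 1 := by
  have := HitProblem.isTable6.finite
  refine ⟨?_, HitProblem.finrank_sigmaInvariants, HitProblem.linearIndependent_sigmaClass,
    HitProblem.span_sigmaClass, HitProblem.finrank_glInvariants, HitProblem.span_glClass,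
    Submodule.finrank_eq_zero.1 HitProblem.finrank_glInvariants_6, ?_⟩
  · rw [HitProblem.isTable17.finrank_eq, HitProblem.length_basis17]
  · rw [inf_eq_right.2 HitProblem.glInvariants_le_ker_kameko, HitProblem.finrank_glInvariants]
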